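/- **Definitions.** Let $k\in\mathbb N$. A $k$-graph $(\Lambda,d)$ is a countable category $\Lambda$ with range and source maps $r,s$ and a functor $d:\Lambda\to\mathbb N^k$ such that, whenever $d(\lambda)=m+n$, there are unique $\mu,\nu\in\Lambda$ with $\lambda=\mu\nu$, $d(\mu)=m$ and $d(\nu)=n$; the objects (vertices) are identified with the set $\Lambda^0$ of paths of degree $0$. Write $\Lambda^m(v)$ for the set of $\lambda$ with $d(\lambda)=m$ and $r(\lambda)=v$, let $e_1,\dots,e_k$ be the standard basis of $\mathbb N^k$, and for $q\in\mathbb N^k$ and $v\in\Lambda^0$ put $$\Lambda^{\le q}(v)=\{\lambda: r(\lambda)=v,\ d(\lambda)\le q,\ \Lambda^{e_i}(s(\lambda))=\emptyset\text{ whenever }d(\lambda)+e_i\le q\}.$$ $\Lambda$ is row-finite if every $\Lambda^m(v)$ is finite, and locally convex if for all $v\in\Lambda^0$, $i\ne j$, $\lambda\in\Lambda^{e_i}(v)$ and $\mu\in\Lambda^{e_j}(v)$ the sets $\Lambda^{e_j}(s(\lambda))$ and $\Lambda^{e_i}(s(\mu))$ are nonempty. For row-finite $\Lambda$, $C^*(\Lambda)$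 is the $C^*$-algebra generated by a universal family of partial isometries $\{s_\lambda:\lambda\in\Lambda\}$ such that the $s_v$ $(v\in\Lambda^0)$ are mutually orthogonal projections, $s_{\lambda\mu}=s_\lambda s_\mu$ if $s(\lambda)=r(\mu)$, $s_\lambda^*s_\lambda=s_{s(\lambda)}$, and $s_v=\sum_{\lambda\in\Lambda^{\le m}(v)}s_\lambda s_\lambda^*$ for all $v\in\Lambda^0$ and $m\in\mathbb N^k$. Its gauge action $\gamma$ of $\mathbb T^k$ is given by $\gamma_z(s_\lambda)=z^{d(\lambda)}s_\lambda$; an ideal $I$ is gauge-invariant if $\gamma_z(I)\subseteq I$ for all $z\in\mathbb T^k$. A set $H\subseteq\Lambda^0$ is hereditary if $r(\lambda)\in H$ implies $s(\lambda)\in H$ for all $\lambda\in\Lambda$; it is saturated if $v\in H$ whenever $v\in\Lambda^0$ and $\{s(\lambda):\lambda\in\Lambda^{\le e_i}(v)\}\subseteq H$ for some $i$. **Theorem.** Let $(\Lambda,d)$ be a locally convex row-finite $k$-graph. For $H\subseteq\Lambda^0$ let $I_H$ be the closed two-sided ideal of $C^*(\Lambda)$ generated by $\{s_v:v\in H\}$.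 (a) The map $H\mapsto I_H$ is an isomorphism of the lattice of saturated hereditary subsets of $\Lambda^0$ onto the lattice of closed gauge-invariant ideals of $C^*(\Lambda)$ (both ordered by inclusion). (b) Let $H$ be saturated and hereditary. Then $\Gamma(\Lambda\setminus H):=(\Lambda^0\setminus H,\{\lambda\in\Lambda:s(\lambda)\notin H\},r,s)$ is a locally convex row-finite $k$-graph, and there is a $*$-isomorphism of $C^*(\Lambda)/I_H$ onto $C^*(\Gamma(\Lambda\setminus H))$ that maps $s_\lambda+I_H$ to the generator $s_\lambda$ of $C^*(\Gamma(\Lambda\setminus H))$ for every $\lambda$ with $s(\lambda)\notin H$. (c) Let $H$ be hereditary. Then $\Lambda(H):=(H,\{\lambda\in\Lambda:r(\lambda)\in H\},r,s)$ is a locally convex row-finite $k$-graph; there is a $*$-isomorphism of $C^*(\Lambda(H))$ onto the $C^*$-subalgebra $C^*(\{s_\lambda:r(\lambda)\in H\})$ of $C^*(\Lambda)$ that maps generators $s_\lambda$ to $s_\lambda$; and this subalgebra is a full corner of $I_H$, that is, it is contained in $I_H$, it equals $pI_Hp$ for some projection $p$ in the multiplier algebra of $I_H$, and no proper closed two-sided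 ideal of $I_H$ contains it. -/

import Mathlib

open CategoryTheory

universe u v w

noncomputable section

namespace HigherRank

/-! ### Higher-rank graphs

A path `l : w ⟶ v` of the category `Λ` has range `r(l) = v` and source `s(l) = w`.  The product
`l m` of two paths with `s(l) = r(m)` is the composite of `m` followed by `l`, that is `m ≫ l`. -/

/-- A functor from the category `Λ` to the additive monoid `ℕ ^ k`. -/
structure DegreeMap (k : ℕ) (Λ : Type u) [Category.{v} Λ] where
  deg : ∀ {w v : Λ}, (w ⟶ v) → (Fin k → ℕ)
  deg_id : ∀ v : Λ, deg (𝟙 v) = 0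
  deg_comp : ∀ {u w v : Λ} (m : u ⟶ w) (l : w ⟶ v), deg (m ≫ l) = deg l + deg m

/-- The basis vector `e_i` of `ℕ ^ k`. -/
abbrev basisVec {k : ℕ} (i : Fin k) : Fin k → ℕ := Pi.single i 1

namespace DegreeMap

variable {k : ℕ} {Λ : Type u} [Category.{v} Λ] (d : DegreeMap k Λ)

/-- `(Λ, d)` is a `k`-graph: `Λ` is countable, and `d` has the factorisation property. -/
structure IsKGraph : Prop where
  countable_obj : Countable Λ
  countable_hom : ∀ w v : Λ, Countable (w ⟶ v)
  factorisation : ∀ {w v : Λ} (l : w ⟶ v) (m n : Fin k → ℕ), d.deg l = m + n →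
    ∃! p : Σ u : Λ, (w ⟶ u) × (u ⟶ v),
      p.2.1 ≫ p.2.2 = l ∧ d.deg p.2.2 = m ∧ d.deg p.2.1 = n

/-- `Λ^m(v)`: the paths of degree `m` with range `v`; a path with range `v` is given together with
its source. -/
def paths (m : Fin k → ℕ) (v : Λ) : Set (Σ w : Λ, (w ⟶ v)) :=
  {l | d.deg l.2 = m}

/-- `Λ^{≤ q}(v)`. -/
def pathsUpTo (q : Fin k → ℕ) (v : Λ) : Set (Σ w : Λ, (w ⟶ v)) :=
  {l | d.deg l.2 ≤ q ∧ ∀ i, d.deg l.2 + basisVec i ≤ q → d.paths (basisVec i) l.1 = ∅}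

def RowFinite : Prop :=
  ∀ (v : Λ) (m : Fin k → ℕ), (d.paths m v).Finite

def LocallyConvex : Prop :=
  ∀ (v : Λ) (i j : Fin k), i ≠ j →
    ∀ l ∈ d.paths (basisVec i) v, ∀ m ∈ d.paths (basisVec j) v,
      (d.paths (basisVec j) l.1).Nonempty ∧ (d.paths (basisVec i) m.1).Nonempty

/-- The full subcategory of `Λ` on a set `S` of vertices, with the degree map of `Λ`.

If `H` is hereditary, then a path with source outside `H` has range outside `H`, and a path with
range in `H` has source in `H`.  So the paths of `d.restrict Hᶜ` are the paths of `Λ` with source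
outside `H` (this is `Γ(Λ ∖ H)`), and the paths of `d.restrict H` are the paths of `Λ` with range
in `H` (this is `Λ(H)`). -/
def restrict (S : Set Λ) :
    DegreeMap k (ObjectProperty.FullSubcategory (fun v : Λ => v ∈ S)) where
  deg l := d.deg l.hom
  deg_id v := d.deg_id v.obj
  deg_comp m l := d.deg_comp m.hom l.hom

end DegreeMap

/-! ### Saturated hereditary sets of vertices -/

/-- `H` is hereditary: if a path has its range in `H`, then it has its source in `H`. -/
def Hereditary {Λ : Type u} [Category.{v} Λ] (H : Set Λ) : Prop :=
  ∀ ⦃w v : Λ⦄, (w ⟶ v) → v ∈ H → w ∈ H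

namespace DegreeMap

variable {k : ℕ} {Λ : Type u} [Category.{v} Λ] (d : DegreeMap k Λ)

def Saturated (H : Set Λ) : Prop :=
  ∀ (v : Λ) (i : Fin k), (∀ l ∈ d.pathsUpTo (basisVec i) v, l.1 ∈ H) → v ∈ H

/-- The saturated hereditary subsets of the vertex set, ordered by inclusion. -/
def SatHered : Type u := {H : Set Λ // Hereditary H ∧ d.Saturated H}

instance : PartialOrder d.SatHered := inferInstanceAs (PartialOrder (Subtype _))

instance : InfSet d.SatHered where
  sInf 𝒮 := ⟨⋂ H ∈ 𝒮, H.1,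
    fun _ _ l hv => Set.mem_iInter₂.2 fun H hH => H.2.1 l (Set.mem_iInter₂.1 hv H hH),
    fun v i h => Set.mem_iInter₂.2 fun H hH =>
      H.2.2 v i fun l hl => Set.mem_iInter₂.1 (h l hl) H hH⟩

/-- The lattice of saturated hereditary sets: meets are intersections. -/
instance : CompleteLattice d.SatHered :=
  completeLatticeOfInf _ fun _ =>
    ⟨fun H hH _ hv => Set.mem_iInter₂.1 hv H hH,
      fun _ hK _ hv => Set.mem_iInter₂.2 fun _ hH => hK hH hv⟩

end DegreeMap

/-! ### Closed ideals of a C*-algebra -/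

/-- A norm-closed two-sided ideal of a C*-algebra. -/
structure ClosedIdeal (A : Type u) [NonUnitalCStarAlgebra A] extends Submodule ℂ A where
  mul_mem_left' : ∀ (a : A) {x : A}, x ∈ carrier → a * x ∈ carrier
  mul_mem_right' : ∀ {x : A} (a : A), x ∈ carrier → x * a ∈ carrier
  isClosed' : IsClosed carrier

namespace ClosedIdeal

variable {A : Type u} [NonUnitalCStarAlgebra A]

instance : SetLike (ClosedIdeal A) A where
  coe I := I.carrier
  coe_injective I J h := by
    cases I; cases J
    congr 1
    exact SetLike.coe_injective h

instance : PartialOrder (ClosedIdeal A) := .ofSetLike (ClosedIdeal A) A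

instance : AddSubgroupClass (ClosedIdeal A) A where
  add_mem {I} _ _ ha hb := I.toSubmodule.add_mem ha hb
  zero_mem I := I.toSubmodule.zero_mem
  neg_mem {I} _ ha := I.toSubmodule.neg_mem ha

instance : SMulMemClass (ClosedIdeal A) ℂ A where
  smul_mem {I} c _ ha := I.toSubmodule.smul_mem c ha

theorem mul_mem_left (I : ClosedIdeal A) (a : A) {x : A} (hx : x ∈ I) : a * x ∈ I :=
  I.mul_mem_left' a hx

theorem mul_mem_right (I : ClosedIdeal A) {x : A} (a : A) (hx : x ∈ I) : x * a ∈ I :=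
  I.mul_mem_right' a hx

instance : NonUnitalSubringClass (ClosedIdeal A) A where
  mul_mem {I} a _ _ hb := I.mul_mem_left a hb

instance isClosed (I : ClosedIdeal A) : IsClosed (I : Set A) := I.isClosed'

instance : InfSet (ClosedIdeal A) where
  sInf 𝒮 :=
    { carrier := ⋂ I ∈ 𝒮, (I : Set A)
      add_mem' := fun ha hb => Set.mem_iInter₂.2 fun I hI =>
        add_mem (Set.mem_iInter₂.1 ha I hI) (Set.mem_iInter₂.1 hb I hI)
      zero_mem' := Set.mem_iInter₂.2 fun I _ => zero_mem I
      smul_mem' := fun c _ ha => Set.mem_iInter₂.2 fun I hI =>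
        SMulMemClass.smul_mem c (Set.mem_iInter₂.1 ha I hI)
      mul_mem_left' := fun a _ hx => Set.mem_iInter₂.2 fun I hI =>
        I.mul_mem_left a (Set.mem_iInter₂.1 hx I hI)
      mul_mem_right' := fun a hx => Set.mem_iInter₂.2 fun I hI =>
        I.mul_mem_right a (Set.mem_iInter₂.1 hx I hI)
      isClosed' := isClosed_biInter fun I _ => I.isClosed }

/-- The lattice of closed ideals: meets are intersections. -/
instance : CompleteLattice (ClosedIdeal A) :=
  completeLatticeOfInf _ fun _ =>
    ⟨fun I hI _ hv => Set.mem_iInter₂.1 hv I hI,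
      fun _ hK _ hv => Set.mem_iInter₂.2 fun _ hI => hK hI hv⟩

theorem mem_sInf {𝒮 : Set (ClosedIdeal A)} {x : A} : x ∈ sInf 𝒮 ↔ ∀ I ∈ 𝒮, x ∈ I :=
  Set.mem_iInter₂

/-- The closed ideal generated by a set. -/
def generatedBy (S : Set A) : ClosedIdeal A :=
  sInf {I | S ⊆ I}

/-- The elements of `I` whose adjoint is in `I`; by `star_mem` this is all of `I`. -/
def symmPart (I : ClosedIdeal A) : NonUnitalStarSubalgebra ℂ A where
  carrier := {x | x ∈ I ∧ star x ∈ I}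
  add_mem' ha hb := ⟨add_mem ha.1 hb.1, by rw [star_add]; exact add_mem ha.2 hb.2⟩
  zero_mem' := ⟨zero_mem I, by rw [star_zero]; exact zero_mem I⟩
  mul_mem' ha hb := ⟨mul_mem ha.1 hb.1, by rw [star_mul]; exact mul_mem hb.2 ha.2⟩
  smul_mem' c _ ha :=
    ⟨SMulMemClass.smul_mem c ha.1, by rw [star_smul]; exact SMulMemClass.smul_mem _ ha.2⟩
  star_mem' ha := ⟨ha.2, by rw [star_star]; exact ha.1⟩

instance (I : ClosedIdeal A) : IsClosed (I.symmPart : Set A) :=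
  I.isClosed.inter (I.isClosed.preimage continuous_star)

/-- Closed ideals of C*-algebras are self-adjoint. -/
theorem star_mem (I : ClosedIdeal A) {a : A} (ha : a ∈ I) : star a ∈ I := by
  let _ : PartialOrder I.symmPart := CStarAlgebra.spectralOrder _
  have _ : StarOrderedRing I.symmPart := CStarAlgebra.spectralOrderedRing _
  let b : I.symmPart := ⟨a * star a, I.mul_mem_right _ ha, by
    rw [star_mul, star_star]; exact I.mul_mem_right _ ha⟩
  have hu := CStarAlgebra.increasingApproximateUnit I.symmPart
  have hb : Filter.Tendsto (fun e : I.symmPart => 2 * ‖b * e - b‖)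
      (CStarAlgebra.approximateUnit I.symmPart) (nhds 0) := by
    have h1 := (hu.toIsApproximateUnit.tendsto_mul_left b).sub_const b
    simpa using (h1.norm).const_mul 2
  have key : ∀ᶠ e : I.symmPart in CStarAlgebra.approximateUnit I.symmPart,
      ‖star a * (e : A) - star a‖ ^ 2 ≤ 2 * ‖b * e - b‖ := by
    filter_upwards [hu.eventually_norm, hu.eventually_star_eq] with e he hse
    have hse' : star (e : A) = e := congrArg Subtype.val hse
    have he' : ‖(e : A)‖ ≤ 1 := he
    have h2 : star (star a * (e : A) - star a) * (star a * (e : A) - star a)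
        = (e : A) * (a * star a * e - a * star a) - (a * star a * e - a * star a) := by
      simp only [star_sub, star_mul, star_star, hse']
      noncomm_ring
    have h3 : ‖b * e - b‖ = ‖a * star a * (e : A) - a * star a‖ := rfl
    rw [sq, ← CStarRing.norm_star_mul_self, h2, h3]
    calc _ ≤ ‖(e : A) * (a * star a * e - a * star a)‖ + ‖a * star a * (e : A) - a * star a‖ :=
          norm_sub_le _ _
      _ ≤ 1 * ‖a * star a * (e : A) - a * star a‖ + ‖a * star a * (e : A) - a * star a‖ := by
          gcongr
          exact (norm_mul_le _ _).trans (by gcongr)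
      _ = _ := by ring
  have h0 : Filter.Tendsto (fun e : I.symmPart => ‖star a * (e : A) - star a‖ ^ 2)
      (CStarAlgebra.approximateUnit I.symmPart) (nhds 0) :=
    squeeze_zero' (Filter.Eventually.of_forall fun _ => by positivity) key hb
  have h1 : Filter.Tendsto (fun e : I.symmPart => star a * (e : A))
      (CStarAlgebra.approximateUnit I.symmPart) (nhds (star a)) := by
    rw [tendsto_iff_norm_sub_tendsto_zero]
    have := h0.sqrt
    simpa [Real.sqrt_sq] using this
  exact I.isClosed.mem_of_tendsto h1
    (Filter.Eventually.of_forall fun e => I.mul_mem_left _ e.2.1)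

/-- So a closed ideal is itself a C*-algebra (through the instance for closed subalgebras). -/
instance : StarMemClass (ClosedIdeal A) A where
  star_mem {I} _ ha := I.star_mem ha

/-- The quotient of a C*-algebra by a closed ideal. -/
def Quotient (I : ClosedIdeal A) : Type u := A ⧸ I.toSubmodule

namespace Quotient

variable (I : ClosedIdeal A)

instance : AddCommGroup I.Quotient := inferInstanceAs (AddCommGroup (A ⧸ I.toSubmodule))

instance : Module ℂ I.Quotient := inferInstanceAs (Module ℂ (A ⧸ I.toSubmodule))

/-- The class `a + I`. -/
def mk : A →ₗ[ℂ] I.Quotient := I.toSubmodule.mkQ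

theorem mk_eq {a b : A} : mk I a = mk I b ↔ a - b ∈ I :=
  Submodule.Quotient.eq _

/-- `(a + I) (b + I) = a b + I`. -/
instance : Mul I.Quotient where
  mul := Quotient.map₂ (· * ·) (fun a a' ha b b' hb => by
    have ha' : a - a' ∈ I := (Submodule.quotientRel_def _).1 ha
    have hb' : b - b' ∈ I := (Submodule.quotientRel_def _).1 hb
    refine (Submodule.quotientRel_def _).2 ?_
    have h : a * b - a' * b' = (a - a') * b + a' * (b - b') := by noncomm_ring
    change a * b - a' * b' ∈ I
    rw [h]
    exact add_mem (I.mul_mem_right _ ha') (I.mul_mem_left _ hb'))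

/-- `(a + I)* = a* + I`. -/
instance : Star I.Quotient where
  star := Quotient.map star (fun a a' ha => by
    have ha' : a - a' ∈ I := (Submodule.quotientRel_def _).1 ha
    refine (Submodule.quotientRel_def _).2 ?_
    change star a - star a' ∈ I
    rw [← star_sub]
    exact I.star_mem ha')

theorem mk_mul (a b : A) : mk I (a * b) = mk I a * mk I b := rfl

theorem mk_star (a : A) : mk I (star a) = star (mk I a) := rfl

end Quotient

end ClosedIdeal

/-- The closed *-subalgebra `C*(S)` generated by a subset `S` of a C*-algebra. -/
def generatedCStar {A : Type u} [NonUnitalCStarAlgebra A] (S : Set A) :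
    NonUnitalStarSubalgebra ℂ A :=
  (NonUnitalStarAlgebra.adjoin ℂ S).topologicalClosure

instance {A : Type u} [NonUnitalCStarAlgebra A] (S : Set A) :
    IsClosed (generatedCStar S : Set A) :=
  NonUnitalStarSubalgebra.isClosed_topologicalClosure _

/-- The subalgebra `B` of `A` is a corner: `B = p A p` for a projection `p` in the multiplier
algebra of `A`. -/
def IsCorner {A : Type u} [NonUnitalCStarAlgebra A] (B : NonUnitalStarSubalgebra ℂ A) : Prop :=
  ∃ p : DoubleCentralizer ℂ A, IsStarProjection p ∧
    ∀ b : A, b ∈ B ↔ ∃ a : A, (b : DoubleCentralizer ℂ A) = p * (a : DoubleCentralizer ℂ A) * p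

/-- A corner is full if it is contained in no proper closed ideal. -/
def IsFullCorner {A : Type u} [NonUnitalCStarAlgebra A] (B : NonUnitalStarSubalgebra ℂ A) :
    Prop :=
  IsCorner B ∧ ∀ J : ClosedIdeal A, (B : Set A) ⊆ J → J = ⊤

/-! ### Cuntz-Krieger families -/

namespace DegreeMap

variable {k : ℕ} {Λ : Type u} [Category.{v} Λ] (d : DegreeMap k Λ)

/-- The Cuntz-Krieger relations for `t`, where each equation `a = b` is read as `E a b`.  If `Λ` is
row-finite, then the set `Λ^{≤ m}(v)` is finite, and `T` in the last relation is this set. -/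
structure CKRelations {B : Type w} [NonUnitalRing B] [Star B] (E : B → B → Prop)
    (t : ∀ ⦃w v : Λ⦄, (w ⟶ v) → B) : Prop where
  partial_isometry : ∀ ⦃w v : Λ⦄ (l : w ⟶ v), E (t l * star (t l) * t l) (t l)
  vertex_mul_self : ∀ v : Λ, E (t (𝟙 v) * t (𝟙 v)) (t (𝟙 v))
  vertex_star : ∀ v : Λ, E (star (t (𝟙 v))) (t (𝟙 v))
  vertex_orthogonal : ∀ v v' : Λ, v ≠ v' → E (t (𝟙 v) * t (𝟙 v')) 0
  comp : ∀ ⦃u w v : Λ⦄ (l : w ⟶ v) (m : u ⟶ w), E (t (m ≫ l)) (t l * t m)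
  star_mul_self : ∀ ⦃w v : Λ⦄ (l : w ⟶ v), E (star (t l) * t l) (t (𝟙 w))
  sum : ∀ (v : Λ) (m : Fin k → ℕ) (T : Finset (Σ w : Λ, (w ⟶ v))),
    (T : Set (Σ w : Λ, (w ⟶ v))) = d.pathsUpTo m v →
      E (t (𝟙 v)) (∑ l ∈ T, t l.2 * star (t l.2))

/-- `t` is a Cuntz-Krieger `Λ`-family in the C*-algebra `B`. -/
def IsCKFamily {B : Type w} [NonUnitalCStarAlgebra B] (t : ∀ ⦃w v : Λ⦄, (w ⟶ v) → B) : Prop :=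
  d.CKRelations (fun a b => a = b) t

end DegreeMap

/-! ### The universal C*-algebra

The free unital *-algebra on the paths of `Λ` carries a largest C*-seminorm that vanishes on the
Cuntz-Krieger relations.  Its completion is a unital C*-algebra, and `C*(Λ)` is the closed
(non-unital) *-subalgebra generated by the paths. -/

/-- The free unital *-algebra on `X`: the monoid algebra of words in letters `x` and `x*`, which
are written as `(x, false)` and `(x, true)`. -/
def FreeStar (X : Type u) : Type u := MonoidAlgebra ℂ (FreeMonoid (X × Bool))

namespace FreeStar

variable {X : Type u}

instance : Ring (FreeStar X) := inferInstanceAs (Ring (MonoidAlgebra ℂ (FreeMonoid (X × Bool))))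

instance : Algebra ℂ (FreeStar X) :=
  inferInstanceAs (Algebra ℂ (MonoidAlgebra ℂ (FreeMonoid (X × Bool))))

/-- A scalar multiple of a word. -/
def word (m : FreeMonoid (X × Bool)) (c : ℂ) : FreeStar X := MonoidAlgebra.single m c

/-- The generator `x`. -/
def gen (x : X) : FreeStar X := word (FreeMonoid.of (x, false)) 1

theorem induction {P : FreeStar X → Prop} (x : FreeStar X) (zero : P 0)
    (add : ∀ a b, P a → P b → P (a + b)) (word : ∀ m c, P (word m c)) : P x :=
  MonoidAlgebra.induction_linear x zero add word

theorem word_mul (m n : FreeMonoid (X × Bool)) (a b : ℂ) :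
    word m a * word n b = word (m * n) (a * b) :=
  MonoidAlgebra.single_mul_single ..

theorem smul_word (m : FreeMonoid (X × Bool)) (a c : ℂ) : a • word m c = word m (a * c) :=
  MonoidAlgebra.smul_single ..

/-- The adjoint of a word: reverse it, and exchange `x` and `x*`. -/
def wordStar (m : FreeMonoid (X × Bool)) : FreeMonoid (X × Bool) :=
  FreeMonoid.ofList ((m.toList.map fun p => (p.1, !p.2)).reverse)

theorem wordStar_wordStar (m : FreeMonoid (X × Bool)) : wordStar (wordStar m) = m := by
  apply FreeMonoid.toList.injective
  simp [wordStar, Function.comp_def]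

theorem wordStar_mul (m n : FreeMonoid (X × Bool)) :
    wordStar (m * n) = wordStar n * wordStar m := by
  apply FreeMonoid.toList.injective
  simp [wordStar]

/-- The adjoint: conjugate-linear, and equal to `wordStar` on words. -/
def adj : FreeStar X →+ FreeStar X :=
  (MonoidAlgebra.coeffAddEquiv.symm.toAddMonoidHom).comp <|
    ((Finsupp.mapRange.addMonoidHom (starRingEnd ℂ).toAddMonoidHom).comp
      (Finsupp.mapDomain.addMonoidHom wordStar)).comp
        (MonoidAlgebra.coeffAddEquiv (R := ℂ) (M := FreeMonoid (X × Bool))).toAddMonoidHom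

theorem adj_word (m : FreeMonoid (X × Bool)) (c : ℂ) :
    adj (word m c) = word (wordStar m) (starRingEnd ℂ c) := by
  apply MonoidAlgebra.coeff_injective
  change Finsupp.mapRange (starRingEnd ℂ) (map_zero _) (Finsupp.mapDomain wordStar (Finsupp.single m c)) =
    Finsupp.single (wordStar m) _
  rw [Finsupp.mapDomain_single]
  exact Finsupp.mapRange_single (hf := map_zero _)

instance : StarRing (FreeStar X) where
  star := adj
  star_involutive x := by
    induction x using FreeStar.induction with
    | zero => simp
    | add a b ha hb => rw [map_add, map_add, ha, hb]
    | word m c => simp [adj_word, wordStar_wordStar]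
  star_mul x y := by
    change adj (x * y) = adj y * adj x
    induction x using FreeStar.induction with
    | zero => simp
    | add a b ha hb => rw [add_mul, map_add, map_add, ha, hb, mul_add]
    | word m c =>
      induction y using FreeStar.induction with
      | zero => simp
      | add a b ha hb => rw [mul_add, map_add, map_add, ha, hb, add_mul]
      | word n e => simp [adj_word, word_mul, wordStar_mul, mul_comm]
  star_add := map_add adj

theorem star_word (m : FreeMonoid (X × Bool)) (c : ℂ) :
    star (word m c) = word (wordStar m) (star c) := adj_word m c

instance : StarModule ℂ (FreeStar X) where
  star_smul c x := by
    induction x using FreeStar.induction with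
    | zero => simp
    | add a b ha hb => rw [smul_add, star_add, star_add, ha, hb, smul_add]
    | word m e => simp only [smul_word, star_word, star_mul']

/-- The homomorphism that sends `x` to `t x` and `x*` to `(t x)*`. -/
def liftHom {B : Type w} [Ring B] [StarRing B] [Algebra ℂ B] (t : X → B) :
    FreeStar X →ₐ[ℂ] B :=
  MonoidAlgebra.lift ℂ B (FreeMonoid (X × Bool))
    (FreeMonoid.lift fun p => if p.2 then star (t p.1) else t p.1)

theorem liftHom_word {B : Type w} [Ring B] [StarRing B] [Algebra ℂ B] (t : X → B)
    (m : FreeMonoid (X × Bool)) (c : ℂ) : liftHom t (word m c) =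
      c • FreeMonoid.lift (fun p => if p.2 then star (t p.1) else t p.1) m :=
  MonoidAlgebra.lift_single ..

/-- The *-homomorphism given by its values on the generators. -/
def lift {B : Type w} [Ring B] [StarRing B] [Algebra ℂ B] [StarModule ℂ B] (t : X → B) :
    FreeStar X →⋆ₐ[ℂ] B where
  toAlgHom := liftHom t
  map_star' x := by
    change liftHom t (star x) = star (liftHom t x)
    induction x using FreeStar.induction with
    | zero => simp
    | add a b ha hb => rw [star_add, map_add, map_add, ha, hb, star_add]
    | word m c =>
      rw [star_word, liftHom_word, liftHom_word, star_smul]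
      congr 1
      induction m using FreeMonoid.inductionOn' with
      | one => simp [wordStar]
      | of_mul p m ih =>
        rw [wordStar_mul, map_mul, map_mul, star_mul, ih]
        congr 1
        rcases p with ⟨x, _ | _⟩ <;> simp [wordStar]

theorem lift_gen {B : Type w} [Ring B] [StarRing B] [Algebra ℂ B] [StarModule ℂ B] (t : X → B)
    (x : X) : lift t (gen x) = t x := by
  refine (liftHom_word t _ _).trans ?_
  simp

end FreeStar

namespace DegreeMap

variable {k : ℕ} {Λ : Type u} [Category.{v} Λ] (d : DegreeMap k Λ)

/-- The free *-algebra on the paths of `Λ`. -/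
def Free (_ : DegreeMap k Λ) : Type (max u v) := FreeStar (Σ w : Λ, Σ v : Λ, (w ⟶ v))

instance : Ring d.Free := inferInstanceAs (Ring (FreeStar _))
instance : Algebra ℂ d.Free := inferInstanceAs (Algebra ℂ (FreeStar _))
instance : StarRing d.Free := inferInstanceAs (StarRing (FreeStar _))
instance : StarModule ℂ d.Free := inferInstanceAs (StarModule ℂ (FreeStar _))

/-- The generators of the free *-algebra. -/
def freeGen : ∀ ⦃w v : Λ⦄, (w ⟶ v) → d.Free := fun _ _ l => FreeStar.gen ⟨_, _, l⟩

/-- A C*-seminorm on the free *-algebra that vanishes on the Cuntz-Krieger relations. -/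
structure CKSeminorm where
  toSeminorm : Seminorm ℂ d.Free
  mul_le : ∀ a b, toSeminorm (a * b) ≤ toSeminorm a * toSeminorm b
  star_mul : ∀ a, toSeminorm (star a * a) = toSeminorm a ^ 2
  ck : d.CKRelations (fun a b => toSeminorm (a - b) = 0) d.freeGen

variable {d} in
theorem CKSeminorm.eq_of_sub (p : d.CKSeminorm) {a b : d.Free} (h : p.toSeminorm (a - b) = 0) :
    p.toSeminorm a = p.toSeminorm b := by
  have := abs_sub_map_le_sub p.toSeminorm a b
  rw [h] at this
  exact sub_eq_zero.1 (abs_nonpos_iff.1 this)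

variable {d} in
theorem CKSeminorm.gen_le (p : d.CKSeminorm) {w v : Λ} (l : w ⟶ v) :
    p.toSeminorm (d.freeGen l) ≤ 1 := by
  have hv : p.toSeminorm (d.freeGen (𝟙 w)) ≤ 1 := by
    have h1 : _ = p.toSeminorm (d.freeGen (𝟙 w)) ^ 2 := p.star_mul (d.freeGen (𝟙 w))
    have h2 := p.eq_of_sub (p.ck.star_mul_self (𝟙 w))
    have h3 : p.toSeminorm (d.freeGen (𝟙 w)) = p.toSeminorm (d.freeGen (𝟙 w)) ^ 2 := h2 ▸ h1
    nlinarith [sq_nonneg (p.toSeminorm (d.freeGen (𝟙 w)) - 1)]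
  have h1 : _ = p.toSeminorm (d.freeGen l) ^ 2 := p.star_mul (d.freeGen l)
  have h2 := p.eq_of_sub (p.ck.star_mul_self l)
  have h3 : p.toSeminorm (d.freeGen (𝟙 w)) = p.toSeminorm (d.freeGen l) ^ 2 := h2 ▸ h1
  nlinarith [sq_nonneg (p.toSeminorm (d.freeGen l) - 1)]

variable {d} in
theorem CKSeminorm.star_le (p : d.CKSeminorm) (a : d.Free) :
    p.toSeminorm a ≤ p.toSeminorm (star a) := by
  have h1 : _ = p.toSeminorm a ^ 2 := p.star_mul a
  have h2 : p.toSeminorm (star a * a) ≤ p.toSeminorm (star a) * p.toSeminorm a := p.mul_le _ _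
  have h3 := apply_nonneg p.toSeminorm a
  have h4 := apply_nonneg p.toSeminorm (star a)
  rw [h1] at h2
  by_contra! h
  nlinarith

variable {d} in
theorem CKSeminorm.star_eq (p : d.CKSeminorm) (a : d.Free) :
    p.toSeminorm (star a) = p.toSeminorm a :=
  le_antisymm (by simpa using p.star_le (star a)) (p.star_le a)

theorem bddAbove_seminorm (x : d.Free) :
    BddAbove (Set.range fun p : d.CKSeminorm => p.toSeminorm x) := by
  suffices h : ∃ C : ℝ, ∀ p : d.CKSeminorm, p.toSeminorm x ≤ C by
    obtain ⟨C, hC⟩ := h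
    exact ⟨C, by rintro _ ⟨p, rfl⟩; exact hC p⟩
  refine FreeStar.induction
    (P := fun x : d.Free => ∃ C : ℝ, ∀ p : d.CKSeminorm, p.toSeminorm x ≤ C) x ?_ ?_ ?_
  · exact ⟨0, fun p => (map_zero p.toSeminorm).le⟩
  · rintro a b ⟨C, hC⟩ ⟨D, hD⟩
    exact ⟨C + D, fun p => (map_add_le_add p.toSeminorm a b).trans (add_le_add (hC p) (hD p))⟩
  · intro m c
    refine ⟨‖c‖, fun p => ?_⟩
    have hone : p.toSeminorm (1 : d.Free) ≤ 1 := by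
      have h1 : p.toSeminorm (star 1 * 1) = p.toSeminorm (1 : d.Free) ^ 2 := p.star_mul 1
      rw [star_one, one_mul] at h1
      nlinarith [sq_nonneg (p.toSeminorm (1 : d.Free) - 1)]
    have hm : p.toSeminorm (FreeStar.word m 1 : d.Free) ≤ 1 := by
      induction m using FreeMonoid.inductionOn' with
      | one => exact hone
      | of_mul q m ih =>
        have e : (FreeStar.word (FreeMonoid.of q * m) 1 : d.Free)
            = (FreeStar.word (FreeMonoid.of q) 1 : d.Free) * (FreeStar.word m 1 : d.Free) := by
          have := FreeStar.word_mul (FreeMonoid.of q) m 1 1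
          rw [mul_one] at this
          exact this.symm
        have hq : p.toSeminorm (FreeStar.word (FreeMonoid.of q) 1 : d.Free) ≤ 1 := by
          rcases q with ⟨⟨w, v, l⟩, _ | _⟩
          · exact p.gen_le l
          · have e2 : (FreeStar.word (FreeMonoid.of (⟨w, v, l⟩, true)) 1 : d.Free)
                = star (d.freeGen l) := by
              refine Eq.trans ?_ (FreeStar.star_word _ _).symm
              simp [FreeStar.wordStar]
            rw [e2, p.star_eq]
            exact p.gen_le l
        rw [e]
        refine (p.mul_le _ _).trans ?_
        exact mul_le_one₀ hq (apply_nonneg p.toSeminorm _) ih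
    have e3 : (FreeStar.word m c : d.Free) = c • (FreeStar.word m 1 : d.Free) := by
      have := FreeStar.smul_word m c 1
      rw [mul_one] at this
      exact this.symm
    rw [e3]
    refine (map_smul_eq_mul p.toSeminorm c (FreeStar.word m 1 : d.Free)).le.trans ?_
    exact mul_le_of_le_one_right (norm_nonneg c) hm

instance : Nonempty d.CKSeminorm :=
  ⟨{ toSeminorm := 0
     mul_le := fun _ _ => by simp
     star_mul := fun _ => by simp
     ck := by constructor <;> intros <;> rfl }⟩

/-- The largest C*-seminorm that vanishes on the Cuntz-Krieger relations. -/
instance : Norm d.Free := ⟨fun x => ⨆ p : d.CKSeminorm, p.toSeminorm x⟩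

theorem norm_def (x : d.Free) : ‖x‖ = ⨆ p : d.CKSeminorm, p.toSeminorm x := rfl

variable {d} in
theorem le_norm (p : d.CKSeminorm) (x : d.Free) : p.toSeminorm x ≤ ‖x‖ :=
  le_ciSup (d.bddAbove_seminorm x) p

theorem norm_nonneg_aux (x : d.Free) : 0 ≤ ‖x‖ :=
  Real.iSup_nonneg fun p => apply_nonneg p.toSeminorm x

theorem norm_star_aux (x : d.Free) : ‖star x‖ = ‖x‖ := by
  simp only [norm_def, CKSeminorm.star_eq]

instance : SeminormedAddCommGroup d.Free :=
  AddGroupSeminorm.toSeminormedAddCommGroup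
    { toFun := fun x => ‖x‖
      map_zero' := by simp [norm_def]
      add_le' := fun x y => ciSup_le fun p =>
        (map_add_le_add p.toSeminorm x y).trans (add_le_add (le_norm p x) (le_norm p y))
      neg' := fun x => by simp [norm_def] }

instance : SeminormedRing d.Free where
  dist_eq := dist_eq_norm_neg_add
  norm_mul_le x y := ciSup_le fun p => (p.mul_le x y).trans <|
    mul_le_mul (le_norm p x) (le_norm p y) (apply_nonneg p.toSeminorm y) (d.norm_nonneg_aux x)

instance : NormedAlgebra ℂ d.Free where
  norm_smul_le c x := ciSup_le fun p => by
    rw [map_smul_eq_mul]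
    exact mul_le_mul_of_nonneg_left (le_norm p x) (norm_nonneg c)

theorem norm_star_mul_self_free (x : d.Free) : ‖star x * x‖ = ‖x‖ ^ 2 := by
  refine le_antisymm ?_ ?_
  · refine (norm_mul_le _ _).trans ?_
    rw [norm_star_aux, sq]
  · have h : ‖x‖ ≤ Real.sqrt ‖star x * x‖ := ciSup_le fun p => by
      refine Real.le_sqrt_of_sq_le ?_
      rw [← p.star_mul x]
      exact le_norm p _
    have h2 := pow_le_pow_left₀ (norm_nonneg x) h 2
    rwa [Real.sq_sqrt (norm_nonneg _)] at h2

/-! The completion. -/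

instance : NormedStarGroup d.Free := ⟨fun x => (d.norm_star_aux x).le⟩

/-- The completion of the free *-algebra in its largest Cuntz-Krieger C*-seminorm. -/
abbrev Envelope : Type (max u v) := UniformSpace.Completion d.Free

open UniformSpace in
instance : StarRing d.Envelope where
  star := Completion.map star
  star_involutive x := by
    have hs : UniformContinuous (star : d.Free → d.Free) := (starₗᵢ ℂ).isometry.uniformContinuous
    change Completion.map star (Completion.map star x) = x
    rw [← Function.comp_apply (f := Completion.map star), Completion.map_comp hs hs]
    have : (star ∘ star : d.Free → d.Free) = id := funext star_star
    rw [this, Completion.map_id, id]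
  star_mul x y := by
    have hs : UniformContinuous (star : d.Free → d.Free) := (starₗᵢ ℂ).isometry.uniformContinuous
    have hc := Completion.continuous_map (f := (star : d.Free → d.Free))
    change Completion.map star (x * y) = Completion.map star y * Completion.map star x
    refine Completion.induction_on₂ x y (isClosed_eq (by fun_prop) (by fun_prop)) fun a b => ?_
    simp only [← Completion.coe_mul, Completion.map_coe hs, StarMul.star_mul]
  star_add x y := by
    have hs : UniformContinuous (star : d.Free → d.Free) := (starₗᵢ ℂ).isometry.uniformContinuous
    have hc := Completion.continuous_map (f := (star : d.Free → d.Free))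
    change Completion.map star (x + y) = Completion.map star x + Completion.map star y
    refine Completion.induction_on₂ x y (isClosed_eq (by fun_prop) (by fun_prop)) fun a b => ?_
    simp only [← Completion.coe_add, Completion.map_coe hs, StarAddMonoid.star_add]

open UniformSpace in
theorem star_coe (a : d.Free) : star (a : d.Envelope) = ((star a : d.Free) : d.Envelope) :=
  Completion.map_coe (starₗᵢ ℂ : d.Free ≃ₗᵢ⋆[ℂ] d.Free).isometry.uniformContinuous a

open UniformSpace in
theorem continuous_star_envelope : Continuous (star : d.Envelope → d.Envelope) :=
  Completion.continuous_map

instance : NormedAlgebra ℂ d.Envelope where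
  norm_smul_le c x := _root_.norm_smul_le c x

open UniformSpace in
instance : CStarRing d.Envelope where
  norm_mul_self_le x := by
    have hc := d.continuous_star_envelope
    refine Completion.induction_on x (isClosed_le (by fun_prop) (by fun_prop)) fun a => ?_
    rw [star_coe, ← Completion.coe_mul, Completion.norm_coe, Completion.norm_coe,
      norm_star_mul_self_free, sq]

open UniformSpace in
instance : StarModule ℂ d.Envelope where
  star_smul c x := by
    have hc := d.continuous_star_envelope
    refine Completion.induction_on x (isClosed_eq ?_ ?_) fun a => ?_
    · exact hc.comp (continuous_const_smul c)
    · exact hc.const_smul (star c)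
    · rw [← Completion.coe_smul, star_coe, star_coe, StarModule.star_smul, Completion.coe_smul]

instance : CStarAlgebra d.Envelope where

/-- The C*-algebra `C*(Λ)`. -/
def CStar : Type (max u v) :=
  generatedCStar {x : d.Envelope | ∃ (w v : Λ) (l : w ⟶ v), x = (d.freeGen l : d.Envelope)}

instance : NonUnitalCStarAlgebra d.CStar :=
  NonUnitalStarSubalgebra.nonUnitalCStarAlgebra (generatedCStar _)

/-- The universal Cuntz-Krieger family `s`. -/
def s : ∀ ⦃w v : Λ⦄, (w ⟶ v) → d.CStar := fun _ _ l =>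
  ⟨(d.freeGen l : d.Envelope),
    subset_closure (NonUnitalStarAlgebra.subset_adjoin ℂ _ ⟨_, _, l, rfl⟩)⟩

end DegreeMap
namespace DegreeMap

variable {k : ℕ} {Λ : Type u} [Category.{v} Λ] (d : DegreeMap k Λ)

section UniversalProperty

variable {B : Type w} [NonUnitalCStarAlgebra B] {t : ∀ ⦃w v : Λ⦄, (w ⟶ v) → B}

/-- The representation of the free *-algebra on the unitization of `B` given by `t`. -/
def freeRep (t : ∀ ⦃w v : Λ⦄, (w ⟶ v) → B) : d.Free →⋆ₐ[ℂ] Unitization ℂ B :=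
  FreeStar.lift fun x => (t x.2.2 : Unitization ℂ B)

theorem freeRep_gen (t : ∀ ⦃w v : Λ⦄, (w ⟶ v) → B) {w v : Λ} (l : w ⟶ v) :
    d.freeRep t (d.freeGen l) = (t l : Unitization ℂ B) :=
  FreeStar.lift_gen _ _

variable {d}

/-- The C*-seminorm given by a Cuntz-Krieger family. -/
def CKSeminorm.ofFamily (ht : d.IsCKFamily t) : d.CKSeminorm where
  toSeminorm := (normSeminorm ℂ (Unitization ℂ B)).comp (d.freeRep t).toAlgHom.toLinearMap
  mul_le a b := by
    change ‖d.freeRep t (a * b)‖ ≤ ‖d.freeRep t a‖ * ‖d.freeRep t b‖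
    rw [map_mul]
    exact norm_mul_le _ _
  star_mul a := by
    change ‖d.freeRep t (star a * a)‖ = ‖d.freeRep t a‖ ^ 2
    rw [map_mul, map_star, CStarRing.norm_star_mul_self, sq]
  ck := by
    have key : ∀ a b : d.Free, d.freeRep t a = d.freeRep t b →
        (normSeminorm ℂ (Unitization ℂ B)).comp (d.freeRep t).toAlgHom.toLinearMap (a - b) = 0 := by
      intro a b h
      change ‖d.freeRep t (a - b)‖ = 0
      rw [map_sub, h, sub_self, norm_zero]
    constructor
    · intro w v l
      apply key
      simp only [map_mul, map_star, freeRep_gen, ← Unitization.inr_star, ← Unitization.inr_mul,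
        ht.partial_isometry l]
    · intro v
      apply key
      simp only [map_mul, freeRep_gen, ← Unitization.inr_mul, ht.vertex_mul_self v]
    · intro v
      apply key
      simp only [map_star, freeRep_gen, ← Unitization.inr_star, ht.vertex_star v]
    · intro v v' h
      apply key
      simp only [map_mul, map_zero, freeRep_gen, ← Unitization.inr_mul,
        ht.vertex_orthogonal v v' h, Unitization.inr_zero]
    · intro u w v l m
      apply key
      simp only [map_mul, freeRep_gen, ← Unitization.inr_mul, ht.comp l m]
    · intro w v l
      apply key
      simp only [map_mul, map_star, freeRep_gen, ← Unitization.inr_star, ← Unitization.inr_mul,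
        ht.star_mul_self l]
    · intro v m T hT
      apply key
      simp only [map_sum, map_mul, map_star, freeRep_gen, ← Unitization.inr_star,
        ← Unitization.inr_mul, ht.sum v m T hT]
      exact map_sum (Unitization.inrNonUnitalStarAlgHom ℂ B) _ _

theorem norm_freeRep_le (ht : d.IsCKFamily t) (a : d.Free) : ‖d.freeRep t a‖ ≤ ‖a‖ :=
  le_norm (CKSeminorm.ofFamily ht) a

theorem continuous_freeRep (ht : d.IsCKFamily t) : Continuous (d.freeRep t) :=
  AddMonoidHomClass.continuous_of_bound (d.freeRep t) 1 fun a => by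
    rw [one_mul]; exact norm_freeRep_le ht a

open UniformSpace in
/-- The extension of `freeRep` to the completion. -/
def envelopeRep (ht : d.IsCKFamily t) : d.Envelope →+* Unitization ℂ B :=
  Completion.extensionHom (d.freeRep t : d.Free →+* Unitization ℂ B) (continuous_freeRep ht)

open UniformSpace in
theorem envelopeRep_coe (ht : d.IsCKFamily t) (a : d.Free) :
    envelopeRep ht (a : d.Envelope) = d.freeRep t a :=
  Completion.extensionHom_coe _ (continuous_freeRep ht) a

open UniformSpace in
theorem continuous_envelopeRep (ht : d.IsCKFamily t) : Continuous (envelopeRep ht) :=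
  Completion.continuous_extension

open UniformSpace in
theorem envelopeRep_star (ht : d.IsCKFamily t) (x : d.Envelope) :
    envelopeRep ht (star x) = star (envelopeRep ht x) := by
  have hc := continuous_envelopeRep ht
  refine Completion.induction_on x (isClosed_eq (hc.comp continuous_star) hc.star) fun a => ?_
  rw [star_coe, envelopeRep_coe, envelopeRep_coe, map_star]

open UniformSpace in
theorem envelopeRep_smul (ht : d.IsCKFamily t) (c : ℂ) (x : d.Envelope) :
    envelopeRep ht (c • x) = c • envelopeRep ht x := by
  have hc := continuous_envelopeRep ht
  refine Completion.induction_on x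
    (isClosed_eq (hc.comp (continuous_const_smul c)) (hc.const_smul c)) fun a => ?_
  rw [← Completion.coe_smul, envelopeRep_coe, envelopeRep_coe, map_smul]

/-- `envelopeRep` as a *-homomorphism. -/
def envelopeStarRep (ht : d.IsCKFamily t) : d.Envelope →⋆ₙₐ[ℂ] Unitization ℂ B where
  toFun := envelopeRep ht
  map_smul' := envelopeRep_smul ht
  map_zero' := map_zero _
  map_add' := map_add _
  map_mul' := map_mul _
  map_star' := envelopeRep_star ht

theorem envelopeRep_fst (ht : d.IsCKFamily t) (x : d.CStar) :
    (envelopeRep ht x.1).fst = 0 := by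
  let φ : Unitization ℂ B →⋆ₐ[ℂ] ℂ :=
    { Unitization.fstHom ℂ B with map_star' := fun _ => rfl }
  let ψ : d.Envelope →⋆ₙₐ[ℂ] ℂ :=
    (φ : Unitization ℂ B →⋆ₙₐ[ℂ] ℂ).comp (envelopeStarRep ht)
  have hψ : Continuous ψ := Unitization.continuous_fst.comp (continuous_envelopeRep ht)
  have h1 : ∀ y ∈ NonUnitalStarAlgebra.adjoin ℂ
      {x : d.Envelope | ∃ (w v : Λ) (l : w ⟶ v), x = (d.freeGen l : d.Envelope)}, ψ y = 0 := by
    intro y hy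
    induction hy using NonUnitalStarAlgebra.adjoin_induction with
    | mem y h =>
      obtain ⟨w, v, l, rfl⟩ := h
      change (envelopeRep ht _).fst = 0
      rw [envelopeRep_coe, freeRep_gen, Unitization.fst_inr]
    | add a b _ _ ha hb => rw [map_add, ha, hb, add_zero]
    | zero => exact map_zero ψ
    | mul a b _ _ ha hb => rw [map_mul, ha, zero_mul]
    | smul c a _ ha => rw [map_smul, ha, smul_zero]
    | star a _ ha => rw [map_star, ha, star_zero]
  exact closure_minimal h1 (isClosed_eq hψ continuous_const) x.2

/-- The universal property of `C*(Λ)`. -/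
def lift (ht : d.IsCKFamily t) : d.CStar →⋆ₙₐ[ℂ] B where
  toFun x := (envelopeRep ht x.1).snd
  map_smul' c x := by
    change (envelopeRep ht (c • x.1)).snd = _
    rw [envelopeRep_smul]; rfl
  map_zero' := by
    change (envelopeRep ht 0).snd = 0
    rw [map_zero]; rfl
  map_add' x y := by
    change (envelopeRep ht (x.1 + y.1)).snd = _
    rw [map_add]; rfl
  map_mul' x y := by
    change (envelopeRep ht (x.1 * y.1)).snd = _
    rw [map_mul, Unitization.snd_mul, envelopeRep_fst, envelopeRep_fst, zero_smul, zero_smul,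
      zero_add, zero_add]
  map_star' x := by
    change (envelopeRep ht (star x.1)).snd = _
    rw [envelopeRep_star]; rfl

theorem lift_s (ht : d.IsCKFamily t) {w v : Λ} (l : w ⟶ v) : lift ht (d.s l) = t l := by
  change (envelopeRep ht (d.freeGen l : d.Envelope)).snd = t l
  rw [envelopeRep_coe, freeRep_gen, Unitization.snd_inr]

end UniversalProperty

/-- The inclusion of `C*(Λ)` in its envelope. -/
def toEnvelope : d.CStar →⋆ₙₐ[ℂ] d.Envelope where
  toFun x := x.1
  map_smul' _ _ := rfl
  map_zero' := rfl
  map_add' _ _ := rfl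
  map_mul' _ _ := rfl
  map_star' _ := rfl

theorem toEnvelope_injective : Function.Injective d.toEnvelope := Subtype.val_injective

/-- The map of the free *-algebra to its completion. -/
def ofFree : d.Free →⋆ₙₐ[ℂ] d.Envelope where
  toFun x := (x : d.Envelope)
  map_smul' c x := UniformSpace.Completion.coe_smul c x
  map_zero' := UniformSpace.Completion.coe_zero
  map_add' x y := UniformSpace.Completion.coe_add x y
  map_mul' x y := UniformSpace.Completion.coe_mul x y
  map_star' x := (d.star_coe x).symm

theorem ofFree_eq {a b : d.Free} (h : ∀ p : d.CKSeminorm, p.toSeminorm (a - b) = 0) :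
    d.ofFree a = d.ofFree b := by
  change (a : d.Envelope) = (b : d.Envelope)
  rw [← sub_eq_zero, ← UniformSpace.Completion.coe_sub, ← norm_eq_zero,
    UniformSpace.Completion.norm_coe, norm_def]
  simp [h]

theorem toEnvelope_s_eq {w v : Λ} (l : w ⟶ v) : d.toEnvelope (d.s l) = d.ofFree (d.freeGen l) :=
  rfl

/-- `s` is a Cuntz-Krieger family. -/
theorem isCKFamily_s : d.IsCKFamily d.s where
  partial_isometry _ _ l := d.toEnvelope_injective (by
    simpa only [map_mul, map_star, toEnvelope_s_eq] using
      d.ofFree_eq fun p => p.ck.partial_isometry l)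
  vertex_mul_self v := d.toEnvelope_injective (by
    simpa only [map_mul, map_star, toEnvelope_s_eq] using
      d.ofFree_eq fun p => p.ck.vertex_mul_self v)
  vertex_star v := d.toEnvelope_injective (by
    simpa only [map_mul, map_star, toEnvelope_s_eq] using
      d.ofFree_eq fun p => p.ck.vertex_star v)
  vertex_orthogonal v v' h := d.toEnvelope_injective (by
    simpa only [map_mul, map_zero, toEnvelope_s_eq] using
      d.ofFree_eq fun p => p.ck.vertex_orthogonal v v' h)
  comp _ _ _ l m := d.toEnvelope_injective (by
    simpa only [map_mul, map_star, toEnvelope_s_eq] using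
      d.ofFree_eq fun p => p.ck.comp l m)
  star_mul_self _ _ l := d.toEnvelope_injective (by
    simpa only [map_mul, map_star, toEnvelope_s_eq] using
      d.ofFree_eq fun p => p.ck.star_mul_self l)
  sum v m T hT := d.toEnvelope_injective (by
    simpa only [map_sum, map_mul, map_star, toEnvelope_s_eq] using
      d.ofFree_eq fun p => p.ck.sum v m T hT)

/-! ### The gauge action and the ideals -/

/-- `z ^ n` for `z` in the torus and `n ∈ ℕ ^ k`. -/
def torusPow (z : Fin k → Circle) (n : Fin k → ℕ) : ℂ := ∏ i, (z i : ℂ) ^ n i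

theorem torusPow_zero (z : Fin k → Circle) : torusPow z 0 = 1 := by simp [torusPow]

theorem torusPow_add (z : Fin k → Circle) (m n : Fin k → ℕ) :
    torusPow z (m + n) = torusPow z m * torusPow z n := by
  simp [torusPow, pow_add, Finset.prod_mul_distrib]

theorem star_torusPow_mul (z : Fin k → Circle) (n : Fin k → ℕ) :
    star (torusPow z n) * torusPow z n = 1 := by
  have h : ‖torusPow z n‖ = 1 := by
    rw [torusPow, norm_prod]
    exact Finset.prod_eq_one fun i _ => by rw [norm_pow, Circle.norm_coe, one_pow]
  rw [Complex.star_def, Complex.conj_mul', h]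
  norm_num

theorem torusPow_mul_star (z : Fin k → Circle) (n : Fin k → ℕ) :
    torusPow z n * star (torusPow z n) = 1 := by
  rw [mul_comm, star_torusPow_mul]

theorem isCKFamily_gauge (z : Fin k → Circle) :
    d.IsCKFamily (fun _ _ l => torusPow z (d.deg l) • d.s l) where
  partial_isometry _ _ l := by
    simp only [star_smul, smul_mul_smul_comm, torusPow_mul_star, one_mul,
      d.isCKFamily_s.partial_isometry l]
  vertex_mul_self v := by
    simp only [d.deg_id, torusPow_zero, one_smul, d.isCKFamily_s.vertex_mul_self v]
  vertex_star v := by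
    simp only [d.deg_id, torusPow_zero, one_smul, d.isCKFamily_s.vertex_star v]
  vertex_orthogonal v v' h := by
    simp only [d.deg_id, torusPow_zero, one_smul, d.isCKFamily_s.vertex_orthogonal v v' h]
  comp _ _ _ l m := by
    simp only [d.deg_comp, torusPow_add, smul_mul_smul_comm, d.isCKFamily_s.comp l m]
  star_mul_self _ _ l := by
    simp only [star_smul, smul_mul_smul_comm, star_torusPow_mul, d.deg_id, torusPow_zero,
      one_smul, d.isCKFamily_s.star_mul_self l]
  sum v m T hT := by
    simp only [star_smul, smul_mul_smul_comm, torusPow_mul_star, d.deg_id, torusPow_zero,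
      one_smul, ← d.isCKFamily_s.sum v m T hT]

/-- The gauge action: `γ_z (s_l) = z ^ d(l) s_l`. -/
def gauge (z : Fin k → Circle) : d.CStar →⋆ₙₐ[ℂ] d.CStar := lift (d.isCKFamily_gauge z)

/-- The closed ideals `I` of `C*(Λ)` with `γ_z(I) ⊆ I` for all `z` in the torus, ordered by
inclusion. -/
def GaugeIdeal : Type (max u v) := {I : ClosedIdeal d.CStar // ∀ z, ∀ a ∈ I, d.gauge z a ∈ I}

instance : PartialOrder d.GaugeIdeal := inferInstanceAs (PartialOrder (Subtype _))

instance : InfSet d.GaugeIdeal where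
  sInf 𝒮 := ⟨sInf (Subtype.val '' 𝒮), fun z a ha => by
    rw [ClosedIdeal.mem_sInf] at ha ⊢
    rintro _ ⟨I, hI, rfl⟩
    exact I.2 z a (ha _ ⟨I, hI, rfl⟩)⟩

/-- The lattice of gauge-invariant closed ideals: meets are intersections. -/
instance : CompleteLattice d.GaugeIdeal :=
  completeLatticeOfInf _ fun 𝒮 =>
    ⟨fun I hI => show sInf (Subtype.val '' 𝒮) ≤ I.1 from sInf_le ⟨I, hI, rfl⟩,
      fun J hJ => show J.1 ≤ sInf (Subtype.val '' 𝒮) from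
        le_sInf (by rintro _ ⟨I, hI, rfl⟩; exact hJ hI)⟩

/-- `I_H`, the closed ideal generated by the projections `s_v` with `v ∈ H`. -/
def vertexIdeal (H : Set Λ) : ClosedIdeal d.CStar :=
  ClosedIdeal.generatedBy {x | ∃ v ∈ H, x = d.s (𝟙 v)}

/-- `C*({s_l : r(l) ∈ H})`. -/
def rangeSubalgebra (H : Set Λ) : NonUnitalStarSubalgebra ℂ d.CStar :=
  generatedCStar {x | ∃ (w v : Λ) (l : w ⟶ v), v ∈ H ∧ x = d.s l}

end DegreeMap

end HigherRank

end

noncomputable section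
namespace HigherRank

/-! The proof rests on a gauge-invariant uniqueness theorem, `RowFinite.eq_zero_of_gauge_invariant`,
and on the fact that no vertex projection of `C*(Λ)` vanishes, `s_vertex_ne_zero`.

For the uniqueness theorem, let `J` be a gauge-invariant closed ideal that contains no `s_v`. The
elements `s_l s_m*` span a dense *-subalgebra, and those with `d(l) = d(m)` span a subspace, the
core, that is exhausted by finite-dimensional algebras built from matrix units. An element of `J` in
such an algebra has all its matrix coefficients zero, since a nonzero one would put a vertex
projection in `J`. So the quotient map is isometric on the core and on its closure. For `a` in `J`,
each Fourier component `b` of `a` along the gauge action is in `J`, and `b* b` is gauge-fixed, so it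
is in the closure of the core and vanishes. An element whose Fourier components all vanish is zero.

For the vertex projections, `Λ` is represented on the `ℓ²` space of its boundary paths. Local
convexity makes it possible to truncate an element of `Λ^{≤ n}(v)` to one of `Λ^{≤ m}(v)` for `m ≤
n` (`LocallyConvex.exists_isInitial`). Row-finiteness then gives a boundary path at every vertex by
compactness, and every boundary path at `v` begins with exactly one element of `Λ^{≤ m}(v)`, which
is the summation relation.

Part (b) follows from universal properties in both directions: saturation makes the sets `Λ^{≤ m}`
of the quotient graph the expected ones, so that extension by zero is a Cuntz-Krieger family. In
part (a), `v` is recovered from `I_H` because `s_v` is nonzero in `C*(Γ(Λ ∖ H))` for `v ∉ H`.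
Conversely, if `H` is the vertex set of a gauge-invariant ideal `I`, the uniqueness theorem makes
`C*(Γ(Λ ∖ H)) → C*(Λ)/I` injective, so `I = I_H`. In part (c) the same theorem makes `C*(Λ(H)) →
C*(Λ)` injective, and the corner projection is the strict limit of finite sums of the `s_v` with `v
∈ H`. -/

theorem continuous_starHom {A : Type u} {B : Type w} [NonUnitalCStarAlgebra A]
    [NonUnitalCStarAlgebra B] (φ : A →⋆ₙₐ[ℂ] B) : Continuous φ :=
  have := NonUnitalStarAlgHom.instContinuousLinearMapClassComplex (F := A →⋆ₙₐ[ℂ] B)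
  map_continuous φ

/-! ### Approximate units of closed ideals, and quotients as C*-algebras -/

namespace ClosedIdeal

variable {A : Type u} [NonUnitalCStarAlgebra A] (I : ClosedIdeal A)

/-- A closed ideal has a self-adjoint approximate unit `e` for which `1 - e` is a contraction in
the unitization. -/
theorem exists_approximateUnit : ∃ l : Filter I, l.NeBot ∧
    (∀ᶠ e : I in l, ‖e‖ ≤ 1 ∧ star e = e ∧ ‖(1 - ((e : A) : Unitization ℂ A))‖ ≤ 1) ∧
    (∀ x : I, Filter.Tendsto (fun e : I => x * e) l (nhds x)) ∧
    (∀ x : I, Filter.Tendsto (fun e : I => e * x) l (nhds x)) := by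
  let _ : PartialOrder I := CStarAlgebra.spectralOrder _
  have _ : StarOrderedRing I := CStarAlgebra.spectralOrderedRing _
  let _ : PartialOrder A := CStarAlgebra.spectralOrder _
  have _ : StarOrderedRing A := CStarAlgebra.spectralOrderedRing _
  have hu := CStarAlgebra.increasingApproximateUnit I
  refine ⟨CStarAlgebra.approximateUnit I, inferInstance, ?_,
    hu.toIsApproximateUnit.tendsto_mul_left, hu.toIsApproximateUnit.tendsto_mul_right⟩
  filter_upwards [hu.eventually_norm, hu.eventually_star_eq, hu.eventually_nonneg]
    with e he hse hpos
  refine ⟨he, hse, ?_⟩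
  -- The spectral orders of `I` and `A` are separate structures; positivity passes from one to the
  -- other through a factorisation `e = f* f`.
  have h0 : (0 : A) ≤ (e : A) := by
    obtain ⟨f, hf⟩ := CStarAlgebra.nonneg_iff_eq_star_mul_self.1 hpos
    have : (e : A) = star (f : A) * f := congrArg Subtype.val hf
    rw [this]
    exact star_mul_self_nonneg _
  have h1 : (0 : Unitization ℂ A) ≤ ((e : A) : Unitization ℂ A) := Unitization.inr_nonneg_iff.2 h0
  have h2 : ((e : A) : Unitization ℂ A) ≤ 1 := by
    rw [← CStarAlgebra.norm_le_one_iff_of_nonneg _ h1, Unitization.norm_inr]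
    exact he
  exact (CStarAlgebra.norm_le_one_iff_of_nonneg _ (sub_nonneg.2 h2)).2 (sub_le_self _ h1)

namespace Quotient

-- Only the norm is imported from the quotient by the submodule; the additive structure is kept, so
-- that it agrees with the one in the statement of the theorem.
scoped instance : NormedAddCommGroup I.Quotient :=
  { (instAddCommGroup I : AddCommGroup I.Quotient),
    @Submodule.Quotient.normedAddCommGroup A _ ℂ _ _ I.toSubmodule I.isClosed with }

scoped instance : NormedSpace ℂ I.Quotient :=
  { (instModuleComplex I : Module ℂ I.Quotient) with
    norm_smul_le := norm_smul_le (α := ℂ) (β := A ⧸ I.toSubmodule) }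

scoped instance : CompleteSpace I.Quotient :=
  inferInstanceAs (CompleteSpace (A ⧸ I.toSubmodule))

theorem mk_surjective : Function.Surjective (mk I) := Submodule.mkQ_surjective _

theorem norm_mk_le (a : A) : ‖mk I a‖ ≤ ‖a‖ := Submodule.Quotient.norm_mk_le I.toSubmodule a

theorem exists_norm_lt (x : I.Quotient) {ε : ℝ} (hε : 0 < ε) :
    ∃ a : A, mk I a = x ∧ ‖a‖ < ‖x‖ + ε :=
  Submodule.Quotient.norm_mk_lt (S := I.toSubmodule) x hε

theorem mk_eq_zero {a : A} : mk I a = 0 ↔ a ∈ I := by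
  rw [← map_zero (mk I), mk_eq, sub_zero]

/-- The ring structure of the quotient. -/
abbrev nonUnitalRing : NonUnitalRing I.Quotient :=
  { instAddCommGroup I, instMul I with
    left_distrib := fun x y z => by
      obtain ⟨a, rfl⟩ := mk_surjective I x
      obtain ⟨b, rfl⟩ := mk_surjective I y
      obtain ⟨c, rfl⟩ := mk_surjective I z
      simp only [← map_add, ← mk_mul, mul_add]
    right_distrib := fun x y z => by
      obtain ⟨a, rfl⟩ := mk_surjective I x
      obtain ⟨b, rfl⟩ := mk_surjective I y
      obtain ⟨c, rfl⟩ := mk_surjective I z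
      simp only [← map_add, ← mk_mul, add_mul]
    zero_mul := fun x => by
      obtain ⟨a, rfl⟩ := mk_surjective I x
      rw [← map_zero (mk I), ← mk_mul, zero_mul]
    mul_zero := fun x => by
      obtain ⟨a, rfl⟩ := mk_surjective I x
      rw [← map_zero (mk I), ← mk_mul, mul_zero]
    mul_assoc := fun x y z => by
      obtain ⟨a, rfl⟩ := mk_surjective I x
      obtain ⟨b, rfl⟩ := mk_surjective I y
      obtain ⟨c, rfl⟩ := mk_surjective I z
      simp only [← mk_mul, mul_assoc] }

scoped instance : NonUnitalNormedRing I.Quotient :=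
  { (inferInstance : NormedAddCommGroup I.Quotient),
    nonUnitalRing I with
    norm_mul_le := fun x y => by
      -- The quotient norm is an infimum, so representatives are chosen up to `ε`, and `ε` tends to
      -- `0` at the end.
      have h : ∀ ε > 0, ‖x * y‖ ≤ (‖x‖ + ε) * (‖y‖ + ε) := by
        intro ε hε
        obtain ⟨a, rfl, ha⟩ := exists_norm_lt I x hε
        obtain ⟨b, rfl, hb⟩ := exists_norm_lt I y hε
        rw [← mk_mul]
        exact (norm_mk_le I _).trans ((norm_mul_le _ _).trans
          (mul_le_mul ha.le hb.le (norm_nonneg _) (by positivity)))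
      have ht : Filter.Tendsto (fun ε : ℝ => (‖x‖ + ε) * (‖y‖ + ε)) (nhdsWithin 0 (Set.Ioi 0))
          (nhds (‖x‖ * ‖y‖)) := by
        have : Continuous fun ε : ℝ => (‖x‖ + ε) * (‖y‖ + ε) := by fun_prop
        simpa using (this.tendsto 0).mono_left nhdsWithin_le_nhds
      exact ge_of_tendsto ht (by filter_upwards [self_mem_nhdsWithin] with ε hε using h ε hε) }

scoped instance : StarRing I.Quotient where
  star_involutive x := by
    obtain ⟨a, rfl⟩ := mk_surjective I x
    rw [← mk_star, ← mk_star, star_star]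
  star_mul x y := by
    obtain ⟨a, rfl⟩ := mk_surjective I x
    obtain ⟨b, rfl⟩ := mk_surjective I y
    simp only [← mk_star, ← mk_mul, star_mul]
  star_add x y := by
    obtain ⟨a, rfl⟩ := mk_surjective I x
    obtain ⟨b, rfl⟩ := mk_surjective I y
    simp only [← mk_star, ← map_add, star_add]

/-- The estimate behind the C*-identity in the quotient. -/
theorem norm_mk_mul_self_le (a i : A) (hi : i ∈ I) :
    ‖mk I a‖ * ‖mk I a‖ ≤ ‖star a * a + i‖ := by
  obtain ⟨l, hl, hev, hr, -⟩ := I.exists_approximateUnit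
  have key : ∀ᶠ e : I in l, ‖mk I a‖ * ‖mk I a‖ ≤
      ‖star a * a + i‖ + 2 * ‖(⟨i, hi⟩ : I) * e - ⟨i, hi⟩‖ := by
    filter_upwards [hev] with e ⟨he, hse, h1⟩
    have hse' : star (e : A) = e := congrArg Subtype.val hse
    have he' : ‖(e : A)‖ ≤ 1 := he
    have h2 : ‖mk I a‖ ≤ ‖a - a * e‖ := by
      have : mk I a = mk I (a - a * e) := by
        rw [mk_eq, sub_sub_cancel]
        exact I.mul_mem_left _ e.2
      rw [this]
      exact norm_mk_le I _
    have h3 : ‖a - a * e‖ * ‖a - a * e‖ = ‖star (a - a * e) * (a - a * e)‖ :=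
      CStarRing.norm_star_mul_self.symm
    -- With `b = a* a + i`, this is `(1 - e) b (1 - e) - (1 - e) i (1 - e)` multiplied out. The
    -- first term has norm at most `‖b‖`, as `1 - e` is a contraction in the unitization; the second
    -- tends to `0`, as `i e → i`.
    have h4 : star (a - a * e) * (a - a * (e : A)) =
        ((star a * a + i) - (star a * a + i) * e - e * (star a * a + i)
          + e * (star a * a + i) * e) + ((i * e - i) - e * (i * e - i)) := by
      simp only [star_sub, star_mul, hse']
      noncomm_ring
    have h5 : ∀ b : A, ‖b - b * e - e * b + e * b * e‖ ≤ ‖b‖ := by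
      intro b
      have : ((b - b * e - e * b + e * b * e : A) : Unitization ℂ A)
          = (1 - ((e : A) : Unitization ℂ A)) * b * (1 - ((e : A) : Unitization ℂ A)) := by
        simp only [Unitization.inr_add, Unitization.inr_sub, Unitization.inr_mul]
        noncomm_ring
      rw [← Unitization.norm_inr (𝕜 := ℂ), this]
      calc _ ≤ ‖(1 - ((e : A) : Unitization ℂ A))‖ * ‖(b : Unitization ℂ A)‖ *
            ‖(1 - ((e : A) : Unitization ℂ A))‖ :=
          (norm_mul_le _ _).trans (by gcongr; exact norm_mul_le _ _)
        _ ≤ 1 * ‖(b : Unitization ℂ A)‖ * 1 := by gcongr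
        _ = _ := by rw [one_mul, mul_one, Unitization.norm_inr]
    have h6 : ‖(⟨i, hi⟩ : I) * e - ⟨i, hi⟩‖ = ‖i * (e : A) - i‖ := rfl
    calc ‖mk I a‖ * ‖mk I a‖ ≤ ‖a - a * e‖ * ‖a - a * e‖ := by gcongr
      _ ≤ ‖star a * a + i‖ + (‖i * (e : A) - i‖ + 1 * ‖i * (e : A) - i‖) := by
          rw [h3, h4]
          refine (norm_add_le _ _).trans (add_le_add (h5 _) ((norm_sub_le _ _).trans ?_))
          gcongr
          exact (norm_mul_le _ _).trans (by gcongr)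
      _ = _ := by rw [h6]; ring
  have ht : Filter.Tendsto (fun e : I => ‖star a * a + i‖ + 2 * ‖(⟨i, hi⟩ : I) * e - ⟨i, hi⟩‖) l
      (nhds ‖star a * a + i‖) := by
    have := (((hr ⟨i, hi⟩).sub_const ⟨i, hi⟩).norm.const_mul 2).const_add ‖star a * a + i‖
    simpa using this
  exact ge_of_tendsto ht key

scoped instance : CStarRing I.Quotient where
  norm_mul_self_le x := by
    obtain ⟨a, rfl⟩ := mk_surjective I x
    refine le_of_forall_pos_le_add fun ε hε => ?_
    -- A representative `b` of almost minimal norm differs from `a* a` by an element of `I`, so the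
    -- estimate applies with `i = b - a* a`.
    obtain ⟨b, hb, hlt⟩ := exists_norm_lt I (star (mk I a) * mk I a) hε
    rw [← mk_star, ← mk_mul, mk_eq] at hb
    refine le_trans ?_ hlt.le
    have := norm_mk_mul_self_le I a _ hb
    rwa [add_sub_cancel] at this

scoped instance : StarModule ℂ I.Quotient where
  star_smul c x := by
    obtain ⟨a, rfl⟩ := mk_surjective I x
    simp only [← mk_star, ← map_smul, star_smul]

scoped instance : IsScalarTower ℂ I.Quotient I.Quotient where
  smul_assoc c x y := by
    obtain ⟨a, rfl⟩ := mk_surjective I x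
    obtain ⟨b, rfl⟩ := mk_surjective I y
    simp only [smul_eq_mul, ← map_smul, ← mk_mul, smul_mul_assoc]

scoped instance : SMulCommClass ℂ I.Quotient I.Quotient where
  smul_comm c x y := by
    obtain ⟨a, rfl⟩ := mk_surjective I x
    obtain ⟨b, rfl⟩ := mk_surjective I y
    simp only [smul_eq_mul, ← map_smul, ← mk_mul, mul_smul_comm]

scoped instance : NonUnitalCStarAlgebra I.Quotient where

/-- The quotient map as a *-homomorphism. -/
def mkHom : A →⋆ₙₐ[ℂ] I.Quotient where
  toFun := mk I
  map_smul' := map_smul (mk I)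
  map_zero' := map_zero (mk I)
  map_add' := map_add (mk I)
  map_mul' := mk_mul I
  map_star' := mk_star I

/-- A *-homomorphism that vanishes on `I` factors through the quotient. -/
def liftHom {B : Type w} [NonUnitalCStarAlgebra B] (φ : A →⋆ₙₐ[ℂ] B) (h : ∀ a ∈ I, φ a = 0) :
    I.Quotient →⋆ₙₐ[ℂ] B where
  toFun := I.toSubmodule.liftQ (φ : A →ₗ[ℂ] B) (fun a ha => h a ha)
  map_smul' c x := map_smul (I.toSubmodule.liftQ (φ : A →ₗ[ℂ] B) (fun a ha => h a ha)) c x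
  map_zero' := map_zero (I.toSubmodule.liftQ (φ : A →ₗ[ℂ] B) (fun a ha => h a ha))
  map_add' x y := map_add (I.toSubmodule.liftQ (φ : A →ₗ[ℂ] B) (fun a ha => h a ha)) x y
  map_mul' x y := by
    obtain ⟨a, rfl⟩ := mk_surjective I x
    obtain ⟨b, rfl⟩ := mk_surjective I y
    exact map_mul φ a b
  map_star' x := by
    obtain ⟨a, rfl⟩ := mk_surjective I x
    exact map_star φ a

end Quotient

/-! ### Kernels, preimages, generated ideals, and ideals of ideals -/

open scoped ClosedIdeal.Quotient

/-- The kernel of a *-homomorphism. -/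
def ker {B : Type w} [NonUnitalCStarAlgebra B] (φ : A →⋆ₙₐ[ℂ] B) : ClosedIdeal A where
  carrier := {a | φ a = 0}
  add_mem' := fun {a b} ha hb => by
    change φ (a + b) = 0
    rw [map_add, show φ a = 0 from ha, show φ b = 0 from hb, add_zero]
  zero_mem' := map_zero φ
  smul_mem' := fun c a ha => by
    change φ (c • a) = 0
    rw [map_smul, show φ a = 0 from ha, smul_zero]
  mul_mem_left' := fun a {x} hx => by
    change φ (a * x) = 0
    rw [map_mul, show φ x = 0 from hx, mul_zero]
  mul_mem_right' := fun {x} a hx => by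
    change φ (x * a) = 0
    rw [map_mul, show φ x = 0 from hx, zero_mul]
  isClosed' := isClosed_eq (continuous_starHom φ) continuous_const

theorem mem_ker {B : Type w} [NonUnitalCStarAlgebra B] (φ : A →⋆ₙₐ[ℂ] B) {a : A} :
    a ∈ ker φ ↔ φ a = 0 := Iff.rfl

/-- The preimage of a closed ideal under a *-homomorphism. -/
def comap {B : Type w} [NonUnitalCStarAlgebra B] (φ : A →⋆ₙₐ[ℂ] B) (J : ClosedIdeal B) :
    ClosedIdeal A := ker ((Quotient.mkHom J).comp φ)

theorem mem_comap {B : Type w} [NonUnitalCStarAlgebra B] (φ : A →⋆ₙₐ[ℂ] B) (J : ClosedIdeal B)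
    {a : A} : a ∈ comap φ J ↔ φ a ∈ J := Quotient.mk_eq_zero J

theorem subset_generatedBy (S : Set A) : S ⊆ (generatedBy S : Set A) := fun _ hx =>
  mem_sInf.2 fun _ hI => hI hx

theorem generatedBy_le {S : Set A} {J : ClosedIdeal A} (h : S ⊆ J) : generatedBy S ≤ J :=
  sInf_le h

/-- A closed ideal of a closed ideal is a closed ideal. -/
def ofIdeal (J : ClosedIdeal I) : ClosedIdeal A where
  carrier := Subtype.val '' (J : Set I)
  add_mem' := by
    rintro _ _ ⟨a, ha, rfl⟩ ⟨b, hb, rfl⟩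
    exact ⟨a + b, add_mem ha hb, rfl⟩
  zero_mem' := ⟨0, zero_mem J, rfl⟩
  smul_mem' := by
    rintro c _ ⟨a, ha, rfl⟩
    exact ⟨c • a, SMulMemClass.smul_mem c ha, rfl⟩
  mul_mem_left' := by
    rintro a _ ⟨x, hx, rfl⟩
    refine ⟨⟨a * x, I.mul_mem_left a x.2⟩, ?_, rfl⟩
    -- `a x` is the limit of `(a e) x`, where `a e` is in `I`; so `J`, an ideal of `I` only,
    -- contains each `(a e) x`, and it is closed.
    obtain ⟨l, hl, -, -, hr⟩ := I.exists_approximateUnit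
    refine J.isClosed.mem_of_tendsto (b := l)
      (f := fun e => (⟨a * (e : I), I.mul_mem_left a e.2⟩ : I) * x) ?_
      (Filter.Eventually.of_forall fun e => J.mul_mem_left _ hx)
    rw [tendsto_subtype_rng]
    have h := ((continuous_subtype_val.tendsto _).comp (hr x)).const_mul a
    refine h.congr fun e => ?_
    exact (mul_assoc a (e : A) (x : A)).symm
  mul_mem_right' := by
    rintro _ a ⟨x, hx, rfl⟩
    refine ⟨⟨x * a, I.mul_mem_right a x.2⟩, ?_, rfl⟩
    obtain ⟨l, hl, -, hr, -⟩ := I.exists_approximateUnit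
    refine J.isClosed.mem_of_tendsto (b := l)
      (f := fun e => x * (⟨(e : I) * a, I.mul_mem_right a e.2⟩ : I)) ?_
      (Filter.Eventually.of_forall fun e => J.mul_mem_right _ hx)
    rw [tendsto_subtype_rng]
    have h := ((continuous_subtype_val.tendsto _).comp (hr x)).mul_const a
    refine h.congr fun e => ?_
    exact mul_assoc (x : A) (e : A) a
  isClosed' := I.isClosed.isClosedEmbedding_subtypeVal.isClosedMap _ J.isClosed

theorem mem_ofIdeal {J : ClosedIdeal I} {x : I} : (x : A) ∈ I.ofIdeal J ↔ x ∈ J :=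
  ⟨by rintro ⟨y, hy, h⟩; rwa [← Subtype.ext h], fun h => ⟨x, h, rfl⟩⟩

end ClosedIdeal
namespace DegreeMap

variable {k : ℕ} {Λ : Type u} [Category.{v} Λ] {d : DegreeMap k Λ}

/-! ### Initial segments of paths -/

/-- The path `p` is an initial segment of the path `q` with the same range. -/
def IsInitial {v : Λ} (p q : Σ w : Λ, (w ⟶ v)) : Prop := ∃ n : q.1 ⟶ p.1, n ≫ p.2 = q.2

/-- The product `l p`. -/
def prepend {w v : Λ} (l : w ⟶ v) (p : Σ u : Λ, (u ⟶ w)) : Σ u : Λ, (u ⟶ v) := ⟨p.1, p.2 ≫ l⟩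

theorem IsInitial.refl {v : Λ} (p : Σ w : Λ, (w ⟶ v)) : IsInitial p p :=
  ⟨𝟙 _, Category.id_comp _⟩

theorem IsInitial.trans {v : Λ} {p q r : Σ w : Λ, (w ⟶ v)} (h : IsInitial p q)
    (h' : IsInitial q r) : IsInitial p r := by
  obtain ⟨n, hn⟩ := h
  obtain ⟨n', hn'⟩ := h'
  exact ⟨n' ≫ n, by rw [Category.assoc, hn, hn']⟩

theorem IsInitial.prepend {w v : Λ} (l : w ⟶ v) {p q : Σ u : Λ, (u ⟶ w)} (h : IsInitial p q) :
    IsInitial (prepend l p) (prepend l q) := by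
  obtain ⟨n, hn⟩ := h
  exact ⟨n, by simp only [DegreeMap.prepend, ← hn, Category.assoc]⟩

theorem isInitial_prepend {w v : Λ} (l : w ⟶ v) (p : Σ u : Λ, (u ⟶ w)) :
    IsInitial ⟨w, l⟩ (prepend l p) := ⟨p.2, rfl⟩

theorem deg_prepend {w v : Λ} (l : w ⟶ v) (p : Σ u : Λ, (u ⟶ w)) :
    d.deg (prepend l p).2 = d.deg l + d.deg p.2 := d.deg_comp _ _

theorem prepend_comp {u w v : Λ} (l : w ⟶ v) (m : u ⟶ w) (p : Σ x : Λ, (x ⟶ u)) :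
    prepend (m ≫ l) p = prepend l (prepend m p) := by
  simp [prepend]

/-- This is the uniqueness half of the factorisation property. The remainders are compared by `HEq`
because their ranges `p.1` and `q.1` are not equal by definition. -/
theorem IsKGraph.eq_of_comp_eq (hd : d.IsKGraph) {v : Λ} {p q : Σ w : Λ, (w ⟶ v)} {u : Λ}
    {a : u ⟶ p.1} {b : u ⟶ q.1} (h : a ≫ p.2 = b ≫ q.2) (hpq : d.deg p.2 = d.deg q.2) :
    p = q ∧ HEq a b := by
  have hdeg : d.deg a = d.deg b := by
    have := congrArg d.deg h
    rw [d.deg_comp, d.deg_comp, hpq] at this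
    exact add_left_cancel this
  have hu := (hd.factorisation (a ≫ p.2) (d.deg p.2) (d.deg a) (d.deg_comp _ _)).unique
    (y₁ := ⟨p.1, a, p.2⟩) (y₂ := ⟨q.1, b, q.2⟩) ⟨rfl, rfl, rfl⟩ ⟨h.symm, hpq.symm, hdeg.symm⟩
  obtain ⟨p1, p2⟩ := p
  obtain ⟨q1, q2⟩ := q
  simp only [Sigma.mk.injEq] at hu
  obtain ⟨rfl, hu⟩ := hu
  simp only [heq_eq_eq, Prod.mk.injEq] at hu
  exact ⟨by rw [hu.2], heq_of_eq hu.1⟩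

theorem IsKGraph.cancel (hd : d.IsKGraph) {u w v : Λ} {l : w ⟶ v} {a b : u ⟶ w}
    (h : a ≫ l = b ≫ l) : a = b :=
  eq_of_heq (hd.eq_of_comp_eq (p := ⟨w, l⟩) (q := ⟨w, l⟩) h rfl).2

theorem IsKGraph.prepend_injective (hd : d.IsKGraph) {w v : Λ} (l : w ⟶ v) :
    Function.Injective (prepend l) := by
  rintro ⟨u, a⟩ ⟨u', b⟩ h
  simp only [prepend, Sigma.mk.injEq] at h
  obtain ⟨rfl, h⟩ := h
  rw [hd.cancel (eq_of_heq h)]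

theorem IsKGraph.isInitial_of_prepend (hd : d.IsKGraph) {w v : Λ} {l : w ⟶ v}
    {p q : Σ u : Λ, (u ⟶ w)} (h : IsInitial (prepend l p) (prepend l q)) : IsInitial p q := by
  obtain ⟨n, hn⟩ := h
  refine ⟨n, hd.cancel (l := l) ?_⟩
  exact (Category.assoc _ _ _).trans hn

theorem IsKGraph.eq_of_isInitial (hd : d.IsKGraph) {v : Λ} {p q r : Σ w : Λ, (w ⟶ v)}
    (hp : IsInitial p r) (hq : IsInitial q r) (h : d.deg p.2 = d.deg q.2) : p = q := by
  obtain ⟨a, ha⟩ := hp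
  obtain ⟨b, hb⟩ := hq
  exact (hd.eq_of_comp_eq (ha.trans hb.symm) h).1

theorem IsKGraph.exists_factor (hd : d.IsKGraph) {w v : Λ} (l : w ⟶ v) {m : Fin k → ℕ}
    (hm : m ≤ d.deg l) : ∃ (u : Λ) (a : w ⟶ u) (b : u ⟶ v), a ≫ b = l ∧ d.deg b = m ∧
      d.deg a = d.deg l - m := by
  obtain ⟨p, hp, -⟩ := hd.factorisation l m (d.deg l - m) (by rw [add_tsub_cancel_of_le hm])
  exact ⟨p.1, p.2.1, p.2.2, hp⟩

theorem IsKGraph.eq_id_of_deg (hd : d.IsKGraph) {w v : Λ} (l : w ⟶ v) (h : d.deg l = 0) :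
    (⟨w, l⟩ : Σ w : Λ, (w ⟶ v)) = ⟨v, 𝟙 v⟩ :=
  (hd.eq_of_comp_eq (p := ⟨w, l⟩) (q := ⟨v, 𝟙 v⟩) (a := 𝟙 w) (b := l) (by simp)
    (by simp [h, d.deg_id])).1

theorem IsKGraph.paths_nonempty_of_le (hd : d.IsKGraph) {w v : Λ} (l : w ⟶ v) {m : Fin k → ℕ}
    (hm : m ≤ d.deg l) : (d.paths m v).Nonempty := by
  obtain ⟨u, a, b, -, h, -⟩ := hd.exists_factor l hm
  exact ⟨⟨u, b⟩, h⟩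

theorem basisVec_le_iff (i : Fin k) (m : Fin k → ℕ) : basisVec i ≤ m ↔ 0 < m i := by
  constructor
  · intro h
    simpa [Nat.pos_iff_ne_zero, Nat.one_le_iff_ne_zero] using h i
  · intro h j
    by_cases hj : j = i
    · subst hj; simpa using! h
    · simp [basisVec, hj]

theorem add_basisVec_le_iff {p m : Fin k → ℕ} (hp : p ≤ m) (i : Fin k) :
    p + basisVec i ≤ m ↔ p i < m i := by
  constructor
  · intro h
    have := h i
    simp at this
    omega
  · intro h j
    by_cases hj : j = i
    · subst hj; simpa using h
    · simpa [basisVec, hj] using hp j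

/-! ### The sets `Λ^{≤ m}(v)` -/

theorem mem_pathsUpTo_of_deg {m : Fin k → ℕ} {v : Λ} {p : Σ w : Λ, (w ⟶ v)}
    (h : d.deg p.2 = m) : p ∈ d.pathsUpTo m v :=
  ⟨h.le, fun i hi => absurd (hi i) (by simp [h])⟩

/-- Prepending `l` shifts all degrees by `d(l)` and leaves the source alone, so neither the bound
nor the maximality condition changes. -/
theorem prepend_mem_pathsUpTo_iff {w v : Λ} (l : w ⟶ v) {m : Fin k → ℕ}
    {p : Σ u : Λ, (u ⟶ w)} :
    prepend l p ∈ d.pathsUpTo (d.deg l + m) v ↔ p ∈ d.pathsUpTo m w := by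
  simp only [pathsUpTo, Set.mem_ofPred_eq, deg_prepend, add_assoc, add_le_add_iff_left]
  rfl

/-- If `q` were longer than `p` in direction `i`, the part of `r` after `p` would contain an edge of
colour `i`, and one could be moved to its front. This is an edge at `s(p)` that membership of `p` in
`Λ^{≤ m}(v)` excludes. -/
theorem IsKGraph.deg_le_of_isInitial (hd : d.IsKGraph) {v : Λ} {m : Fin k → ℕ}
    {p q r : Σ w : Λ, (w ⟶ v)} (hp : p ∈ d.pathsUpTo m v) (hq : d.deg q.2 ≤ m)
    (hpr : IsInitial p r) (hqr : IsInitial q r) : d.deg q.2 ≤ d.deg p.2 := by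
  intro i
  by_contra hlt
  replace hlt : d.deg p.2 i < d.deg q.2 i := not_le.1 hlt
  obtain ⟨a, ha⟩ := hpr
  obtain ⟨b, hb⟩ := hqr
  have h1 : d.deg p.2 + d.deg a = d.deg q.2 + d.deg b := by
    rw [← d.deg_comp, ← d.deg_comp, ha, hb]
  have h2 : d.deg p.2 i + d.deg a i = d.deg q.2 i + d.deg b i := congrFun h1 i
  have h3 : d.deg p.2 + basisVec i ≤ m :=
    (add_basisVec_le_iff hp.1 i).2 (hlt.trans_le (hq i))
  have h4 := hd.paths_nonempty_of_le a ((basisVec_le_iff i (d.deg a)).2 (by omega))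
  rw [hp.2 i h3] at h4
  exact Set.not_nonempty_empty h4

/-- A path has at most one initial segment in `Λ^{≤ m}(v)`. All uniqueness arguments about boundary
paths reduce to this. -/
theorem IsKGraph.eq_of_mem_pathsUpTo (hd : d.IsKGraph) {v : Λ} {m : Fin k → ℕ}
    {p q r : Σ w : Λ, (w ⟶ v)} (hp : p ∈ d.pathsUpTo m v) (hq : q ∈ d.pathsUpTo m v)
    (hpr : IsInitial p r) (hqr : IsInitial q r) : p = q :=
  hd.eq_of_isInitial hpr hqr (le_antisymm (hd.deg_le_of_isInitial hq hp.1 hqr hpr)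
    (hd.deg_le_of_isInitial hp hq.1 hpr hqr))

theorem finite_pathsUpTo (hr : d.RowFinite) (m : Fin k → ℕ) (v : Λ) :
    (d.pathsUpTo m v).Finite :=
  ((Set.finite_Iic m).biUnion fun n _ => hr v n).subset fun p hp =>
    Set.mem_iUnion₂.2 ⟨d.deg p.2, hp.1, rfl⟩

/-- Among the finitely many paths of degree at most `m`, one of maximal length admits no extension
within `m`. -/
theorem pathsUpTo_nonempty (hr : d.RowFinite) (m : Fin k → ℕ) (v : Λ) :
    (d.pathsUpTo m v).Nonempty := by
  have hfin : {p : Σ w : Λ, (w ⟶ v) | d.deg p.2 ≤ m}.Finite :=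
    ((Set.finite_Iic m).biUnion fun n _ => hr v n).subset fun p hp =>
      Set.mem_iUnion₂.2 ⟨d.deg p.2, hp, rfl⟩
  obtain ⟨p, hp, hmax⟩ := Set.exists_max_image _ (fun p => ∑ i, d.deg p.2 i) hfin
    ⟨⟨v, 𝟙 v⟩, by simp [d.deg_id]⟩
  refine ⟨p, hp, fun i hi => Set.eq_empty_iff_forall_notMem.2 fun q hq => ?_⟩
  have hq' : d.deg q.2 = basisVec i := hq
  have h := hmax (prepend p.2 q) (by rw [Set.mem_ofPred_eq, deg_prepend, hq']; exact hi)
  simp [deg_prepend, hq', Finset.sum_add_distrib] at h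

/-- In a locally convex graph, edges of colour `i` persist along paths of degree `0` in the
direction `i`. -/
theorem LocallyConvex.paths_nonempty (hc : d.LocallyConvex) (hd : d.IsKGraph) {i : Fin k}
    {w v : Λ} (l : w ⟶ v) (hl : d.deg l i = 0) (hv : (d.paths (basisVec i) v).Nonempty) :
    (d.paths (basisVec i) w).Nonempty := by
  induction hn : ∑ j, d.deg l j generalizing w v with
  | zero =>
    have h0 : d.deg l = 0 := by
      ext j
      exact (Finset.sum_eq_zero_iff.1 hn) j (Finset.mem_univ j)
    have h := congrArg Sigma.fst (hd.eq_id_of_deg l h0)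
    simp only at h
    subst h
    exact hv
  | succ n ih =>
    obtain ⟨j, hj⟩ : ∃ j, 0 < d.deg l j := by
      by_contra! h
      have : ∑ j, d.deg l j = 0 := Finset.sum_eq_zero fun j _ => by simpa using h j
      omega
    obtain ⟨u, a, b, hab, hb, ha⟩ := hd.exists_factor l ((basisVec_le_iff j _).2 hj)
    have hij : i ≠ j := by rintro rfl; omega
    obtain ⟨e, he⟩ := hv
    -- The first edge `b` of `l` has colour `j ≠ i`, so local convexity carries the edge of colour
    -- `i` from `v` to `s(b)`; the remainder `a` is shorter.
    have hu : (d.paths (basisVec i) u).Nonempty := (hc v i j hij e he ⟨u, b⟩ hb).2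
    have hdeg : d.deg l = d.deg b + d.deg a := by rw [← d.deg_comp, hab]
    refine ih a ?_ hu ?_
    · rw [ha]; simp [hl]
    · rw [hdeg, hb] at hn
      simp [Finset.sum_add_distrib] at hn
      omega

/-- Cut `q` at degree `m ⊓ d(q)`. If the segment could still be extended by colour `i` within `m`,
then `d(q)_i < m_i ≤ n_i` and the rest of `q` has degree `0` in direction `i`. By local convexity
the edge of colour `i` would persist to `s(q)`, contrary to the maximality of `q`. -/
theorem LocallyConvex.exists_isInitial (hc : d.LocallyConvex) (hd : d.IsKGraph) {v : Λ}
    {m n : Fin k → ℕ} (hmn : m ≤ n) {q : Σ w : Λ, (w ⟶ v)} (hq : q ∈ d.pathsUpTo n v) :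
    ∃ p ∈ d.pathsUpTo m v, IsInitial p q := by
  obtain ⟨u, a, b, hab, hb, ha⟩ := hd.exists_factor q.2 (m := m ⊓ d.deg q.2) inf_le_right
  refine ⟨⟨u, b⟩, ⟨hb.le.trans inf_le_left, fun i hi => ?_⟩, a, hab⟩
  have hbm : d.deg b ≤ m := hb.le.trans inf_le_left
  have h1 : d.deg b i < m i := (add_basisVec_le_iff hbm i).1 hi
  have h2 : d.deg q.2 i < m i := by
    rw [hb] at h1
    simpa using h1
  have h3 := hq.2 i ((add_basisVec_le_iff hq.1 i).2 (h2.trans_le (hmn i)))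
  by_contra hne
  have h4 := hc.paths_nonempty hd a (by
    rw [ha]; simp only [Pi.sub_apply, Pi.inf_apply]; omega) (Set.nonempty_iff_ne_empty.2 hne)
  rw [h3] at h4
  exact Set.not_nonempty_empty h4

/-! ### Boundary paths -/

variable (d) in
/-- A boundary path with range `v`: a compatible family of paths in the sets `Λ^{≤ m}(v)`. -/
@[ext]
structure Boundary (v : Λ) where
  seg : (Fin k → ℕ) → Σ w : Λ, (w ⟶ v)
  seg_mem : ∀ m, seg m ∈ d.pathsUpTo m v
  isInitial : ∀ {m n}, m ≤ n → IsInitial (seg m) (seg n)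

/-- Every vertex is the range of a boundary path. -/
theorem nonempty_boundary (hd : d.IsKGraph) (hr : d.RowFinite) (hc : d.LocallyConvex) (v : Λ) :
    Nonempty (d.Boundary v) := by
  choose f hf hfi using fun (m n : Fin k → ℕ) (h : m ≤ n) (q : d.pathsUpTo n v) =>
    hc.exists_isInitial hd h q.2
  let _ : Category (Fin k → ℕ) := Preorder.smallCategory _
  -- The sets `Λ^{≤ m}(v)` with truncation form an inverse system of finite nonempty sets,
  -- functorial because truncations are unique; a boundary path is a compatible choice, which exists
  -- by compactness.
  let F : (Fin k → ℕ)ᵒᵖ ⥤ Type (max u v) :=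
    { obj := fun m => d.pathsUpTo m.unop v
      map := fun {n m} h => TypeCat.ofHom fun q => ⟨f m.unop n.unop (leOfHom h.unop) q, hf _ _ _ q⟩
      map_id := fun n => by
        refine ConcreteCategory.hom_ext _ _ fun q => Subtype.ext ?_
        exact hd.eq_of_mem_pathsUpTo (hf _ _ _ q) q.2 (hfi _ _ _ q) (IsInitial.refl _)
      map_comp := fun {a b c} h h' => by
        refine ConcreteCategory.hom_ext _ _ fun q => Subtype.ext ?_
        exact hd.eq_of_mem_pathsUpTo (hf _ _ _ q) (hf _ _ _ _) (hfi _ _ _ q)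
          ((hfi _ _ _ ⟨_, hf _ _ (leOfHom h.unop) q⟩).trans (hfi _ _ _ q)) }
  have : ∀ j, Finite (F.obj j) := fun j => (finite_pathsUpTo hr j.unop v).to_subtype
  have : ∀ j, Nonempty (F.obj j) := fun j => (pathsUpTo_nonempty hr j.unop v).to_subtype
  obtain ⟨x, hx⟩ := nonempty_sections_of_finite_inverse_system F
  refine ⟨⟨fun m => (x (Opposite.op m)).1, fun m => (x (Opposite.op m)).2, fun {m n} h => ?_⟩⟩
  have := hx (homOfLE h).op
  rw [← this]
  exact hfi _ _ _ _

/-- The boundary path `l x`. -/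
def Boundary.prepend (hd : d.IsKGraph) (hc : d.LocallyConvex) {w v : Λ} (l : w ⟶ v)
    (x : d.Boundary w) : d.Boundary v :=
  -- The product of `l` with the segment of `x` at `m` is in `Λ^{≤ d(l) + m}(v)`; its truncation to
  -- `m` is the segment of `l x` at `m`.
  have h m := hc.exists_isInitial hd (m := m) le_add_self
    ((prepend_mem_pathsUpTo_iff l).2 (x.seg_mem m))
  { seg := fun m => (h m).choose
    seg_mem := fun m => (h m).choose_spec.1
    isInitial := fun {m n} hmn => by
      obtain ⟨r, hr, hri⟩ := hc.exists_isInitial hd hmn (h n).choose_spec.1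
      rw [hd.eq_of_mem_pathsUpTo (h m).choose_spec.1 hr
        ((h m).choose_spec.2.trans ((x.isInitial hmn).prepend l))
        (hri.trans (h n).choose_spec.2)]
      exact hri }

namespace Boundary

variable (hd : d.IsKGraph) (hc : d.LocallyConvex)

theorem isInitial_prepend_seg {w v : Λ} (l : w ⟶ v) (x : d.Boundary w) (m : Fin k → ℕ) :
    IsInitial ((x.prepend hd hc l).seg m) (DegreeMap.prepend l (x.seg m)) :=
  (hc.exists_isInitial hd (m := m) le_add_self
    ((prepend_mem_pathsUpTo_iff l).2 (x.seg_mem m))).choose_spec.2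

/-- The segments of `l x` are defined by choice. This criterion identifies them: an element of `Λ^{≤
m}(v)` that is initial in `l x(n)` for a single `n ≥ m` is the segment at `m`. -/
theorem eq_prepend_seg {w v : Λ} (l : w ⟶ v) (x : d.Boundary w) {m n : Fin k → ℕ}
    {p : Σ u : Λ, (u ⟶ v)} (hp : p ∈ d.pathsUpTo m v)
    (h : IsInitial p (DegreeMap.prepend l (x.seg n))) (hmn : m ≤ n) :
    (x.prepend hd hc l).seg m = p :=
  hd.eq_of_mem_pathsUpTo ((x.prepend hd hc l).seg_mem m) hp
    ((isInitial_prepend_seg hd hc l x m).trans ((x.isInitial hmn).prepend l)) h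

theorem prepend_seg_add {w v : Λ} (l : w ⟶ v) (x : d.Boundary w) (m : Fin k → ℕ) :
    (x.prepend hd hc l).seg (d.deg l + m) = DegreeMap.prepend l (x.seg m) :=
  eq_prepend_seg hd hc l x ((prepend_mem_pathsUpTo_iff l).2 (x.seg_mem m))
    ((x.isInitial le_add_self).prepend l) le_rfl

theorem prepend_id (v : Λ) (x : d.Boundary v) : x.prepend hd hc (𝟙 v) = x := by
  ext1
  funext m
  refine eq_prepend_seg hd hc _ x (x.seg_mem m) (n := m) ?_ le_rfl
  simpa [DegreeMap.prepend] using! IsInitial.refl _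

theorem prepend_comp {u w v : Λ} (l : w ⟶ v) (m : u ⟶ w) (x : d.Boundary u) :
    x.prepend hd hc (m ≫ l) = (x.prepend hd hc m).prepend hd hc l := by
  ext1
  funext n
  refine eq_prepend_seg hd hc _ x (Boundary.seg_mem _ n) (n := n) ?_ le_rfl
  rw [DegreeMap.prepend_comp]
  exact (isInitial_prepend_seg hd hc l _ n).trans
    ((isInitial_prepend_seg hd hc m x n).prepend l)

theorem prepend_injective {w v : Λ} (l : w ⟶ v) :
    Function.Injective (Boundary.prepend hd hc l : d.Boundary w → d.Boundary v) := by
  intro x y h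
  ext1
  funext m
  refine hd.prepend_injective l ?_
  rw [← prepend_seg_add hd hc l x, ← prepend_seg_add hd hc l y, h]

theorem prepend_seg_self {w v : Λ} (l : w ⟶ v) (x : d.Boundary w) {m : Fin k → ℕ}
    (hl : (⟨w, l⟩ : Σ w : Λ, (w ⟶ v)) ∈ d.pathsUpTo m v) :
    (x.prepend hd hc l).seg m = ⟨w, l⟩ :=
  eq_prepend_seg hd hc l x hl (isInitial_prepend l _) le_rfl

/-- The tail of `y` after `l = y(m)` is read off from the segments of `y` at the degrees `d(l) + n`.
-/
theorem exists_prepend {v : Λ} (y : d.Boundary v) (m : Fin k → ℕ) :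
    ∃ x : d.Boundary (y.seg m).1, x.prepend hd hc (y.seg m).2 = y := by
  set l := (y.seg m).2 with hl
  -- Possibly `m` is not below `d(l) + n`. But `l` is also in `Λ^{≤ d(l)}(v)`, so it is the
  -- truncation of `y(d(l) + n)` to `d(l)`: both are initial in `y(m + (d(l) + n))`.
  have h1 : ∀ n, IsInitial (y.seg m) (y.seg (d.deg l + n)) := by
    intro n
    obtain ⟨p, hp, hpi⟩ := hc.exists_isInitial hd (m := d.deg l) le_self_add
      (y.seg_mem (d.deg l + n))
    have : p = y.seg m := hd.eq_of_mem_pathsUpTo hp (mem_pathsUpTo_of_deg rfl)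
      (hpi.trans (y.isInitial (le_add_self (b := m)))) (y.isInitial le_self_add)
    exact this.subst (motive := fun q => IsInitial q (y.seg (d.deg l + n))) hpi
  choose g hg using h1
  have h2 : ∀ n, DegreeMap.prepend l ⟨_, g n⟩ = y.seg (d.deg l + n) := fun n =>
    Sigma.ext rfl (heq_of_eq (hg n))
  refine ⟨⟨fun n => ⟨_, g n⟩, fun n => ?_, fun {n n'} hn => ?_⟩, ?_⟩
  · rw [← prepend_mem_pathsUpTo_iff l, h2]
    exact y.seg_mem _
  · refine hd.isInitial_of_prepend (l := l) ?_
    rw [h2, h2]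
    exact y.isInitial (by gcongr)
  · ext1
    funext n
    refine eq_prepend_seg hd hc l _ (y.seg_mem n) (n := n) ?_ le_rfl
    rw [h2]
    exact y.isInitial le_add_self

end Boundary

end DegreeMap

/-! ### Partial isometries of `ℓ²` -/

section Spans

variable {X : Type u} {Y : Type v}

/-- The Hilbert space `ℓ²(X)`. -/
abbrev EllTwo (X : Type u) : Type u := lp (fun _ : X => ℂ) 2

theorem memℓp_extend {f g : Y → X} (hf : Function.Injective f) (hg : Function.Injective g)
    (ξ : EllTwo X) : Memℓp (Function.extend f (fun y => ξ (g y)) 0 : X → ℂ) 2 := by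
  refine memℓp_gen ?_
  have h := (lp.memℓp ξ).summable (by norm_num)
  have h2 : Summable fun y => ‖ξ (g y)‖ ^ (2 : ENNReal).toReal := h.comp_injective hg
  rw [← Function.Injective.summable_iff hf]
  · exact h2.congr fun y => by simp only [Function.comp_apply, hf.extend_apply]
  · intro x hx
    rw [Function.extend_apply' _ _ _ (by simpa using hx)]
    simp

/-- The operator on `ℓ²(X)` that moves the coordinate `g y` to the coordinate `f y`. -/
def spanMap (f g : Y → X) (hf : Function.Injective f) (hg : Function.Injective g) :
    EllTwo X →ₗ[ℂ] EllTwo X where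
  toFun ξ := ⟨Function.extend f (fun y => ξ (g y)) 0, memℓp_extend hf hg ξ⟩
  map_add' ξ η := by
    refine lp.ext (funext fun x => ?_)
    change Function.extend f (fun y => ξ (g y) + η (g y)) 0 x =
      Function.extend f (fun y => ξ (g y)) 0 x + Function.extend f (fun y => η (g y)) 0 x
    by_cases hx : ∃ y, f y = x
    · obtain ⟨y, rfl⟩ := hx
      simp only [hf.extend_apply]
    · simp only [Function.extend_apply' _ _ _ hx, Pi.zero_apply, add_zero]
  map_smul' c ξ := by
    refine lp.ext (funext fun x => ?_)
    change Function.extend f (fun y => c * ξ (g y)) 0 x =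
      c * Function.extend f (fun y => ξ (g y)) 0 x
    by_cases hx : ∃ y, f y = x
    · obtain ⟨y, rfl⟩ := hx
      simp only [hf.extend_apply]
    · simp only [Function.extend_apply' _ _ _ hx, Pi.zero_apply, mul_zero]

theorem spanMap_apply {f g : Y → X} (hf : Function.Injective f) (hg : Function.Injective g)
    (ξ : EllTwo X) (y : Y) : spanMap f g hf hg ξ (f y) = ξ (g y) := by
  change Function.extend f (fun y => ξ (g y)) 0 (f y) = ξ (g y)
  rw [hf.extend_apply]

theorem spanMap_apply' {f g : Y → X} (hf : Function.Injective f) (hg : Function.Injective g)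
    (ξ : EllTwo X) {x : X} (hx : ¬ ∃ y, f y = x) : spanMap f g hf hg ξ x = 0 := by
  change Function.extend f (fun y => ξ (g y)) 0 x = 0
  rw [Function.extend_apply' _ _ _ hx]
  rfl

theorem norm_spanMap_le (f g : Y → X) (hf : Function.Injective f) (hg : Function.Injective g)
    (ξ : EllTwo X) : ‖spanMap f g hf hg ξ‖ ≤ 1 * ‖ξ‖ := by
  rw [one_mul]
  refine lp.norm_le_of_tsum_le (by norm_num) (norm_nonneg _) ?_
  rw [lp.norm_rpow_eq_tsum (by norm_num)]
  have h := (lp.memℓp ξ).summable (by norm_num)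
  have h1 : ∑' x, ‖spanMap f g hf hg ξ x‖ ^ (2 : ENNReal).toReal
      = ∑' y, ‖ξ (g y)‖ ^ (2 : ENNReal).toReal := by
    rw [← hf.tsum_eq]
    · exact tsum_congr fun y => by rw [spanMap_apply]
    · intro x hx
      by_contra hn
      refine hx ?_
      have : spanMap f g hf hg ξ x = 0 := spanMap_apply' hf hg ξ (by simpa using hn)
      simp [this]
  rw [h1]
  exact (h.comp_injective hg).tsum_le_tsum_of_inj g hg (fun _ _ => by positivity)
    (fun _ => le_rfl) h

/-- `spanMap` as a bounded operator. -/
def spanOp (f g : Y → X) (hf : Function.Injective f) (hg : Function.Injective g) :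
    EllTwo X →L[ℂ] EllTwo X :=
  (spanMap f g hf hg).mkContinuous 1 (norm_spanMap_le f g hf hg)

theorem spanOp_apply {f g : Y → X} (hf : Function.Injective f) (hg : Function.Injective g)
    (ξ : EllTwo X) (y : Y) : spanOp f g hf hg ξ (f y) = ξ (g y) :=
  spanMap_apply hf hg ξ y

theorem spanOp_apply' {f g : Y → X} (hf : Function.Injective f) (hg : Function.Injective g)
    (ξ : EllTwo X) {x : X} (hx : ¬ ∃ y, f y = x) : spanOp f g hf hg ξ x = 0 :=
  spanMap_apply' hf hg ξ hx

/-- Both inner products reduce to the sum over `Y` of the products of `ξ (f y)` and `η (g y)`, since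
the other terms vanish. -/
theorem star_spanOp (f g : Y → X) (hf : Function.Injective f) (hg : Function.Injective g) :
    star (spanOp f g hf hg) = spanOp g f hg hf := by
  rw [ContinuousLinearMap.star_eq_adjoint]
  refine (ContinuousLinearMap.eq_adjoint_iff _ _).2 (fun ξ η => ?_) |>.symm
  rw [lp.inner_eq_tsum, lp.inner_eq_tsum, ← hg.tsum_eq, ← hf.tsum_eq]
  · exact tsum_congr fun y => by rw [spanOp_apply, spanOp_apply]
  · intro x hx
    by_contra hn
    refine hx ?_
    exact (congrArg (inner ℂ (ξ x)) (spanOp_apply' hf hg η (by simpa using hn))).trans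
      (inner_zero_right _)
  · intro x hx
    by_contra hn
    refine hx ?_
    exact (congrArg (inner ℂ · (η x)) (spanOp_apply' hg hf ξ (by simpa using hn))).trans
      (inner_zero_left _)

end Spans

namespace DegreeMap

variable {k : ℕ} {Λ : Type u} [Category.{v} Λ] {d : DegreeMap k Λ}
  (hd : d.IsKGraph) (hc : d.LocallyConvex)

variable (d) in
/-- The operators on the boundary path space. -/
abbrev BoundarySpace : Type (max u v) := EllTwo (Σ v : Λ, d.Boundary v)

theorem sigma_prepend_injective {w v : Λ} (l : w ⟶ v) : Function.Injective
    (fun x : d.Boundary w => (⟨v, x.prepend hd hc l⟩ : Σ v : Λ, d.Boundary v)) := fun _ _ h =>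
  Boundary.prepend_injective hd hc l (eq_of_heq (Sigma.mk.inj h).2)

/-- The boundary path representation. -/
def boundaryRep ⦃w v : Λ⦄ (l : w ⟶ v) : d.BoundarySpace →L[ℂ] d.BoundarySpace :=
  spanOp (fun x : d.Boundary w => ⟨v, x.prepend hd hc l⟩) (fun x => ⟨w, x⟩)
    (sigma_prepend_injective hd hc l) sigma_mk_injective

theorem boundaryRep_apply {w v : Λ} (l : w ⟶ v) (ξ : d.BoundarySpace) (x : d.Boundary w) :
    boundaryRep hd hc l ξ ⟨v, x.prepend hd hc l⟩ = ξ ⟨w, x⟩ :=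
  spanOp_apply (sigma_prepend_injective hd hc l) sigma_mk_injective ξ x

theorem boundaryRep_apply_of_ne {w v v' : Λ} (l : w ⟶ v) (ξ : d.BoundarySpace)
    (y : d.Boundary v') (h : v' ≠ v) : boundaryRep hd hc l ξ ⟨v', y⟩ = 0 :=
  spanOp_apply' _ _ _ (by rintro ⟨x, hx⟩; exact h (Sigma.mk.inj hx).1.symm)

theorem boundaryRep_apply_of_forall_ne {w v : Λ} (l : w ⟶ v) (ξ : d.BoundarySpace)
    (y : d.Boundary v) (h : ∀ x : d.Boundary w, x.prepend hd hc l ≠ y) :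
    boundaryRep hd hc l ξ ⟨v, y⟩ = 0 :=
  spanOp_apply' _ _ _ (by rintro ⟨x, hx⟩; exact h x (eq_of_heq (Sigma.mk.inj hx).2))

theorem star_boundaryRep_apply {w v : Λ} (l : w ⟶ v) (ξ : d.BoundarySpace) (x : d.Boundary w) :
    star (boundaryRep hd hc l) ξ ⟨w, x⟩ = ξ ⟨v, x.prepend hd hc l⟩ := by
  rw [boundaryRep, star_spanOp]
  exact spanOp_apply sigma_mk_injective (sigma_prepend_injective hd hc l) ξ x

theorem star_boundaryRep_apply_of_ne {w v w' : Λ} (l : w ⟶ v) (ξ : d.BoundarySpace)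
    (x : d.Boundary w') (h : w' ≠ w) : star (boundaryRep hd hc l) ξ ⟨w', x⟩ = 0 := by
  rw [boundaryRep, star_spanOp]
  exact spanOp_apply' _ _ _ (by rintro ⟨y, hy⟩; exact h (Sigma.mk.inj hy).1.symm)

theorem boundaryRep_id_apply (v : Λ) (ξ : d.BoundarySpace) (x : d.Boundary v) :
    boundaryRep hd hc (𝟙 v) ξ ⟨v, x⟩ = ξ ⟨v, x⟩ := by
  have := boundaryRep_apply hd hc (𝟙 v) ξ x
  rwa [Boundary.prepend_id] at this

theorem boundaryRep_comp {u w v : Λ} (l : w ⟶ v) (m : u ⟶ w) :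
    boundaryRep hd hc (m ≫ l) = boundaryRep hd hc l * boundaryRep hd hc m := by
  ext ξ ⟨v', y⟩
  rw [mul_apply_eq_comp]
  by_cases hv : v' = v
  · subst hv
    by_cases hy : ∃ x : d.Boundary w, x.prepend hd hc l = y
    · obtain ⟨x, rfl⟩ := hy
      rw [boundaryRep_apply]
      by_cases hx : ∃ z : d.Boundary u, z.prepend hd hc m = x
      · obtain ⟨z, rfl⟩ := hx
        rw [boundaryRep_apply, ← Boundary.prepend_comp, boundaryRep_apply]
      · push Not at hx
        rw [boundaryRep_apply_of_forall_ne hd hc m ξ x hx, boundaryRep_apply_of_forall_ne]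
        intro z hz
        rw [Boundary.prepend_comp] at hz
        exact hx z (Boundary.prepend_injective hd hc l hz)
    · push Not at hy
      rw [boundaryRep_apply_of_forall_ne hd hc l _ y hy, boundaryRep_apply_of_forall_ne]
      intro z hz
      rw [Boundary.prepend_comp] at hz
      exact hy _ hz
  · rw [boundaryRep_apply_of_ne hd hc _ _ _ hv, boundaryRep_apply_of_ne hd hc _ _ _ hv]

theorem star_boundaryRep_mul_self {w v : Λ} (l : w ⟶ v) :
    star (boundaryRep hd hc l) * boundaryRep hd hc l = boundaryRep hd hc (𝟙 w) := by
  ext ξ ⟨w', x⟩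
  rw [mul_apply_eq_comp]
  by_cases hw : w' = w
  · subst hw
    rw [star_boundaryRep_apply, boundaryRep_apply, boundaryRep_id_apply]
  · rw [star_boundaryRep_apply_of_ne hd hc _ _ _ hw, boundaryRep_apply_of_ne hd hc _ _ _ hw]

/-- For the summation relation, a boundary path `y` with range `v` begins with exactly one element
of `Λ^{≤ m}(v)`, namely `y.seg m`. So exactly one range projection is the identity at the coordinate
`y`, and the others vanish there. -/
theorem isCKFamily_boundaryRep : d.IsCKFamily (boundaryRep hd hc) where
  partial_isometry w v l := by
    rw [mul_assoc, star_boundaryRep_mul_self, ← boundaryRep_comp, Category.id_comp]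
  vertex_mul_self v := by rw [← boundaryRep_comp, Category.id_comp]
  vertex_star v := by
    rw [← star_boundaryRep_mul_self hd hc (𝟙 v), star_mul, star_star]
  vertex_orthogonal v v' h := by
    ext ξ ⟨v'', y⟩
    rw [mul_apply_eq_comp]
    by_cases hv : v'' = v
    · subst hv
      rw [boundaryRep_id_apply, boundaryRep_apply_of_ne hd hc _ _ _ h]
      rfl
    · rw [boundaryRep_apply_of_ne hd hc _ _ _ hv]
      rfl
  comp _ _ _ l m := boundaryRep_comp hd hc l m
  star_mul_self _ _ l := star_boundaryRep_mul_self hd hc l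
  sum v m T hT := by
    ext ξ ⟨v', y⟩
    rw [sum_apply, lp.coeFn_sum, Finset.sum_apply]
    by_cases hv : v' = v
    · subst hv
      rw [boundaryRep_id_apply]
      have hmem : y.seg m ∈ T := by
        rw [← Finset.mem_coe, hT]
        exact y.seg_mem m
      rw [Finset.sum_eq_single_of_mem (y.seg m) hmem]
      · obtain ⟨x, hx⟩ := Boundary.exists_prepend hd hc y m
        have h1 := boundaryRep_apply hd hc (y.seg m).2
          (star (boundaryRep hd hc (y.seg m).2) ξ) x
        rw [star_boundaryRep_apply, hx] at h1
        exact h1.symm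
      · rintro p hp hne
        rw [mul_apply_eq_comp, boundaryRep_apply_of_forall_ne]
        intro x hx
        have hp' : p ∈ d.pathsUpTo m v' := by rw [← hT]; exact hp
        have := Boundary.prepend_seg_self hd hc p.2 x hp'
        rw [hx] at this
        exact hne this.symm
    · rw [boundaryRep_apply_of_ne hd hc _ _ _ hv]
      refine (Finset.sum_eq_zero fun p _ => ?_).symm
      rw [mul_apply_eq_comp, boundaryRep_apply_of_ne hd hc _ _ _ hv]

include hd hc in
/-- The generating projections of `C*(Λ)` are not zero. -/
theorem s_vertex_ne_zero (hr : d.RowFinite) (v : Λ) : d.s (𝟙 v) ≠ 0 := by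
  intro h
  obtain ⟨x⟩ := nonempty_boundary hd hr hc v
  have h1 : boundaryRep hd hc (𝟙 v) = 0 := by
    rw [← lift_s (isCKFamily_boundaryRep hd hc), h, map_zero]
  classical
  have h2 := boundaryRep_id_apply hd hc v (lp.single 2 ⟨v, x⟩ 1) x
  rw [h1] at h2
  simp at h2

end DegreeMap
open scoped ClosedIdeal.Quotient
namespace DegreeMap

variable {k : ℕ} {Λ : Type u} [Category.{v} Λ] (d : DegreeMap k Λ)

/-! ### Algebra in `C*(Λ)` -/

theorem s_id_mul {w v : Λ} (l : w ⟶ v) : d.s (𝟙 v) * d.s l = d.s l := by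
  rw [← d.isCKFamily_s.comp, Category.comp_id]

theorem s_mul_id {w v : Λ} (l : w ⟶ v) : d.s l * d.s (𝟙 w) = d.s l := by
  rw [← d.isCKFamily_s.comp, Category.id_comp]

theorem star_s_id (v : Λ) : star (d.s (𝟙 v)) = d.s (𝟙 v) := d.isCKFamily_s.vertex_star v

theorem star_s_mul_id {w v : Λ} (l : w ⟶ v) : star (d.s l) * d.s (𝟙 v) = star (d.s l) := by
  rw [← star_s_id, ← star_mul, s_id_mul]

theorem id_mul_star_s {w v : Λ} (l : w ⟶ v) : d.s (𝟙 w) * star (d.s l) = star (d.s l) := by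
  rw [← star_s_id, ← star_mul, s_mul_id]

theorem star_s_mul_s_of_ne {w v w' v' : Λ} (l : w ⟶ v) (m : w' ⟶ v') (h : v ≠ v') :
    star (d.s l) * d.s m = 0 := by
  rw [← star_s_mul_id, ← d.s_id_mul m, mul_assoc, ← mul_assoc (d.s (𝟙 v)),
    d.isCKFamily_s.vertex_orthogonal v v' h, zero_mul, mul_zero]

theorem s_mul_s_of_ne {w v w' v' : Λ} (l : w ⟶ v) (m : w' ⟶ v') (h : w ≠ v') :
    d.s l * d.s m = 0 := by
  rw [← s_mul_id, ← d.s_id_mul m, mul_assoc, ← mul_assoc (d.s (𝟙 w)),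
    d.isCKFamily_s.vertex_orthogonal _ _ h, zero_mul, mul_zero]

theorem s_mul_star_s_of_ne {w v w' v' : Λ} (l : w ⟶ v) (m : w' ⟶ v') (h : w ≠ w') :
    d.s l * star (d.s m) = 0 := by
  rw [← s_mul_id, ← d.id_mul_star_s m, mul_assoc, ← mul_assoc (d.s (𝟙 w)),
    d.isCKFamily_s.vertex_orthogonal _ _ h, zero_mul, mul_zero]

theorem s_mul_star_s_mul_s {w v : Λ} (l : w ⟶ v) : d.s l * star (d.s l) * d.s l = d.s l :=
  d.isCKFamily_s.partial_isometry l

theorem _root_.HigherRank.eq_zero_of_sum_star_mul_self {A : Type u} [NonUnitalCStarAlgebra A]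
    {ι : Type v} {T : Finset ι} {a : ι → A} (h : ∑ i ∈ T, star (a i) * a i = 0) {i : ι}
    (hi : i ∈ T) : a i = 0 := by
  let _ : PartialOrder A := CStarAlgebra.spectralOrder _
  have _ : StarOrderedRing A := CStarAlgebra.spectralOrderedRing _
  exact CStarRing.star_mul_self_eq_zero_iff _ |>.1
    ((Finset.sum_eq_zero_iff_of_nonneg fun j _ => star_mul_self_nonneg (a j)).1 h i hi)

variable {d} in
theorem RowFinite.s_id_eq_sum (hr : d.RowFinite) (v : Λ) (m : Fin k → ℕ) :
    d.s (𝟙 v) = ∑ p ∈ (finite_pathsUpTo hr m v).toFinset, d.s p.2 * star (d.s p.2) :=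
  d.isCKFamily_s.sum v m _ (Set.Finite.coe_toFinset _)

variable {d} in
-- Orthogonality of ranges is not among the relations. Expand `s_q* s_v s_q` by the summation
-- relation: the term of `q` alone is already the total `s_{s(q)}`, so the other terms, which are
-- positive, vanish.
theorem RowFinite.star_s_mul_s_of_ne (hr : d.RowFinite) {m : Fin k → ℕ} {v : Λ}
    {p q : Σ w : Λ, (w ⟶ v)} (hp : p ∈ d.pathsUpTo m v) (hq : q ∈ d.pathsUpTo m v)
    (hpq : p ≠ q) : star (d.s p.2) * d.s q.2 = 0 := by
  classical
  set T := (finite_pathsUpTo hr m v).toFinset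
  have hpT : p ∈ T := (Set.Finite.mem_toFinset _).2 hp
  have hqT : q ∈ T := (Set.Finite.mem_toFinset _).2 hq
  have h1 : star (d.s q.2) * d.s (𝟙 v) * d.s q.2 =
      ∑ r ∈ T, star (star (d.s r.2) * d.s q.2) * (star (d.s r.2) * d.s q.2) := by
    rw [hr.s_id_eq_sum v m, Finset.mul_sum, Finset.sum_mul]
    simp only [star_mul, star_star, mul_assoc, T]
  rw [star_s_mul_id, ← Finset.add_sum_erase _ _ hqT, d.isCKFamily_s.star_mul_self,
    d.star_s_id, d.isCKFamily_s.vertex_mul_self, left_eq_add] at h1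
  exact eq_zero_of_sum_star_mul_self h1 (Finset.mem_erase.2 ⟨hpq, hpT⟩)

/-- The linear span of the elements `s_l s_m*`. -/
def spanning : Submodule ℂ d.CStar :=
  Submodule.span ℂ {x | ∃ (w v v' : Λ) (l : w ⟶ v) (m : w ⟶ v'), x = d.s l * star (d.s m)}

theorem s_mul_star_s_mem {w v w' v' : Λ} (l : w ⟶ v) (m : w' ⟶ v') :
    d.s l * star (d.s m) ∈ d.spanning := by
  by_cases h : w = w'
  · subst h
    exact Submodule.subset_span ⟨_, _, _, l, m, rfl⟩
  · rw [s_mul_star_s_of_ne d l m h]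
    exact zero_mem _

theorem star_mem_spanning {x : d.CStar} (hx : x ∈ d.spanning) : star x ∈ d.spanning := by
  induction hx using Submodule.span_induction with
  | mem x h =>
    obtain ⟨w, v, v', l, m, rfl⟩ := h
    rw [star_mul, star_star]
    exact d.s_mul_star_s_mem m l
  | zero => rw [star_zero]; exact zero_mem _
  | add x y _ _ hx hy => rw [star_add]; exact add_mem hx hy
  | smul c x _ hx => rw [star_smul]; exact Submodule.smul_mem _ _ hx

theorem s_mul_mem_spanning {w v : Λ} (l : w ⟶ v) {x : d.CStar} (hx : x ∈ d.spanning) :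
    d.s l * x ∈ d.spanning := by
  induction hx using Submodule.span_induction with
  | mem x h =>
    obtain ⟨w', v', v'', a, b, rfl⟩ := h
    rw [← mul_assoc]
    by_cases h : w = v'
    · subst h
      rw [← d.isCKFamily_s.comp]
      exact d.s_mul_star_s_mem _ _
    · rw [s_mul_s_of_ne d l a h, zero_mul]
      exact zero_mem _
  | zero => rw [mul_zero]; exact zero_mem _
  | add x y _ _ hx hy => rw [mul_add]; exact add_mem hx hy
  | smul c x _ hx => rw [mul_smul_comm]; exact Submodule.smul_mem _ _ hx

theorem mul_star_s_mem_spanning {w v : Λ} (l : w ⟶ v) {x : d.CStar} (hx : x ∈ d.spanning) :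
    x * star (d.s l) ∈ d.spanning := by
  have := d.star_mem_spanning (d.s_mul_mem_spanning l (d.star_mem_spanning hx))
  rwa [star_mul, star_star] at this

variable {d} in
-- Extend `l` and `m` to the common degree `q = d(l) ⊔ d(m)`. The product becomes a sum of terms
-- `s_a (s_{la}* s_{mb}) s_b*` with `la` and `mb` in `Λ^{≤ q}(v)`, and the middle factor is a vertex
-- projection or zero.
theorem RowFinite.star_s_mul_s_mem (hr : d.RowFinite) {w w' v v' : Λ} (l : w ⟶ v)
    (m : w' ⟶ v') : star (d.s l) * d.s m ∈ d.spanning := by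
  by_cases hv : v = v'
  swap
  · rw [d.star_s_mul_s_of_ne l m hv]
    exact zero_mem _
  subst hv
  set q := d.deg l ⊔ d.deg m
  rw [← d.id_mul_star_s l, ← d.s_mul_id m, hr.s_id_eq_sum w (q - d.deg l),
    hr.s_id_eq_sum w' (q - d.deg m), Finset.sum_mul, Finset.mul_sum, Finset.sum_mul]
  refine sum_mem fun a ha => ?_
  rw [Finset.mul_sum]
  refine sum_mem fun b hb => ?_
  rw [Set.Finite.mem_toFinset] at ha hb
  have ha' : prepend l a ∈ d.pathsUpTo q v := by
    have := (prepend_mem_pathsUpTo_iff l).2 ha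
    rwa [add_tsub_cancel_of_le le_sup_left] at this
  have hb' : prepend m b ∈ d.pathsUpTo q v := by
    have := (prepend_mem_pathsUpTo_iff m).2 hb
    rwa [add_tsub_cancel_of_le le_sup_right] at this
  have h1 : d.s a.2 * star (d.s a.2) * star (d.s l) * (d.s m * (d.s b.2 * star (d.s b.2))) =
      d.s a.2 * (star (d.s (prepend l a).2) * d.s (prepend m b).2) * star (d.s b.2) := by
    simp only [prepend, d.isCKFamily_s.comp, star_mul, mul_assoc]
  rw [h1]
  refine d.mul_star_s_mem_spanning _ (d.s_mul_mem_spanning _ ?_)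
  by_cases h : prepend l a = prepend m b
  · rw [h, d.isCKFamily_s.star_mul_self]
    have := d.s_mul_star_s_mem (𝟙 (prepend m b).1) (𝟙 (prepend m b).1)
    rwa [star_s_id, d.isCKFamily_s.vertex_mul_self] at this
  · rw [hr.star_s_mul_s_of_ne ha' hb' h]
    exact zero_mem _

variable {d} in
theorem RowFinite.mul_mem_spanning (hr : d.RowFinite) {x y : d.CStar} (hx : x ∈ d.spanning)
    (hy : y ∈ d.spanning) : x * y ∈ d.spanning := by
  induction hx using Submodule.span_induction with
  | mem x h =>
    obtain ⟨w, v, v', a, b, rfl⟩ := h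
    rw [mul_assoc]
    refine d.s_mul_mem_spanning a ?_
    induction hy using Submodule.span_induction with
    | mem y h =>
      obtain ⟨w, v, v', a', b', rfl⟩ := h
      rw [← mul_assoc]
      exact d.mul_star_s_mem_spanning _ (hr.star_s_mul_s_mem _ _)
    | zero => rw [mul_zero]; exact zero_mem _
    | add x y _ _ hx hy => rw [mul_add]; exact add_mem hx hy
    | smul c x _ hx => rw [mul_smul_comm]; exact Submodule.smul_mem _ _ hx
  | zero => rw [zero_mul]; exact zero_mem _
  | add x y _ _ hx hy => rw [add_mul]; exact add_mem hx hy
  | smul c x _ hx => rw [smul_mul_assoc]; exact Submodule.smul_mem _ _ hx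

variable {d} in
/-- The elements `s_l` generate `C*(Λ)`. -/
theorem mem_of_forall_s_mem (K : NonUnitalStarSubalgebra ℂ d.CStar)
    (hK : IsClosed (K : Set d.CStar)) (hs : ∀ ⦃w v : Λ⦄ (l : w ⟶ v), d.s l ∈ K) (x : d.CStar) :
    x ∈ K := by
  have h1 : ∀ y ∈ NonUnitalStarAlgebra.adjoin ℂ
      {x : d.Envelope | ∃ (w v : Λ) (l : w ⟶ v), x = (d.freeGen l : d.Envelope)},
      y ∈ (d.toEnvelope '' (K : Set d.CStar)) := by
    intro y hy
    induction hy using NonUnitalStarAlgebra.adjoin_induction with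
    | mem y h =>
      obtain ⟨w, v, l, rfl⟩ := h
      exact ⟨d.s l, hs l, rfl⟩
    | add a b _ _ ha hb =>
      obtain ⟨a, ha, rfl⟩ := ha
      obtain ⟨b, hb, rfl⟩ := hb
      exact ⟨a + b, add_mem ha hb, map_add _ _ _⟩
    | zero => exact ⟨0, zero_mem K, map_zero _⟩
    | mul a b _ _ ha hb =>
      obtain ⟨a, ha, rfl⟩ := ha
      obtain ⟨b, hb, rfl⟩ := hb
      exact ⟨a * b, mul_mem ha hb, map_mul _ _ _⟩
    | smul c a _ ha =>
      obtain ⟨a, ha, rfl⟩ := ha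
      exact ⟨c • a, SMulMemClass.smul_mem c ha, map_smul _ _ _⟩
    | star a _ ha =>
      obtain ⟨a, ha, rfl⟩ := ha
      exact ⟨star a, star_mem ha, map_star _ _⟩
  have hind : Topology.IsInducing d.toEnvelope := ⟨rfl⟩
  rw [← SetLike.mem_coe, ← hK.closure_eq, hind.closure_eq_preimage_closure_image]
  exact closure_mono h1 x.2

variable {d} in
theorem hom_ext {B : Type w} [NonUnitalCStarAlgebra B] {φ ψ : d.CStar →⋆ₙₐ[ℂ] B}
    (h : ∀ ⦃w v : Λ⦄ (l : w ⟶ v), φ (d.s l) = ψ (d.s l)) : φ = ψ := by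
  ext x
  exact mem_of_forall_s_mem (NonUnitalStarAlgHom.equalizer φ ψ)
    (isClosed_eq (continuous_starHom φ) (continuous_starHom ψ)) h x

variable {d} in
-- The span is a *-subalgebra, and it contains each `s_l = s_l s_{s(l)}*`.
theorem RowFinite.dense_spanning (hr : d.RowFinite) (x : d.CStar) :
    x ∈ closure (d.spanning : Set d.CStar) := by
  let K : NonUnitalStarSubalgebra ℂ d.CStar :=
    { d.spanning with
      mul_mem' := fun ha hb => hr.mul_mem_spanning ha hb
      star_mem' := fun ha => d.star_mem_spanning ha }
  refine mem_of_forall_s_mem K.topologicalClosure (K.isClosed_topologicalClosure) ?_ x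
  intro w v l
  refine K.le_topologicalClosure ?_
  have := d.s_mul_star_s_mem l (𝟙 w)
  rwa [star_s_id, s_mul_id] at this

/-! ### The core -/

/-- The linear span of the elements `s_l s_m*` with `d(l) = d(m)`. -/
def core : Submodule ℂ d.CStar :=
  Submodule.span ℂ {x | ∃ (w v v' : Λ) (l : w ⟶ v) (m : w ⟶ v'), d.deg l = d.deg m ∧
    x = d.s l * star (d.s m)}

variable {d} in
/-- The paths in the sets `Λ^{≤ q}(v)` for `v ∈ V`. -/
def RowFinite.finPaths (hr : d.RowFinite) (q : Fin k → ℕ) (V : Finset Λ) :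
    Finset (Σ v : Λ, Σ w : Λ, (w ⟶ v)) :=
  V.sigma fun v => (finite_pathsUpTo hr q v).toFinset

variable {d} (hr : d.RowFinite)

theorem RowFinite.mem_finPaths {q : Fin k → ℕ} {V : Finset Λ} {p : Σ v : Λ, Σ w : Λ, (w ⟶ v)} :
    p ∈ hr.finPaths q V ↔ p.1 ∈ V ∧ p.2 ∈ d.pathsUpTo q p.1 := by
  simp [finPaths]

theorem RowFinite.star_s_mul_s_finPaths {q : Fin k → ℕ} {V : Finset Λ}
    {p p' : Σ v : Λ, Σ w : Λ, (w ⟶ v)} (hp : p ∈ hr.finPaths q V) (hp' : p' ∈ hr.finPaths q V)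
    (h : p ≠ p') : star (d.s p.2.2) * d.s p'.2.2 = 0 := by
  rw [hr.mem_finPaths] at hp hp'
  obtain ⟨v, p⟩ := p
  obtain ⟨v', p'⟩ := p'
  by_cases hv : v = v'
  · subst hv
    exact hr.star_s_mul_s_of_ne hp.2 hp'.2 (fun h' => h (congrArg _ h'))
  · exact d.star_s_mul_s_of_ne _ _ hv

/-- These are the relations of matrix units. The first alternative also covers `p' = r` with `s(p) ≠
s(p')`, when `s_p s_{p'}*` is itself zero. -/
theorem RowFinite.matrixUnit_mul {q : Fin k → ℕ} {V : Finset Λ}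
    {p p' r r' : Σ v : Λ, Σ w : Λ, (w ⟶ v)} (hp' : p' ∈ hr.finPaths q V)
    (hr' : r ∈ hr.finPaths q V) :
    d.s p.2.2 * star (d.s p'.2.2) * (d.s r.2.2 * star (d.s r'.2.2)) = 0 ∨
    (p' = r ∧ d.s p.2.2 * star (d.s p'.2.2) * (d.s r.2.2 * star (d.s r'.2.2)) =
      d.s p.2.2 * star (d.s r'.2.2)) := by
  by_cases h : p' = r
  · subst h
    by_cases hw : p.2.1 = p'.2.1
    · refine Or.inr ⟨rfl, ?_⟩
      rw [mul_assoc, ← mul_assoc (star _), d.isCKFamily_s.star_mul_self, ← hw, ← mul_assoc,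
        s_mul_id]
    · left
      rw [d.s_mul_star_s_of_ne _ _ hw, zero_mul]
  · left
    rw [mul_assoc, ← mul_assoc (star _), hr.star_s_mul_s_finPaths hp' hr' h, zero_mul, mul_zero]

/-- The elements `s_l s_m*` with `l` and `m` in `finPaths q V`. -/
def RowFinite.matrixUnits (q : Fin k → ℕ) (V : Finset Λ) : Set d.CStar :=
  {x | ∃ p ∈ hr.finPaths q V, ∃ r ∈ hr.finPaths q V, x = d.s p.2.2 * star (d.s r.2.2)}

theorem RowFinite.finite_matrixUnits (q : Fin k → ℕ) (V : Finset Λ) :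
    (hr.matrixUnits q V).Finite := by
  refine Set.Finite.subset (Set.Finite.image2 (fun p r : Σ v : Λ, Σ w : Λ, (w ⟶ v) =>
    d.s p.2.2 * star (d.s r.2.2)) (hr.finPaths q V).finite_toSet
    (hr.finPaths q V).finite_toSet) ?_
  rintro _ ⟨p, hp, r, hr', rfl⟩
  exact ⟨p, hp, r, hr', rfl⟩

/-- The finite-dimensional algebra spanned by the elements `s_l s_m*` with `l` and `m` in
`finPaths q V`. -/
def RowFinite.finCore (q : Fin k → ℕ) (V : Finset Λ) : NonUnitalStarSubalgebra ℂ d.CStar where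
  __ := Submodule.span ℂ (hr.matrixUnits q V)
  mul_mem' := by
    intro x y hx hy
    refine Submodule.span_induction₂ (p := fun x y _ _ => x * y ∈ Submodule.span ℂ _) ?_ ?_ ?_
      ?_ ?_ ?_ ?_ hx hy
    · rintro _ _ ⟨p, hp, p', hp', rfl⟩ ⟨r, hr₁, r', hr₂, rfl⟩
      rcases hr.matrixUnit_mul (p := p) (r' := r') hp' hr₁ with h | ⟨-, h⟩
      · rw [h]
        exact zero_mem _
      · rw [h]
        exact Submodule.subset_span ⟨p, hp, r', hr₂, rfl⟩
    · intro y _; rw [zero_mul]; exact zero_mem _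
    · intro y _; rw [mul_zero]; exact zero_mem _
    · intro x y z _ _ _ h h'; rw [add_mul]; exact add_mem h h'
    · intro x y z _ _ _ h h'; rw [mul_add]; exact add_mem h h'
    · intro c x y _ _ h; rw [smul_mul_assoc]; exact Submodule.smul_mem _ _ h
    · intro c x y _ _ h; rw [mul_smul_comm]; exact Submodule.smul_mem _ _ h
  star_mem' := by
    intro x hx
    induction hx using Submodule.span_induction with
    | mem x h =>
      obtain ⟨p, hp, p', hp', rfl⟩ := h
      rw [star_mul, star_star]
      exact Submodule.subset_span ⟨p', hp', p, hp, rfl⟩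
    | zero => rw [star_zero]; exact zero_mem (Submodule.span ℂ _)
    | add x y _ _ hx hy => rw [star_add]; exact add_mem (S := Submodule ℂ d.CStar) hx hy
    | smul c x _ hx => rw [star_smul]; exact Submodule.smul_mem _ _ hx

theorem RowFinite.mem_finCore {q : Fin k → ℕ} {V : Finset Λ} {x : d.CStar} :
    x ∈ hr.finCore q V ↔ x ∈ Submodule.span ℂ (hr.matrixUnits q V) := Iff.rfl

/-- Closedness makes `finCore` a C*-algebra, so that its injective *-homomorphisms are isometric. -/
instance RowFinite.isClosed_finCore (q : Fin k → ℕ) (V : Finset Λ) :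
    IsClosed (hr.finCore q V : Set d.CStar) := by
  have : FiniteDimensional ℂ (Submodule.span ℂ (hr.matrixUnits q V)) :=
    FiniteDimensional.span_of_finite ℂ (hr.finite_matrixUnits q V)
  exact Submodule.closed_of_finiteDimensional _

/-- If `d(l) = d(m)`, then `s_l s_m*` is the sum of `s_{la} s_{ma}*` over `a` in `Λ^{≤ q -
d(l)}(s(l))`, and both `la` and `ma` are in `Λ^{≤ q}`. Membership is asserted for all larger data so
that two elements can be moved to a common algebra. -/
theorem RowFinite.exists_mem_finCore {x : d.CStar} (hx : x ∈ d.core) :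
    ∃ (q : Fin k → ℕ) (V : Finset Λ), ∀ q' ≥ q, ∀ V' ⊇ V, x ∈ hr.finCore q' V' := by
  classical
  induction hx using Submodule.span_induction with
  | mem x h =>
    obtain ⟨w, v, v', l, m, hlm, rfl⟩ := h
    refine ⟨d.deg l, {v, v'}, fun q hq V hV => ?_⟩
    rw [← d.s_mul_id l, hr.s_id_eq_sum w (q - d.deg l), Finset.mul_sum, Finset.sum_mul]
    refine sum_mem fun a ha => Submodule.subset_span ⟨⟨v, prepend l a⟩, ?_, ⟨v', prepend m a⟩,
        ?_, ?_⟩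
    · rw [Set.Finite.mem_toFinset] at ha
      refine hr.mem_finPaths.2 ⟨hV (by simp), ?_⟩
      have := (prepend_mem_pathsUpTo_iff l).2 ha
      rwa [add_tsub_cancel_of_le hq] at this
    · rw [Set.Finite.mem_toFinset] at ha
      refine hr.mem_finPaths.2 ⟨hV (by simp), ?_⟩
      have := (prepend_mem_pathsUpTo_iff m).2 ha
      rwa [← hlm, add_tsub_cancel_of_le hq] at this
    · simp only [prepend, d.isCKFamily_s.comp, star_mul, mul_assoc]
  | zero => exact ⟨0, ∅, fun _ _ _ _ => zero_mem _⟩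
  | add x y _ _ hx hy =>
    obtain ⟨q, V, h⟩ := hx
    obtain ⟨q', V', h'⟩ := hy
    exact ⟨q ⊔ q', V ∪ V', fun r hr' W hW => add_mem
      (h r (le_sup_left.trans hr') W (Finset.union_subset_left hW))
      (h' r (le_sup_right.trans hr') W (Finset.union_subset_right hW))⟩
  | smul c x _ hx =>
    obtain ⟨q, V, h⟩ := hx
    exact ⟨q, V, fun r hr' W hW => SMulMemClass.smul_mem c (h r hr' W hW)⟩

/-- The scalar is the matrix coefficient of `x` at `(p, r)`; it comes with a vertex projection,
which is what a given ideal may or may not contain. -/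
theorem RowFinite.exists_smul_eq {q : Fin k → ℕ} {V : Finset Λ} {x : d.CStar}
    (hx : x ∈ hr.finCore q V) {p r : Σ v : Λ, Σ w : Λ, (w ⟶ v)} (hp : p ∈ hr.finPaths q V)
    (hr' : r ∈ hr.finPaths q V) :
    ∃ c : ℂ, star (d.s p.2.2) * x * d.s r.2.2 = c • d.s (𝟙 p.2.1) := by
  rw [hr.mem_finCore] at hx
  induction hx using Submodule.span_induction with
  | mem x h =>
    obtain ⟨a, ha, b, hb, rfl⟩ := h
    have e : star (d.s p.2.2) * (d.s a.2.2 * star (d.s b.2.2)) * d.s r.2.2 =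
        (star (d.s p.2.2) * d.s a.2.2) * (star (d.s b.2.2) * d.s r.2.2) := by
      simp only [mul_assoc]
    rw [e]
    by_cases h1 : p = a
    · by_cases h2 : b = r
      · rw [h1, h2, d.isCKFamily_s.star_mul_self, d.isCKFamily_s.star_mul_self]
        by_cases h3 : a.2.1 = r.2.1
        · exact ⟨1, by rw [← h3, d.isCKFamily_s.vertex_mul_self, one_smul]⟩
        · exact ⟨0, by rw [d.isCKFamily_s.vertex_orthogonal _ _ h3, zero_smul]⟩
      · exact ⟨0, by rw [hr.star_s_mul_s_finPaths hb hr' h2, mul_zero, zero_smul]⟩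
    · exact ⟨0, by rw [hr.star_s_mul_s_finPaths hp ha h1, zero_mul, zero_smul]⟩
  | zero => exact ⟨0, by simp⟩
  | add x y _ _ hx hy =>
    obtain ⟨c, hc⟩ := hx
    obtain ⟨c', hc'⟩ := hy
    exact ⟨c + c', by rw [mul_add, add_mul, hc, hc', add_smul]⟩
  | smul c x _ hx =>
    obtain ⟨c', hc'⟩ := hx
    exact ⟨c * c', by rw [mul_smul_comm, smul_mul_assoc, hc', mul_smul]⟩

/-- The diagonal matrix units add up to the unit of the finite-dimensional algebra. -/
theorem RowFinite.sum_mul_eq {q : Fin k → ℕ} {V : Finset Λ} {x : d.CStar}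
    (hx : x ∈ hr.finCore q V) :
    (∑ p ∈ hr.finPaths q V, d.s p.2.2 * star (d.s p.2.2)) * x = x := by
  classical
  rw [hr.mem_finCore] at hx
  induction hx using Submodule.span_induction with
  | mem x h =>
    obtain ⟨a, ha, b, hb, rfl⟩ := h
    rw [Finset.sum_mul, Finset.sum_eq_single_of_mem a ha]
    · rw [← mul_assoc, s_mul_star_s_mul_s]
    · intro p hp hpa
      rw [mul_assoc, ← mul_assoc (star _), hr.star_s_mul_s_finPaths hp ha hpa, zero_mul,
        mul_zero]
  | zero => rw [mul_zero]
  | add x y _ _ hx hy => rw [mul_add, hx, hy]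
  | smul c x _ hx => rw [mul_smul_comm, hx]

theorem RowFinite.mul_sum_eq {q : Fin k → ℕ} {V : Finset Λ} {x : d.CStar}
    (hx : x ∈ hr.finCore q V) :
    x * (∑ p ∈ hr.finPaths q V, d.s p.2.2 * star (d.s p.2.2)) = x := by
  have := congrArg star (hr.sum_mul_eq (star_mem hx))
  simpa only [star_mul, star_sum, star_star] using this

/-- Expand `x` on both sides by the unit of the algebra. Each coefficient times a vertex projection
is in `J`, so each coefficient is zero. -/
theorem RowFinite.eq_zero_of_mem_finCore {J : ClosedIdeal d.CStar} (hJ : ∀ v, d.s (𝟙 v) ∉ J)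
    {q : Fin k → ℕ} {V : Finset Λ} {x : d.CStar} (hx : x ∈ hr.finCore q V) (hxJ : x ∈ J) :
    x = 0 := by
  rw [← hr.sum_mul_eq hx, ← hr.mul_sum_eq hx, Finset.mul_sum, Finset.sum_mul]
  refine Finset.sum_eq_zero fun p hp => ?_
  rw [Finset.mul_sum]
  refine Finset.sum_eq_zero fun r hr' => ?_
  obtain ⟨c, hc⟩ := hr.exists_smul_eq hx hp hr'
  have hmem : c • d.s (𝟙 p.2.1) ∈ J := by
    rw [← hc]
    exact J.mul_mem_right _ (J.mul_mem_left _ hxJ)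
  have hc0 : c = 0 := by
    by_contra h
    refine hJ p.2.1 ?_
    have := SMulMemClass.smul_mem c⁻¹ hmem
    rwa [smul_smul, inv_mul_cancel₀ h, one_smul] at this
  have e : d.s p.2.2 * star (d.s p.2.2) * (x * (d.s r.2.2 * star (d.s r.2.2))) =
      d.s p.2.2 * (star (d.s p.2.2) * x * d.s r.2.2) * star (d.s r.2.2) := by
    simp only [mul_assoc]
  rw [e, hc, hc0, zero_smul, mul_zero, zero_mul]

/-- The quotient map is injective on each finite-dimensional algebra, hence isometric there. An
equality of norms, unlike injectivity, passes to the closure of the core. -/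
theorem RowFinite.norm_mk_of_mem_core (hr : d.RowFinite) {J : ClosedIdeal d.CStar}
    (hJ : ∀ v, d.s (𝟙 v) ∉ J)
    {x : d.CStar} (hx : x ∈ d.core) : ‖ClosedIdeal.Quotient.mk J x‖ = ‖x‖ := by
  obtain ⟨q, V, h⟩ := hr.exists_mem_finCore hx
  let φ : hr.finCore q V →⋆ₙₐ[ℂ] J.Quotient :=
    (ClosedIdeal.Quotient.mkHom J).comp (NonUnitalStarSubalgebraClass.subtype (hr.finCore q V))
  have hφ : Function.Injective φ := by
    rw [injective_iff_map_eq_zero]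
    intro y hy
    exact Subtype.ext (hr.eq_zero_of_mem_finCore hJ y.2 ((ClosedIdeal.Quotient.mk_eq_zero J).1 hy))
  exact NonUnitalStarAlgHom.norm_map φ hφ ⟨x, h q le_rfl V subset_rfl⟩

theorem RowFinite.eq_zero_of_mem_closure_core (hr : d.RowFinite) {J : ClosedIdeal d.CStar}
    (hJ : ∀ v, d.s (𝟙 v) ∉ J) {x : d.CStar} (hx : x ∈ closure (d.core : Set d.CStar))
    (hxJ : x ∈ J) : x = 0 := by
  have h := closure_minimal (fun y hy => hr.norm_mk_of_mem_core hJ hy)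
    (isClosed_eq (continuous_starHom (ClosedIdeal.Quotient.mkHom J)).norm continuous_norm) hx
  have h' : ‖ClosedIdeal.Quotient.mk J x‖ = ‖x‖ := h
  rw [(ClosedIdeal.Quotient.mk_eq_zero J).2 hxJ, norm_zero] at h'
  exact norm_eq_zero.1 h'.symm

end DegreeMap
namespace DegreeMap

open MeasureTheory UnitAddTorus

variable {k : ℕ} {Λ : Type u} [Category.{v} Λ] (d : DegreeMap k Λ)

/-! ### The gauge action and Fourier coefficients -/

theorem gauge_s (z : Fin k → Circle) {w v : Λ} (l : w ⟶ v) :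
    d.gauge z (d.s l) = torusPow z (d.deg l) • d.s l := lift_s _ l

theorem gauge_comp (z y : Fin k → Circle) : (d.gauge z).comp (d.gauge y) = d.gauge (z * y) := by
  refine hom_ext fun w v l => ?_
  change d.gauge z (d.gauge y (d.s l)) = _
  rw [gauge_s, map_smul, gauge_s, gauge_s, smul_smul]
  congr 1
  simp [torusPow, mul_pow, Finset.prod_mul_distrib, mul_comm]

theorem gauge_gauge (z y : Fin k → Circle) (a : d.CStar) :
    d.gauge z (d.gauge y a) = d.gauge (z * y) a := DFunLike.congr_fun (d.gauge_comp z y) a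

theorem gauge_one (a : d.CStar) : d.gauge 1 a = a := by
  have : d.gauge 1 = NonUnitalStarAlgHom.id ℂ d.CStar := hom_ext fun w v l => by
    rw [gauge_s]
    simp [torusPow]
  rw [this]
  rfl

/-- The point of the torus with additive coordinates `t`. -/
def torusPoint (t : UnitAddTorus (Fin k)) : Fin k → Circle := fun i => (t i).toCircle

theorem torusPoint_add (t t' : UnitAddTorus (Fin k)) :
    torusPoint (t + t') = torusPoint t * torusPoint t' := by
  ext i
  simp [torusPoint, AddCircle.toCircle_add]

theorem torusPoint_zero : torusPoint (0 : UnitAddTorus (Fin k)) = 1 := by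
  ext i
  simp [torusPoint, AddCircle.toCircle_zero]

theorem torusPow_torusPoint (t : UnitAddTorus (Fin k)) (n : Fin k → ℕ) :
    torusPow (torusPoint t) n = mFourier (fun i => (n i : ℤ)) t := by
  simp only [torusPow, torusPoint, mFourier, ContinuousMap.coe_mk, fourier_apply]
  refine Finset.prod_congr rfl fun i _ => ?_
  rw [natCast_zsmul, AddCircle.toCircle_nsmul, Circle.coe_pow]

theorem gauge_s_mul_star_s (t : UnitAddTorus (Fin k)) {w v v' : Λ} (l : w ⟶ v) (m : w ⟶ v') :
    d.gauge (torusPoint t) (d.s l * star (d.s m)) =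
      mFourier (fun i => (d.deg l i : ℤ) - d.deg m i) t • (d.s l * star (d.s m)) := by
  rw [map_mul, map_star, gauge_s, gauge_s, star_smul, smul_mul_smul_comm, torusPow_torusPoint,
    torusPow_torusPoint, Complex.star_def, ← mFourier_neg, ← mFourier_add]
  congr 3

/-- The elements with continuous orbit form a *-subalgebra that contains the generators. It is
closed because the gauge maps are contractions, so orbits of nearby elements are uniformly close. -/
theorem continuous_gauge (a : d.CStar) : Continuous fun t => d.gauge (torusPoint t) a := by
  let K : NonUnitalStarSubalgebra ℂ d.CStar :=
    { carrier := {a | Continuous fun t => d.gauge (torusPoint t) a}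
      add_mem' := fun {a b} ha hb => by
        simp only [Set.mem_ofPred_eq, map_add]; exact ha.add hb
      zero_mem' := by simp only [Set.mem_ofPred_eq, map_zero]; exact continuous_const
      mul_mem' := fun {a b} ha hb => by
        simp only [Set.mem_ofPred_eq, map_mul]; exact ha.mul hb
      smul_mem' := fun c {a} ha => by
        simp only [Set.mem_ofPred_eq, map_smul]; exact ha.const_smul c
      star_mem' := fun {a} ha => by
        simp only [Set.mem_ofPred_eq, map_star]; exact ha.star }
  refine mem_of_forall_s_mem K ?_ (fun w v l => ?_) a
  · refine isClosed_of_closure_subset fun a ha => ?_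
    refine continuous_of_uniform_approx_of_continuous fun u hu => ?_
    obtain ⟨ε, hε, h⟩ := Metric.mem_uniformity_dist.1 hu
    obtain ⟨b, hb, hab⟩ := Metric.mem_closure_iff.1 ha ε hε
    refine ⟨_, hb, fun t => h ?_⟩
    rw [dist_eq_norm, ← map_sub]
    rw [dist_eq_norm] at hab
    exact (NonUnitalStarAlgHom.norm_apply_le _ _).trans_lt hab
  · change Continuous fun t => d.gauge (torusPoint t) (d.s l)
    simp only [gauge_s, torusPow_torusPoint]
    exact (mFourier _).continuous.smul continuous_const

/-- The Haar measure of the torus. -/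
def torusHaar (k : ℕ) : Measure (UnitAddTorus (Fin k)) :=
  Measure.pi fun _ => AddCircle.haarAddCircle

instance : IsProbabilityMeasure (torusHaar k) :=
  inferInstanceAs (IsProbabilityMeasure (Measure.pi _))

instance : (torusHaar k).IsAddLeftInvariant :=
  inferInstanceAs (Measure.IsAddLeftInvariant (Measure.pi _))

/-- The spectral component of degree `n` of `a`. -/
def component (n : Fin k → ℤ) (a : d.CStar) : d.CStar :=
  ∫ t, mFourier (-n) t • d.gauge (torusPoint t) a ∂torusHaar k

theorem continuous_integrand (n : Fin k → ℤ) (a : d.CStar) :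
    Continuous fun t => mFourier (-n) t • d.gauge (torusPoint t) a :=
  (mFourier _).continuous.smul (d.continuous_gauge a)

theorem integrable_torus {E : Type u} [NormedAddCommGroup E] {f : UnitAddTorus (Fin k) → E}
    (hf : Continuous f) : Integrable f (torusHaar k) :=
  hf.integrable_of_hasCompactSupport (HasCompactSupport.of_compactSpace f)

/-- The integral is an average over a probability measure of elements of `J`, which is closed and
convex. -/
theorem component_mem {J : ClosedIdeal d.CStar} (hJ : ∀ z, ∀ a ∈ J, d.gauge z a ∈ J)
    (n : Fin k → ℤ) {a : d.CStar} (ha : a ∈ J) : d.component n a ∈ J := by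
  refine (J.toSubmodule.restrictScalars ℝ).convex.integral_mem J.isClosed
    (Filter.Eventually.of_forall fun t => ?_) (integrable_torus (d.continuous_integrand n a))
  exact SMulMemClass.smul_mem (s := J) _ (hJ _ a ha)

/-- A *-endomorphism as a bounded operator. -/
def gaugeCLM (z : Fin k → Circle) : d.CStar →L[ℂ] d.CStar :=
  ⟨(d.gauge z : d.CStar →ₗ[ℂ] d.CStar), continuous_starHom (d.gauge z)⟩

theorem mFourier_apply_add (n : Fin k → ℤ) (t t' : UnitAddTorus (Fin k)) :
    mFourier n (t + t') = mFourier n t * mFourier n t' := by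
  simp only [mFourier, ContinuousMap.coe_mk, Pi.add_apply, fourier_apply, smul_add,
    AddCircle.toCircle_add, Circle.coe_mul, Finset.prod_mul_distrib]

theorem gauge_integrand (n : Fin k → ℤ) (a : d.CStar) (t t' : UnitAddTorus (Fin k)) :
    d.gauge (torusPoint t) (mFourier (-n) t' • d.gauge (torusPoint t') a) =
      mFourier n t • (mFourier (-n) (t + t') • d.gauge (torusPoint (t + t')) a) := by
  rw [map_smul, gauge_gauge, ← torusPoint_add, smul_smul, mFourier_apply_add, ← mul_assoc,
    ← mFourier_add, add_neg_cancel, mFourier_zero, ContinuousMap.one_apply, one_mul]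

/-- The gauge map moves inside the integral, and translation invariance of Haar measure absorbs the
shift up to a character. -/
theorem gauge_component (n : Fin k → ℤ) (a : d.CStar) (t : UnitAddTorus (Fin k)) :
    d.gauge (torusPoint t) (d.component n a) = mFourier n t • d.component n a := by
  have h1 : d.gauge (torusPoint t) (d.component n a) =
      ∫ t', d.gauge (torusPoint t) (mFourier (-n) t' • d.gauge (torusPoint t') a) ∂torusHaar k :=
    ((d.gaugeCLM (torusPoint t)).integral_comp_comm
      (integrable_torus (d.continuous_integrand n a))).symm
  rw [h1]
  simp only [gauge_integrand]
  rw [integral_smul, integral_add_left_eq_self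
    (fun t' => mFourier (-n) t' • d.gauge (torusPoint t') a) t, component]

theorem component_zero_of_fixed {a : d.CStar}
    (h : ∀ t, d.gauge (torusPoint t) a = a) : d.component 0 a = a := by
  simp [component, h, mFourier_zero]

theorem component_add (n : Fin k → ℤ) (a b : d.CStar) :
    d.component n (a + b) = d.component n a + d.component n b := by
  rw [component, component, component, ← integral_add
    (integrable_torus (d.continuous_integrand n a))
    (integrable_torus (d.continuous_integrand n b))]
  simp only [map_add, smul_add]

theorem component_smul (n : Fin k → ℤ) (c : ℂ) (a : d.CStar) :
    d.component n (c • a) = c • d.component n a := by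
  rw [component, component, ← integral_smul]
  simp only [map_smul, smul_comm c]

theorem continuous_component (n : Fin k → ℤ) : Continuous (d.component n) := by
  have h : ∀ a b, d.component n a - d.component n b = d.component n (a - b) := fun a b => by
    rw [sub_eq_iff_eq_add, ← component_add, sub_add_cancel]
  refine LipschitzWith.continuous (K := 1) (LipschitzWith.of_dist_le_mul fun a b => ?_)
  rw [dist_eq_norm, dist_eq_norm, h]
  refine (norm_integral_le_of_norm_le_const (C := ‖a - b‖) (Filter.Eventually.of_forall
    fun t => ?_)).trans (by simp)
  rw [norm_smul]
  refine (mul_le_mul ((ContinuousMap.norm_coe_le_norm _ t).trans mFourier_norm.le)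
    (NonUnitalStarAlgHom.norm_apply_le _ _) (norm_nonneg _) zero_le_one).trans (one_mul _).le

/-- Distinct characters are orthonormal, hence distinct as functions. -/
theorem exists_mFourier_ne_one {n : Fin k → ℤ} (hn : n ≠ 0) :
    ∃ t : UnitAddTorus (Fin k), mFourier n t ≠ 1 := by
  by_contra! h
  refine hn (orthonormal_mFourier.linearIndependent.injective ?_)
  have : mFourier n = mFourier 0 := by
    ext t
    rw [h, mFourier_zero, ContinuousMap.one_apply]
  simp only [mFourierLp, this]

theorem component_zero_s_mul_star_s_mem {w v v' : Λ} (l : w ⟶ v) (m : w ⟶ v') :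
    d.component 0 (d.s l * star (d.s m)) ∈ d.core := by
  by_cases h : d.deg l = d.deg m
  · rw [component_zero_of_fixed]
    · exact Submodule.subset_span ⟨_, _, _, l, m, h, rfl⟩
    · intro t
      have : (fun i => (d.deg l i : ℤ) - d.deg m i) = 0 := by ext i; simp [h]
      rw [gauge_s_mul_star_s, this, mFourier_zero, ContinuousMap.one_apply, one_smul]
  · set n : Fin k → ℤ := fun i => (d.deg l i : ℤ) - d.deg m i with hn
    have hn0 : n ≠ 0 := fun h0 => h (funext fun i => by
      have := congrFun h0 i
      simp only [hn, Pi.zero_apply] at this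
      omega)
    obtain ⟨t, ht⟩ := exists_mFourier_ne_one hn0
    obtain ⟨c, hc⟩ : ∃ c : ℂ, d.component 0 (d.s l * star (d.s m)) =
        c • (d.s l * star (d.s m)) := by
      refine ⟨∫ t, mFourier (-0) t * mFourier n t ∂torusHaar k, ?_⟩
      rw [← integral_smul_const]
      simp only [component, gauge_s_mul_star_s, smul_smul, hn]
    -- The component is fixed by the gauge action, but as a multiple of `s_l s_m*` it is also
    -- multiplied by the character of `n`, which is not `1` at `t`. So it is zero.
    have h1 := d.gauge_component 0 (d.s l * star (d.s m)) t
    rw [hc, map_smul, gauge_s_mul_star_s, mFourier_zero, ContinuousMap.one_apply, one_smul,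
      smul_comm, ← hc] at h1
    have h2 : (mFourier n t - 1) • d.component 0 (d.s l * star (d.s m)) = 0 := by
      rw [sub_smul, one_smul, h1, sub_self]
    rw [(smul_eq_zero.1 h2).resolve_left (sub_ne_zero.2 ht)]
    exact zero_mem _

variable {d} in
theorem RowFinite.component_zero_mem (hr : d.RowFinite) (a : d.CStar) :
    d.component 0 a ∈ closure (d.core : Set d.CStar) := by
  refine map_mem_closure (d.continuous_component 0) (hr.dense_spanning a) fun x hx => ?_
  induction hx using Submodule.span_induction with
  | mem x h =>
    obtain ⟨w, v, v', l, m, rfl⟩ := h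
    exact d.component_zero_s_mul_star_s_mem l m
  | zero =>
    rw [d.component_zero_of_fixed fun t => map_zero _]
    exact zero_mem d.core
  | add x y _ _ hx hy =>
    rw [component_add]
    exact add_mem hx hy
  | smul c x _ hx =>
    rw [component_smul]
    exact Submodule.smul_mem _ _ hx

/-- Pair the orbit of `a` with a norming functional. The resulting continuous function on the torus
has zero Fourier coefficients, so it vanishes at `0`, where its value is `‖a‖`. -/
theorem eq_zero_of_component_eq_zero {a : d.CStar} (h : ∀ n, d.component n a = 0) : a = 0 := by
  by_contra ha
  obtain ⟨φ, -, hφ⟩ := exists_dual_vector ℂ a (norm_ne_zero_iff.2 ha)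
  let f : C(UnitAddTorus (Fin k), ℂ) :=
    ⟨fun t => φ (d.gauge (torusPoint t) a), φ.continuous.comp (d.continuous_gauge a)⟩
  have hf : mFourierCoeff f = 0 := by
    funext n
    have h1 := φ.integral_comp_comm (integrable_torus (d.continuous_integrand n a))
    have h2 : φ (d.component n a) = 0 := by rw [h, map_zero]
    rw [component, ← h1] at h2
    simp only [map_smul] at h2
    exact h2
  have h3 := hasSum_mFourier_series_apply_of_summable (f := f) (by rw [hf]; exact summable_zero) 0
  rw [hf] at h3
  simp only [Pi.zero_apply, zero_smul] at h3
  have h4 : f 0 = 0 := hasSum_zero.unique h3 |>.symm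
  have h5 : f 0 = φ a := by
    change φ (d.gauge (torusPoint 0) a) = _
    rw [torusPoint_zero, gauge_one]
  rw [h5, hφ] at h4
  simp at h4
  exact ha h4

variable {d} in
/-- A gauge-invariant closed ideal that contains no generating projection is zero. -/
theorem RowFinite.eq_zero_of_gauge_invariant (hr : d.RowFinite) {J : ClosedIdeal d.CStar}
    (hJ : ∀ z, ∀ a ∈ J, d.gauge z a ∈ J) (hJs : ∀ v, d.s (𝟙 v) ∉ J) {a : d.CStar} (ha : a ∈ J) :
    a = 0 := by
  refine d.eq_zero_of_component_eq_zero fun n => ?_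
  set b := d.component n a
  -- The characters by which `b` and `b*` are multiplied cancel. So `b* b` is its own component of
  -- degree `0`, which puts it in the closure of the core.
  have hfix : ∀ t, d.gauge (torusPoint t) (star b * b) = star b * b := fun t => by
    rw [map_mul, map_star, gauge_component, star_smul, smul_mul_smul_comm, Complex.star_def,
      ← mFourier_neg, ← mFourier_add, neg_add_cancel, mFourier_zero,
      ContinuousMap.one_apply, one_smul]
  rw [← CStarRing.star_mul_self_eq_zero_iff]
  refine hr.eq_zero_of_mem_closure_core hJs ?_ (J.mul_mem_left _ (d.component_mem hJ n ha))
  rw [← d.component_zero_of_fixed hfix]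
  exact hr.component_zero_mem _

end DegreeMap
open scoped ClosedIdeal.Quotient
namespace DegreeMap

variable {k : ℕ} {Λ : Type u} [Category.{v} Λ] {d : DegreeMap k Λ} {S H : Set Λ}

/-! ### Restrictions to sets of vertices -/

/-- The full subcategory of `Λ` on a set of vertices. -/
abbrev Verts (S : Set Λ) : Type u := ObjectProperty.FullSubcategory (fun v : Λ => v ∈ S)

/-- A path of the full subcategory as a path of `Λ`. -/
def embed {v : Verts S} (p : Σ w : Verts S, (w ⟶ v)) : Σ w : Λ, (w ⟶ v.obj) :=
  ⟨p.1.obj, p.2.hom⟩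

theorem embed_injective {v : Verts S} : Function.Injective (embed (v := v)) := by
  rintro ⟨⟨w, hw⟩, l⟩ ⟨⟨w', hw'⟩, l'⟩ h
  simp only [embed, Sigma.mk.injEq] at h
  obtain ⟨rfl, h⟩ := h
  rw [ObjectProperty.hom_ext _ (eq_of_heq h)]

theorem exists_embed {v : Verts S} (p : Σ w : Λ, (w ⟶ v.obj)) (hp : p.1 ∈ S) :
    ∃ q : Σ w : Verts S, (w ⟶ v), embed q = p :=
  ⟨⟨⟨p.1, hp⟩, ObjectProperty.homMk p.2⟩, rfl⟩

/-- Convexity of `S` keeps the intermediate vertex of a factorisation in `S`. -/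
theorem IsKGraph.restrict (hd : d.IsKGraph)
    (hS : ∀ ⦃w u v : Λ⦄, (w ⟶ u) → (u ⟶ v) → w ∈ S → v ∈ S → u ∈ S) :
    (d.restrict S).IsKGraph where
  countable_obj := by
    have := hd.countable_obj
    refine Function.Injective.countable (f := fun v : Verts S => v.obj) ?_
    rintro ⟨v, hv⟩ ⟨v', hv'⟩ h
    simp only at h
    subst h
    rfl
  countable_hom w v := by
    have := hd.countable_hom w.obj v.obj
    exact Function.Injective.countable (f := fun l : w ⟶ v => l.hom)
      fun l l' h => ObjectProperty.hom_ext _ h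
  factorisation {w v} l m n h := by
    obtain ⟨⟨u, a, b⟩, ⟨hab, hb, ha⟩, huniq⟩ := hd.factorisation l.hom m n h
    refine ⟨⟨⟨u, hS a b w.property v.property⟩, ObjectProperty.homMk a,
      ObjectProperty.homMk b⟩, ⟨ObjectProperty.hom_ext _ hab, hb, ha⟩, ?_⟩
    rintro ⟨⟨u', hu'⟩, a', b'⟩ ⟨hab', hb', ha'⟩
    have := huniq ⟨u', a'.hom, b'.hom⟩ ⟨congrArg (fun f => f.hom) hab', hb', ha'⟩
    simp only [Sigma.mk.injEq] at this
    obtain ⟨rfl, this⟩ := this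
    simp only [heq_eq_eq, Prod.mk.injEq] at this
    obtain ⟨rfl, rfl⟩ := this
    rfl

theorem RowFinite.restrict (hr : d.RowFinite) (S : Set Λ) : (d.restrict S).RowFinite :=
  fun v m => Set.Finite.preimage embed_injective.injOn (hr v.obj m)

/-- Every vertex in `S` that receives an edge of a given colour receives one with source in `S`. -/
def FollowsEdges (d : DegreeMap k Λ) (S : Set Λ) : Prop :=
  ∀ (i : Fin k) (w : Verts S), (d.paths (basisVec i) w.obj).Nonempty →
    ((d.restrict S).paths (basisVec i) w).Nonempty

theorem LocallyConvex.restrict (hc : d.LocallyConvex) (hS : d.FollowsEdges S) :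
    (d.restrict S).LocallyConvex := fun v i j hij l hl m hm => by
  obtain ⟨h1, h2⟩ := hc v.obj i j hij (embed l) hl (embed m) hm
  exact ⟨hS j l.1 h1, hS i m.1 h2⟩

/-- Maximality in `Λ^{≤ m}(v)` asks only whether edges of given colours exist at the source, and
`FollowsEdges` says that `S` and `Λ` give the same answer. -/
theorem FollowsEdges.mem_pathsUpTo_iff (hS : d.FollowsEdges S) {m : Fin k → ℕ} {v : Verts S}
    {p : Σ w : Verts S, (w ⟶ v)} :
    p ∈ (d.restrict S).pathsUpTo m v ↔ embed p ∈ d.pathsUpTo m v.obj := by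
  refine and_congr_right fun _ => forall_congr' fun i => imp_congr_right fun _ => ?_
  rw [← not_iff_not, ← ne_eq, ← ne_eq, ← Set.nonempty_iff_ne_empty, ← Set.nonempty_iff_ne_empty]
  exact ⟨fun ⟨q, hq⟩ => ⟨embed q, hq⟩, hS i p.1⟩

/-- This transfers the summation relation between `Λ` and its restriction, in either direction, once
the paths with source outside `S` contribute zero. -/
theorem FollowsEdges.sum_eq (hS : d.FollowsEdges S) {m : Fin k → ℕ} {v : Verts S}
    {T : Finset (Σ w : Verts S, (w ⟶ v))}
    (hT : (T : Set (Σ w : Verts S, (w ⟶ v))) = (d.restrict S).pathsUpTo m v)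
    {T' : Finset (Σ w : Λ, (w ⟶ v.obj))}
    (hT' : (T' : Set (Σ w : Λ, (w ⟶ v.obj))) = d.pathsUpTo m v.obj)
    {B : Type w} [AddCommMonoid B] (f : (Σ w : Λ, (w ⟶ v.obj)) → B)
    (hf : ∀ p, p.1 ∉ S → f p = 0) : ∑ p ∈ T, f (embed p) = ∑ p ∈ T', f p := by
  refine (Finset.sum_map T ⟨embed, embed_injective⟩ f).symm.trans ?_
  have hmem : ∀ q, q ∈ T ↔ embed q ∈ T' := fun q => by
    rw [← Finset.mem_coe, hT, ← Finset.mem_coe, hT', hS.mem_pathsUpTo_iff]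
  refine Finset.sum_subset ?_ ?_
  · intro p hp
    obtain ⟨q, hq, rfl⟩ := Finset.mem_map.1 hp
    exact (hmem q).1 hq
  · intro p hp hpT
    by_contra h
    have hpS : p.1 ∈ S := by
      by_contra hpS
      exact h (hf p hpS)
    obtain ⟨q, rfl⟩ := exists_embed p hpS
    exact hpT (Finset.mem_map.2 ⟨q, (hmem q).2 hp, rfl⟩)

theorem _root_.HigherRank.Hereditary.followsEdges (hH : Hereditary H) : d.FollowsEdges H :=
  fun i w ⟨p, hp⟩ => by
    obtain ⟨q, rfl⟩ := exists_embed p (hH p.2 w.property)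
    exact ⟨q, hp⟩

/-- Suppose that `w ∉ H` receives edges of colour `i`, all with source in `H`. The path of degree
`0` is then not in `Λ^{≤ e_i}(w)`, so all sources of this set are in `H`, and saturation gives `w ∈
H`. -/
theorem Saturated.followsEdges (hd : d.IsKGraph) (hs : d.Saturated H) : d.FollowsEdges Hᶜ := by
  intro i w ⟨p, hp⟩
  by_contra hne
  rw [Set.not_nonempty_iff_eq_empty] at hne
  refine w.property (hs w.obj i fun l hl => ?_)
  by_contra hlH
  by_cases hi : d.deg l.2 i = 0
  · have h0 : d.deg l.2 = 0 := by
      ext j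
      by_cases hj : j = i
      · rw [hj, hi, Pi.zero_apply]
      · simpa [basisVec, hj] using hl.1 j
    have h1 := hl.2 i ((add_basisVec_le_iff hl.1 i).2 (by simp [hi]))
    have h2 : l = ⟨w.obj, 𝟙 w.obj⟩ := hd.eq_id_of_deg l.2 h0
    rw [h2] at h1
    exact Set.notMem_empty p (h1 ▸ hp)
  · obtain ⟨q, rfl⟩ := exists_embed l hlH
    have : q ∈ (d.restrict Hᶜ).paths (basisVec i) w :=
      le_antisymm hl.1 ((basisVec_le_iff i _).2 (Nat.pos_of_ne_zero hi))
    rw [hne] at this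
    exact this

theorem _root_.HigherRank.Hereditary.convex (hH : Hereditary H) :
    ∀ ⦃w u v : Λ⦄, (w ⟶ u) → (u ⟶ v) → w ∈ H → v ∈ H → u ∈ H := fun _ _ _ _ b _ hv => hH b hv

theorem _root_.HigherRank.Hereditary.convex_compl (hH : Hereditary H) :
    ∀ ⦃w u v : Λ⦄, (w ⟶ u) → (u ⟶ v) → w ∈ Hᶜ → v ∈ Hᶜ → u ∈ Hᶜ :=
  fun _ _ _ a _ hw _ hu => hw (hH a hu)

/-! ### The quotient graph -/

/-- The image of the universal family in a C*-algebra, restricted to the paths in a full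
subcategory whose complement is killed. -/
theorem isCKFamily_restrict (hr : d.RowFinite) (hS : d.FollowsEdges S) {B : Type w}
    [NonUnitalCStarAlgebra B] (φ : d.CStar →⋆ₙₐ[ℂ] B)
    (hφ : ∀ v : Λ, v ∉ S → ∀ u : Verts S, (v ⟶ u.obj) → φ (d.s (𝟙 v)) = 0) :
    (d.restrict S).IsCKFamily (fun _ _ l => φ (d.s l.hom)) where
  partial_isometry _ _ l := by
    simp only [← map_star, ← map_mul, d.isCKFamily_s.partial_isometry l.hom]
  vertex_mul_self v := by
    rw [← map_mul]
    exact congrArg φ (d.isCKFamily_s.vertex_mul_self v.obj)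
  vertex_star v := by
    rw [← map_star]
    exact congrArg φ (d.isCKFamily_s.vertex_star v.obj)
  vertex_orthogonal v v' h := by
    have h' : v.obj ≠ v'.obj := fun h' => h (by cases v; cases v'; simp only at h'; subst h'; rfl)
    rw [← map_mul, ← map_zero φ]
    exact congrArg φ (d.isCKFamily_s.vertex_orthogonal v.obj v'.obj h')
  comp _ _ _ l m := by
    rw [← map_mul]
    exact congrArg φ (d.isCKFamily_s.comp l.hom m.hom)
  star_mul_self w _ l := by
    rw [← map_star, ← map_mul]
    exact congrArg φ (d.isCKFamily_s.star_mul_self l.hom)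
  sum v m T hT := by
    have h1 := congrArg φ (hr.s_id_eq_sum v.obj m)
    have h2 := hS.sum_eq hT (Set.Finite.coe_toFinset (finite_pathsUpTo hr m v.obj))
      (fun p => φ (d.s p.2 * star (d.s p.2))) (fun p hp => by
        rw [← d.s_mul_id p.2, map_mul, map_mul, hφ p.1 hp v p.2, mul_zero, zero_mul])
    rw [map_sum, ← h2] at h1
    simp only [map_mul, map_star] at h1
    exact h1

/-- The universal family of `Γ(Λ ∖ H)`, extended by zero to the paths with source in `H`. -/
def extendZero (d : DegreeMap k Λ) (hH : Hereditary H) ⦃w v : Λ⦄ (l : w ⟶ v) :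
    (d.restrict Hᶜ).CStar :=
  open Classical in
  if h : w ∈ Hᶜ then (d.restrict Hᶜ).s (ObjectProperty.homMk l :
    (⟨w, h⟩ : Verts Hᶜ) ⟶ ⟨v, fun hv => h (hH l hv)⟩) else 0

theorem extendZero_hom (hH : Hereditary H) {w v : Verts Hᶜ} (l : w ⟶ v) :
    d.extendZero hH l.hom = (d.restrict Hᶜ).s l := dif_pos w.property

theorem extendZero_of_mem (hH : Hereditary H) {w v : Λ} (l : w ⟶ v) (h : w ∈ H) :
    d.extendZero hH l = 0 := dif_neg fun hn => hn h

theorem exists_extendZero_eq (hH : Hereditary H) {w v : Λ} (l : w ⟶ v) (h : w ∉ H) :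
    ∃ hv : v ∈ Hᶜ, d.extendZero hH l = (d.restrict Hᶜ).s (ObjectProperty.homMk l :
      (⟨w, h⟩ : Verts Hᶜ) ⟶ ⟨v, hv⟩) :=
  ⟨fun hv => h (hH l hv), dif_pos h⟩

/-- Heredity makes the terms that start in `H` vanish consistently. Saturation enters in the
summation relation at `v ∉ H`: the surviving terms are exactly the set `Λ^{≤ m}(v)` of the quotient
graph. -/
theorem isCKFamily_extendZero (hd : d.IsKGraph) (hr : d.RowFinite) (hH : Hereditary H)
    (hs : d.Saturated H) :
    d.IsCKFamily (d.extendZero hH) where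
  partial_isometry w v l := by
    by_cases h : w ∈ H
    · rw [extendZero_of_mem hH l h, mul_zero]
    · obtain ⟨hv, e⟩ := exists_extendZero_eq (d := d) hH l h
      rw [e, (d.restrict Hᶜ).isCKFamily_s.partial_isometry]
  vertex_mul_self v := by
    by_cases h : v ∈ H
    · rw [extendZero_of_mem hH _ h, mul_zero]
    · exact (congrArg₂ (· * ·) (extendZero_hom hH (𝟙 (⟨v, h⟩ : Verts Hᶜ)))
        (extendZero_hom hH (𝟙 (⟨v, h⟩ : Verts Hᶜ)))).trans
        (((d.restrict Hᶜ).isCKFamily_s.vertex_mul_self ⟨v, h⟩).trans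
          (extendZero_hom hH (𝟙 (⟨v, h⟩ : Verts Hᶜ))).symm)
  vertex_star v := by
    by_cases h : v ∈ H
    · rw [extendZero_of_mem hH _ h, star_zero]
    · exact (congrArg star (extendZero_hom hH (𝟙 (⟨v, h⟩ : Verts Hᶜ)))).trans
        (((d.restrict Hᶜ).isCKFamily_s.vertex_star ⟨v, h⟩).trans
          (extendZero_hom hH (𝟙 (⟨v, h⟩ : Verts Hᶜ))).symm)
  vertex_orthogonal v v' hne := by
    by_cases h : v ∈ H
    · rw [extendZero_of_mem hH _ h, zero_mul]
    · by_cases h' : v' ∈ H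
      · rw [extendZero_of_mem hH (𝟙 v') h', mul_zero]
      · refine (congrArg₂ (· * ·) (extendZero_hom hH (𝟙 (⟨v, h⟩ : Verts Hᶜ)))
          (extendZero_hom hH (𝟙 (⟨v', h'⟩ : Verts Hᶜ)))).trans
          ((d.restrict Hᶜ).isCKFamily_s.vertex_orthogonal ⟨v, h⟩ ⟨v', h'⟩ ?_)
        exact fun e => hne (congrArg (fun x : Verts Hᶜ => x.obj) e)
  comp u w v l m := by
    by_cases h : u ∈ H
    · rw [extendZero_of_mem hH _ h, extendZero_of_mem hH _ h, mul_zero]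
    · obtain ⟨hw, em⟩ := exists_extendZero_eq (d := d) hH m h
      obtain ⟨hv, el⟩ := exists_extendZero_eq (d := d) hH l hw
      obtain ⟨_, e⟩ := exists_extendZero_eq (d := d) hH (m ≫ l) h
      rw [em, el, e]
      exact (d.restrict Hᶜ).isCKFamily_s.comp
        (ObjectProperty.homMk l : (⟨w, hw⟩ : Verts Hᶜ) ⟶ ⟨v, hv⟩)
        (ObjectProperty.homMk m : (⟨u, h⟩ : Verts Hᶜ) ⟶ ⟨w, hw⟩)
  star_mul_self w v l := by
    by_cases h : w ∈ H
    · rw [extendZero_of_mem hH _ h, extendZero_of_mem hH _ h, mul_zero]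
    · obtain ⟨hv, el⟩ := exists_extendZero_eq (d := d) hH l h
      rw [el]
      exact ((d.restrict Hᶜ).isCKFamily_s.star_mul_self
        (ObjectProperty.homMk l : (⟨w, h⟩ : Verts Hᶜ) ⟶ ⟨v, hv⟩)).trans
        (extendZero_hom hH (𝟙 (⟨w, h⟩ : Verts Hᶜ))).symm
  sum v m T hT := by
    by_cases h : v ∈ H
    · rw [extendZero_of_mem hH _ h]
      exact (Finset.sum_eq_zero fun p _ => by
        rw [extendZero_of_mem hH p.2 (hH p.2 h), zero_mul]).symm
    · have h1 := (hr.restrict Hᶜ).s_id_eq_sum ⟨v, h⟩ m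
      have h2 := (hs.followsEdges hd).sum_eq (v := ⟨v, h⟩)
        (Set.Finite.coe_toFinset (finite_pathsUpTo (hr.restrict Hᶜ) m ⟨v, h⟩)) hT
        (fun p => d.extendZero hH p.2 * star (d.extendZero hH p.2)) (fun p hp => by
          rw [extendZero_of_mem hH p.2 (not_not.1 hp), zero_mul])
      rw [← h2]
      exact (extendZero_hom hH (𝟙 (⟨v, h⟩ : Verts Hᶜ))).trans (h1.trans
        (Finset.sum_congr rfl fun p _ => by
          simp only [embed]
          rw [extendZero_hom]))

/-- The *-homomorphism of `C*(Λ)` onto `C*(Γ(Λ ∖ H))`. -/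
def toQuotientGraph (hd : d.IsKGraph) (hr : d.RowFinite) (hH : Hereditary H) (hs : d.Saturated H) :
    d.CStar →⋆ₙₐ[ℂ] (d.restrict Hᶜ).CStar := lift (isCKFamily_extendZero hd hr hH hs)

theorem toQuotientGraph_s (hd : d.IsKGraph) (hr : d.RowFinite) (hH : Hereditary H)
    (hs : d.Saturated H) {w v : Λ}
    (l : w ⟶ v) : toQuotientGraph hd hr hH hs (d.s l) = d.extendZero hH l := lift_s _ l

theorem s_id_mem_vertexIdeal {v : Λ} (hv : v ∈ H) : d.s (𝟙 v) ∈ d.vertexIdeal H :=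
  ClosedIdeal.subset_generatedBy _ ⟨v, hv, rfl⟩

theorem vertexIdeal_le {J : ClosedIdeal d.CStar} (h : ∀ v ∈ H, d.s (𝟙 v) ∈ J) :
    d.vertexIdeal H ≤ J :=
  ClosedIdeal.generatedBy_le (by rintro _ ⟨v, hv, rfl⟩; exact h v hv)

theorem toQuotientGraph_eq_zero (hd : d.IsKGraph) (hr : d.RowFinite) (hH : Hereditary H)
    (hs : d.Saturated H)
    {a : d.CStar} (ha : a ∈ d.vertexIdeal H) : toQuotientGraph hd hr hH hs a = 0 :=
  vertexIdeal_le (J := ClosedIdeal.ker (toQuotientGraph hd hr hH hs)) (fun v hv => by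
    rw [ClosedIdeal.mem_ker, toQuotientGraph_s, extendZero_of_mem hH _ hv]) ha

section FromQuotientGraph

variable (hd : d.IsKGraph) (hr : d.RowFinite) (hH : Hereditary H)
  (hs : d.Saturated H) (I : ClosedIdeal d.CStar)
  (hI : ∀ v ∈ H, d.s (𝟙 v) ∈ I)

/-- The *-homomorphism of `C*(Γ(Λ ∖ H))` to the quotient by an ideal that contains `I_H`. -/
def fromQuotientGraph : (d.restrict Hᶜ).CStar →⋆ₙₐ[ℂ] I.Quotient :=
  lift (isCKFamily_restrict hr (hs.followsEdges hd) (ClosedIdeal.Quotient.mkHom I)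
    fun v hv _ _ => (ClosedIdeal.Quotient.mk_eq_zero I).2 (hI v (not_not.1 hv)))

theorem fromQuotientGraph_s {w v : Verts Hᶜ} (l : w ⟶ v) :
    fromQuotientGraph hd hr hs I hI ((d.restrict Hᶜ).s l) = ClosedIdeal.Quotient.mk I (d.s l.hom) :=
  lift_s _ l

theorem fromQuotientGraph_toQuotientGraph (a : d.CStar) :
    fromQuotientGraph hd hr hs I hI (toQuotientGraph hd hr hH hs a) =
        ClosedIdeal.Quotient.mk I a := by
  have : (fromQuotientGraph hd hr hs I hI).comp (toQuotientGraph hd hr hH hs) =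
      ClosedIdeal.Quotient.mkHom I := by
    refine hom_ext fun w v l => ?_
    change fromQuotientGraph hd hr hs I hI (toQuotientGraph hd hr hH hs (d.s l)) =
      ClosedIdeal.Quotient.mk I (d.s l)
    rw [toQuotientGraph_s]
    by_cases h : w ∈ H
    · rw [extendZero_of_mem hH l h, map_zero]
      refine ((ClosedIdeal.Quotient.mk_eq_zero I).2 ?_).symm
      rw [← d.s_mul_id l]
      exact I.mul_mem_left _ (hI w h)
    · obtain ⟨hv, e⟩ := exists_extendZero_eq (d := d) hH l h
      rw [e, fromQuotientGraph_s]
      rfl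
  exact DFunLike.congr_fun this a

end FromQuotientGraph

/-- The quotient map by `I_H` factors through `C*(Γ(Λ ∖ H))`, so nothing outside `I_H` is killed. -/
theorem mem_vertexIdeal_iff (hd : d.IsKGraph) (hr : d.RowFinite) (hH : Hereditary H)
    (hs : d.Saturated H)
    {a : d.CStar} : a ∈ d.vertexIdeal H ↔ toQuotientGraph hd hr hH hs a = 0 := by
  refine ⟨toQuotientGraph_eq_zero hd hr hH hs, fun h => ?_⟩
  rw [← ClosedIdeal.Quotient.mk_eq_zero, ← fromQuotientGraph_toQuotientGraph hd hr hH hs _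
    (fun v hv => s_id_mem_vertexIdeal hv), h, map_zero]

/-- The quotient of `C*(Λ)` by `I_H` is `C*(Γ(Λ ∖ H))`. -/
theorem exists_quotient_equiv (hd : d.IsKGraph) (hr : d.RowFinite) (hH : Hereditary H)
    (hs : d.Saturated H) :
    ∃ φ : (d.vertexIdeal H).Quotient ≃⋆ₐ[ℂ] (d.restrict Hᶜ).CStar,
      ∀ (w v : Verts Hᶜ) (l : w ⟶ v),
        φ (ClosedIdeal.Quotient.mk (d.vertexIdeal H) (d.s l.hom)) = (d.restrict Hᶜ).s l := by
  let φ := ClosedIdeal.Quotient.liftHom (d.vertexIdeal H) (toQuotientGraph hd hr hH hs)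
    fun a ha => toQuotientGraph_eq_zero hd hr hH hs ha
  let ψ := fromQuotientGraph hd hr hs (d.vertexIdeal H) fun v hv => s_id_mem_vertexIdeal hv
  have h1 : ∀ l x, φ (ClosedIdeal.Quotient.mk _ x) = l → ψ l = ClosedIdeal.Quotient.mk _ x := by
    rintro _ x rfl
    exact fromQuotientGraph_toQuotientGraph hd hr hH hs _ _ x
  have hs' : ∀ (w v : Verts Hᶜ) (l : w ⟶ v),
      φ (ClosedIdeal.Quotient.mk (d.vertexIdeal H) (d.s l.hom)) = (d.restrict Hᶜ).s l := by
    intro w v l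
    exact (toQuotientGraph_s hd hr hH hs l.hom).trans (extendZero_hom hH l)
  have h2 : φ.comp ψ = NonUnitalStarAlgHom.id ℂ _ := by
    refine hom_ext fun w v l => ?_
    change φ (ψ _) = _
    rw [show ψ _ = _ from fromQuotientGraph_s hd hr hs _ _ l]
    exact hs' w v l
  refine ⟨StarAlgEquiv.ofBijective φ ⟨?_, fun y => ⟨ψ y, DFunLike.congr_fun h2 y⟩⟩, hs'⟩
  -- Injectivity of `φ` comes from its left inverse `ψ`.
  intro x y hxy
  obtain ⟨a, rfl⟩ := ClosedIdeal.Quotient.mk_surjective _ x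
  obtain ⟨b, rfl⟩ := ClosedIdeal.Quotient.mk_surjective _ y
  rw [← h1 _ a rfl, hxy, h1 _ b rfl]

/-! ### The lattice of gauge-invariant ideals -/

/-- For `v ∉ H` the image of `s_v` is a vertex projection of `C*(Γ(Λ ∖ H))`. It is nonzero because
the quotient graph is again a locally convex row-finite `k`-graph. -/
theorem s_id_mem_vertexIdeal_iff (hd : d.IsKGraph) (hr : d.RowFinite) (hc : d.LocallyConvex)
    (hH : Hereditary H) (hs : d.Saturated H) {v : Λ} :
    d.s (𝟙 v) ∈ d.vertexIdeal H ↔ v ∈ H := by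
  refine ⟨fun h => ?_, s_id_mem_vertexIdeal⟩
  by_contra hv
  rw [mem_vertexIdeal_iff hd hr hH hs, toQuotientGraph_s] at h
  exact s_vertex_ne_zero (hd.restrict hH.convex_compl) (hc.restrict (hs.followsEdges hd))
    (hr.restrict Hᶜ) ⟨v, hv⟩ ((extendZero_hom hH (𝟙 (⟨v, hv⟩ : Verts Hᶜ))).symm.trans h)

/-- The preimage of `I_H` under a gauge map is a closed ideal, and it contains the generators of
`I_H`, which the gauge action fixes. -/
theorem gauge_mem_vertexIdeal (H : Set Λ) (z : Fin k → Circle) {a : d.CStar}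
    (ha : a ∈ d.vertexIdeal H) : d.gauge z a ∈ d.vertexIdeal H := by
  rw [← ClosedIdeal.mem_comap]
  refine vertexIdeal_le (fun v hv => ?_) ha
  rw [ClosedIdeal.mem_comap, gauge_s, d.deg_id, torusPow_zero, one_smul]
  exact s_id_mem_vertexIdeal hv

variable (d) in
/-- The vertices whose projections are in an ideal. -/
def idealVerts (I : ClosedIdeal d.CStar) : Set Λ := {v | d.s (𝟙 v) ∈ I}

theorem s_mem_of_source_mem {I : ClosedIdeal d.CStar} {w v : Λ} (l : w ⟶ v)
    (h : d.s (𝟙 w) ∈ I) : d.s l ∈ I := by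
  rw [← d.s_mul_id l]
  exact I.mul_mem_left _ h

/-- This is the identity `s_{s(l)} = s_l* s_{r(l)} s_l`; saturation below is the summation relation
for `Λ^{≤ e_i}(v)`. -/
theorem hereditary_idealVerts (I : ClosedIdeal d.CStar) : Hereditary (d.idealVerts I) := by
  intro w v l (hv : d.s (𝟙 v) ∈ I)
  change d.s (𝟙 w) ∈ I
  rw [← d.isCKFamily_s.star_mul_self l, ← d.s_id_mul l]
  exact I.mul_mem_left _ (I.mul_mem_right _ hv)

theorem saturated_idealVerts (hr : d.RowFinite) (I : ClosedIdeal d.CStar) :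
    d.Saturated (d.idealVerts I) := by
  intro v i h
  change d.s (𝟙 v) ∈ I
  rw [hr.s_id_eq_sum v (basisVec i)]
  refine sum_mem fun p hp => I.mul_mem_right _ (s_mem_of_source_mem p.2 (h p ?_))
  exact (Set.Finite.mem_toFinset _).1 hp

/-- A gauge-invariant ideal is generated by the vertex projections in it. -/
theorem eq_vertexIdeal (hd : d.IsKGraph) (hr : d.RowFinite)
    (I : ClosedIdeal d.CStar) (hI : ∀ z, ∀ a ∈ I, d.gauge z a ∈ I) :
    d.vertexIdeal (d.idealVerts I) = I := by
  refine le_antisymm (vertexIdeal_le fun v hv => hv) fun a ha => ?_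
  have hH := hereditary_idealVerts I
  have hs := saturated_idealVerts hr I
  let θ := fromQuotientGraph hd hr hs I fun v hv => hv
  -- The gauge action descends to the quotient because `I` is invariant. `θ` intertwines it with the
  -- gauge action of the quotient graph, so the kernel of `θ` is gauge-invariant.
  let γ (z : Fin k → Circle) : I.Quotient →⋆ₙₐ[ℂ] I.Quotient :=
    ClosedIdeal.Quotient.liftHom I ((ClosedIdeal.Quotient.mkHom I).comp (d.gauge z))
      fun a ha => (ClosedIdeal.Quotient.mk_eq_zero I).2 (hI z a ha)
  have hγ : ∀ z, θ.comp ((d.restrict (d.idealVerts I)ᶜ).gauge z) = (γ z).comp θ := fun z => by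
    refine hom_ext fun w v l => ?_
    change θ ((d.restrict (d.idealVerts I)ᶜ).gauge z _) = γ z (θ _)
    rw [gauge_s, map_smul, show θ _ = _ from fromQuotientGraph_s hd hr hs I _ l]
    change _ = ClosedIdeal.Quotient.mk I (d.gauge z (d.s l.hom))
    rw [gauge_s, map_smul]
    rfl
  rw [mem_vertexIdeal_iff hd hr hH hs]
  -- For `a` in `I`, the image of `a` in `C*(Γ(Λ ∖ H))` is in the kernel of `θ`. That kernel
  -- contains no vertex projection, since `s_v ∈ I` would mean `v ∈ H`.
  refine (hr.restrict _).eq_zero_of_gauge_invariant (J := ClosedIdeal.ker θ) ?_ ?_ ?_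
  · intro z x hx
    rw [ClosedIdeal.mem_ker] at hx ⊢
    have := DFunLike.congr_fun (hγ z) x
    exact this.trans ((congrArg (γ z) hx).trans (map_zero _))
  · intro v hv
    rw [ClosedIdeal.mem_ker, show θ _ = _ from fromQuotientGraph_s hd hr hs I _ (𝟙 v)] at hv
    exact v.property ((ClosedIdeal.Quotient.mk_eq_zero I).1 hv)
  · rw [ClosedIdeal.mem_ker, show θ _ = _ from fromQuotientGraph_toQuotientGraph hd hr hH hs I _ a]
    exact (ClosedIdeal.Quotient.mk_eq_zero I).2 ha

/-- The lattice isomorphism of saturated hereditary sets and gauge-invariant ideals. -/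
def idealOrderIso (hd : d.IsKGraph) (hr : d.RowFinite) (hc : d.LocallyConvex) :
    d.SatHered ≃o d.GaugeIdeal where
  toFun H := ⟨d.vertexIdeal H.1, fun z _ ha => gauge_mem_vertexIdeal H.1 z ha⟩
  invFun I := ⟨d.idealVerts I.1, hereditary_idealVerts I.1, saturated_idealVerts hr I.1⟩
  left_inv H := Subtype.ext (Set.ext fun _ =>
    s_id_mem_vertexIdeal_iff hd hr hc H.2.1 H.2.2)
  right_inv I := Subtype.ext (eq_vertexIdeal hd hr I.1 I.2)
  map_rel_iff' {H K} := by
    refine ⟨fun h v hv => ?_, fun h => vertexIdeal_le fun v hv => s_id_mem_vertexIdeal (h hv)⟩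
    exact (s_id_mem_vertexIdeal_iff hd hr hc K.2.1 K.2.2).1
      (h (s_id_mem_vertexIdeal hv))

end DegreeMap

/-! ### Projections in the multiplier algebra as strict limits -/

section StrictLimit

variable {B : Type u} [NonUnitalCStarAlgebra B] {ι : Type v} {f : Filter ι} [f.NeBot] {p : ι → B}

theorem eq_of_forall_mul_eq {b c : B} (h : ∀ x, b * x = c * x) : b = c := by
  rw [← sub_eq_zero, ← CStarRing.mul_star_self_eq_zero_iff, sub_mul, h, sub_self]

theorem norm_le_one_of_isSelfAdjoint_of_mul_self {q : B} (h : star q = q) (h' : q * q = q) :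
    ‖q‖ ≤ 1 := by
  have h1 : ‖q‖ = ‖q‖ * ‖q‖ := by
    rw [← CStarRing.norm_star_mul_self, h, h']
  by_contra! hlt
  nlinarith

/-- The strict limit of a net of self-adjoint contractions is a multiplier. -/
theorem exists_strictLimit (hstar : ∀ i, star (p i) = p i) (hnorm : ∀ i, ‖p i‖ ≤ 1)
    (hlim : ∀ b, ∃ c, Filter.Tendsto (fun i => p i * b) f (nhds c)) :
    ∃ m : DoubleCentralizer ℂ B,
      (∀ b, Filter.Tendsto (fun i => p i * b) f (nhds (m.fst b))) ∧
      (∀ b, Filter.Tendsto (fun i => b * p i) f (nhds (m.snd b))) := by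
  choose g hg using hlim
  -- As the `p i` are self-adjoint, `b p_i = (p_i b*)*`, so left convergence gives right
  -- convergence.
  have hg' : ∀ b, Filter.Tendsto (fun i => b * p i) f (nhds (star (g (star b)))) := fun b => by
    refine (hg (star b)).star.congr fun i => ?_
    rw [star_mul, star_star, hstar]
  let L : B →ₗ[ℂ] B :=
    { toFun := g
      map_add' := fun a b => tendsto_nhds_unique (hg (a + b))
        (((hg a).add (hg b)).congr fun i => (mul_add _ _ _).symm)
      map_smul' := fun c a => tendsto_nhds_unique (hg (c • a))
        (((hg a).const_smul c).congr fun i => (mul_smul_comm _ _ _).symm) }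
  let R : B →ₗ[ℂ] B :=
    { toFun := fun b => star (g (star b))
      map_add' := fun a b => tendsto_nhds_unique (hg' (a + b))
        (((hg' a).add (hg' b)).congr fun i => (add_mul _ _ _).symm)
      map_smul' := fun c a => tendsto_nhds_unique (hg' (c • a))
        (((hg' a).const_smul c).congr fun i => (smul_mul_assoc _ _ _).symm) }
  have hL : ∀ b, ‖L b‖ ≤ 1 * ‖b‖ := fun b =>
    le_of_tendsto (hg b).norm (Filter.Eventually.of_forall fun i =>
      (norm_mul_le _ _).trans (mul_le_mul_of_nonneg_right (hnorm i) (norm_nonneg b)))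
  have hR : ∀ b, ‖R b‖ ≤ 1 * ‖b‖ := fun b => by
    have := hL (star b)
    rwa [norm_star, ← norm_star (L (star b))] at this
  refine ⟨⟨(L.mkContinuous 1 hL, R.mkContinuous 1 hR), fun x y => ?_⟩, hg, hg'⟩
  -- The compatibility condition of a double centralizer is the limit of `(x p_i) y = x (p_i y)`.
  refine tendsto_nhds_unique ((hg' x).mul_const y) (((hg y).const_mul x).congr fun i => ?_)
  exact (mul_assoc _ _ _).symm

variable {m : DoubleCentralizer ℂ B}
  (hfst : ∀ b, Filter.Tendsto (fun i => p i * b) f (nhds (m.fst b)))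
  (hsnd : ∀ b, Filter.Tendsto (fun i => b * p i) f (nhds (m.snd b)))

include hfst hsnd in
-- Let `j` run in `p_i p_j = p_i` to get `p_i m = p_i`, then let `i` run to get `m m = m`. The right
-- half of the multiplier follows from the left half by adjoints.
theorem isStarProjection_strictLimit (hstar : ∀ i, star (p i) = p i)
    (hmul : ∀ i, ∀ᶠ j in f, p i * p j = p i) : IsStarProjection m := by
  have hstar' : ∀ b, star (m.snd (star b)) = m.fst b := fun b => by
    refine tendsto_nhds_unique (hsnd (star b)).star ((hfst b).congr fun i => ?_)
    rw [star_mul, star_star, hstar]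
  have hp : ∀ i b, p i * m.fst b = p i * b := fun i b => by
    refine tendsto_nhds_unique ((hfst b).const_mul (p i)) (tendsto_const_nhds.congr' ?_)
    filter_upwards [hmul i] with j hj
    rw [← mul_assoc, hj]
  have hff : ∀ b, m.fst (m.fst b) = m.fst b := fun b =>
    tendsto_nhds_unique (hfst (m.fst b)) ((hfst b).congr fun i => (hp i b).symm)
  have hsf : ∀ b, m.snd b = star (m.fst (star b)) := fun b => by
    rw [← hstar', star_star, star_star]
  refine ⟨?_, ?_⟩
  · refine DoubleCentralizer.ext _ _ _ _ (Prod.ext ?_ ?_)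
    · exact ContinuousLinearMap.ext fun b => hff b
    · refine ContinuousLinearMap.ext fun b => ?_
      change m.snd (m.snd b) = m.snd b
      rw [hsf (m.snd b), hsf b, star_star, hff]
  · refine DoubleCentralizer.ext _ _ _ _ (Prod.ext ?_ ?_)
    · exact ContinuousLinearMap.ext fun b => hstar' b
    · refine ContinuousLinearMap.ext fun b => ?_
      change star (m.fst (star b)) = m.snd b
      rw [hsf]

include hfst in
theorem strictLimit_fst_mul (a b : B) : m.fst (a * b) = m.fst a * b :=
  tendsto_nhds_unique (hfst (a * b)) (((hfst a).mul_const b).congr fun _ => mul_assoc _ _ _)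

include hsnd in
theorem strictLimit_snd_mul (a b : B) : m.snd (a * b) = a * m.snd b :=
  tendsto_nhds_unique (hsnd (a * b))
    (((hsnd b).const_mul a).congr fun _ => (mul_assoc _ _ _).symm)

include hfst hsnd in
-- The compression `m a m` of an element of `B` is again an element of `B`, and the embedding of `B`
-- in its multiplier algebra is injective. So the corner can be computed inside `B`.
theorem coe_eq_compression_iff (a b : B) : (b : DoubleCentralizer ℂ B) =
    m * (a : DoubleCentralizer ℂ B) * m ↔ b = m.snd (m.fst a) := by
  have key : m * (a : DoubleCentralizer ℂ B) * m =
      ((m.snd (m.fst a) : B) : DoubleCentralizer ℂ B) := by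
    refine DoubleCentralizer.ext _ _ _ _ (Prod.ext ?_ ?_)
    · refine ContinuousLinearMap.ext fun x => ?_
      change m.fst (a * m.fst x) = m.snd (m.fst a) * x
      rw [strictLimit_fst_mul hfst, m.central]
    · refine ContinuousLinearMap.ext fun x => ?_
      change m.snd (m.snd x * a) = x * m.snd (m.fst a)
      rw [m.central, strictLimit_snd_mul hsnd]
  rw [key]
  refine ⟨fun h => eq_of_forall_mul_eq fun x => ?_, fun h => by rw [h]⟩
  exact congrArg (fun c : DoubleCentralizer ℂ B => c.fst x) h

end StrictLimit

namespace DegreeMap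

variable {k : ℕ} {Λ : Type u} [Category.{v} Λ] {d : DegreeMap k Λ} {H : Set Λ}

/-! ### Hereditary subgraphs -/

section Subgraph

variable (hd : d.IsKGraph) (hr : d.RowFinite) (hc : d.LocallyConvex) (hH : Hereditary H)

/-- The *-homomorphism of `C*(Λ(H))` to `C*(Λ)`. -/
def fromSubgraph : (d.restrict H).CStar →⋆ₙₐ[ℂ] d.CStar :=
  lift (isCKFamily_restrict hr hH.followsEdges (NonUnitalStarAlgHom.id ℂ d.CStar)
    -- By heredity no path leads from a vertex outside `H` to one in `H`, so nothing has to be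
    -- killed.
    fun _ hv u l => absurd (hH l u.property) hv)

theorem fromSubgraph_s {w v : Verts H} (l : w ⟶ v) :
    fromSubgraph hr hH ((d.restrict H).s l) = d.s l.hom := lift_s _ l

include hd hc in
-- The map intertwines the gauge actions, so its kernel is gauge-invariant, and it sends vertex
-- projections to vertex projections of `C*(Λ)`, which are nonzero.
theorem fromSubgraph_injective : Function.Injective (fromSubgraph hr hH) := by
  have hγ : ∀ z, (fromSubgraph hr hH).comp ((d.restrict H).gauge z) =
      (d.gauge z).comp (fromSubgraph hr hH) := fun z => by
    refine hom_ext fun w v l => ?_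
    change fromSubgraph hr hH ((d.restrict H).gauge z _) = d.gauge z (fromSubgraph hr hH _)
    rw [gauge_s, map_smul, fromSubgraph_s, gauge_s]
    rfl
  rw [injective_iff_map_eq_zero]
  intro a ha
  refine (hr.restrict H).eq_zero_of_gauge_invariant
    (J := ClosedIdeal.ker (fromSubgraph hr hH)) (fun z x hx => ?_) (fun v hv => ?_) ha
  · exact (DFunLike.congr_fun (hγ z) x).trans ((congrArg (d.gauge z) hx).trans (map_zero _))
  · rw [ClosedIdeal.mem_ker, fromSubgraph_s] at hv
    exact s_vertex_ne_zero hd hc hr v.obj hv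

theorem s_mem_rangeSubalgebra {w v : Λ} (l : w ⟶ v) (hv : v ∈ H) :
    d.s l ∈ d.rangeSubalgebra H :=
  subset_closure (NonUnitalStarAlgebra.subset_adjoin ℂ _ ⟨_, _, l, hv, rfl⟩)

theorem rangeSubalgebra_le {K : NonUnitalStarSubalgebra ℂ d.CStar}
    (hK : IsClosed (K : Set d.CStar)) (h : ∀ ⦃w v : Λ⦄ (l : w ⟶ v), v ∈ H → d.s l ∈ K) :
    d.rangeSubalgebra H ≤ K :=
  NonUnitalStarSubalgebra.topologicalClosure_minimal _ (NonUnitalStarAlgebra.adjoin_le (by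
    rintro _ ⟨w, v, l, hv, rfl⟩
    exact h l hv)) hK

theorem fromSubgraph_mem (x : (d.restrict H).CStar) :
    fromSubgraph hr hH x ∈ d.rangeSubalgebra H :=
  mem_of_forall_s_mem ((d.rangeSubalgebra H).comap (fromSubgraph hr hH))
    ((NonUnitalStarSubalgebra.isClosed_topologicalClosure _).preimage
      (continuous_starHom (fromSubgraph hr hH)))
    (fun w v l => by
      change fromSubgraph hr hH ((d.restrict H).s l) ∈ d.rangeSubalgebra H
      rw [fromSubgraph_s]
      exact s_mem_rangeSubalgebra l.hom v.property) x

include hd hr hc hH in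
/-- `C*(Λ(H))` is the subalgebra of `C*(Λ)` generated by the paths with range in `H`. -/
theorem exists_subgraph_equiv :
    ∃ φ : (d.restrict H).CStar ≃⋆ₐ[ℂ] d.rangeSubalgebra H,
      ∀ (w v : Verts H) (l : w ⟶ v), (φ ((d.restrict H).s l) : d.CStar) = d.s l.hom := by
  have hinj := fromSubgraph_injective hd hr hc hH
  let φ := NonUnitalStarAlgHom.codRestrict (fromSubgraph hr hH) (d.rangeSubalgebra H)
    (fromSubgraph_mem hr hH)
  refine ⟨StarAlgEquiv.ofBijective φ ⟨fun x y h => hinj (congrArg Subtype.val h), ?_⟩,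
    fun w v l => fromSubgraph_s hr hH l⟩
  rintro ⟨y, hy⟩
  have hle : d.rangeSubalgebra H ≤ NonUnitalStarAlgHom.range (fromSubgraph hr hH) := by
    refine rangeSubalgebra_le ?_ fun w v l hv => ?_
    -- An injective *-homomorphism is isometric, so its range is closed.
    · have := (NonUnitalStarAlgHom.isometry _ hinj).isClosedEmbedding.isClosed_range
      simpa using! this
    · exact ⟨(d.restrict H).s (ObjectProperty.homMk l : (⟨w, hH l hv⟩ : Verts H) ⟶ ⟨v, hv⟩),
        fromSubgraph_s hr hH _⟩
  obtain ⟨x, hx⟩ := hle hy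
  exact ⟨x, Subtype.ext hx⟩

theorem rangeSubalgebra_subset_vertexIdeal :
    (d.rangeSubalgebra H : Set d.CStar) ⊆ d.vertexIdeal H := by
  let K : NonUnitalStarSubalgebra ℂ d.CStar :=
    { (d.vertexIdeal H).toSubmodule with
      mul_mem' := fun {a b} _ hb => (d.vertexIdeal H).mul_mem_left a hb
      star_mem' := fun ha => (d.vertexIdeal H).star_mem ha }
  refine rangeSubalgebra_le (K := K) (d.vertexIdeal H).isClosed fun w v l hv => ?_
  change d.s l ∈ d.vertexIdeal H
  rw [← d.s_id_mul l]
  exact (d.vertexIdeal H).mul_mem_right _ (s_id_mem_vertexIdeal hv)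

end Subgraph

/-! ### The full corner -/

section Corner

open Classical in
variable (d) in
/-- The sum of the projections `s_v` over the vertices `v ∈ H` of a finite set. -/
def vertexSum (H : Set Λ) (F : Finset Λ) : d.CStar := ∑ v ∈ F with v ∈ H, d.s (𝟙 v)

theorem star_vertexSum (F : Finset Λ) : star (d.vertexSum H F) = d.vertexSum H F := by
  simp only [vertexSum, star_sum, star_s_id]

theorem vertexSum_mul_s (F : Finset Λ) {w v : Λ} (l : w ⟶ v) (hF : v ∈ F) (hv : v ∈ H) :
    d.vertexSum H F * d.s l = d.s l := by
  classical
  rw [vertexSum, Finset.sum_mul, Finset.sum_eq_single_of_mem v (Finset.mem_filter.2 ⟨hF, hv⟩),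
    s_id_mul]
  intro v' _ h
  exact d.s_mul_s_of_ne _ _ h

theorem vertexSum_mul_s_of_notMem (F : Finset Λ) {w v : Λ} (l : w ⟶ v) (hv : v ∉ H) :
    d.vertexSum H F * d.s l = 0 := by
  classical
  rw [vertexSum, Finset.sum_mul]
  refine Finset.sum_eq_zero fun v' hv' => d.s_mul_s_of_ne _ _ ?_
  rintro rfl
  exact hv (Finset.mem_filter.1 hv').2

theorem vertexSum_mul_vertexSum {F F' : Finset Λ} (h : F ⊆ F') :
    d.vertexSum H F * d.vertexSum H F' = d.vertexSum H F := by
  classical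
  have : d.vertexSum H F' * d.vertexSum H F = d.vertexSum H F := by
    conv_lhs => rw [vertexSum.eq_def (F := F), Finset.mul_sum]
    refine Finset.sum_congr rfl fun v hv => ?_
    rw [Finset.mem_filter] at hv
    exact vertexSum_mul_s F' (𝟙 v) (h hv.1) hv.2
  have h2 := congrArg star this
  rwa [star_mul, star_vertexSum, star_vertexSum] at h2

theorem norm_vertexSum_le (F : Finset Λ) : ‖d.vertexSum H F‖ ≤ 1 :=
  norm_le_one_of_isSelfAdjoint_of_mul_self (star_vertexSum F) (vertexSum_mul_vertexSum subset_rfl)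

/-- On `s_l s_m*` the net is eventually constant, with value the element itself or `0` according to
whether `r(l)` is in `H`. The partial sums are contractions, so convergence extends from the dense
span. -/
theorem RowFinite.exists_tendsto_vertexSum_mul (hr : d.RowFinite) (a : d.CStar) :
    ∃ b, Filter.Tendsto (fun F => d.vertexSum H F * a) Filter.atTop (nhds b) := by
  classical
  have hspan : ∀ x ∈ d.spanning,
      ∃ b, Filter.Tendsto (fun F => d.vertexSum H F * x) Filter.atTop (nhds b) := by
    intro x hx
    induction hx using Submodule.span_induction with
    | mem x h =>
      obtain ⟨w, v, v', l, m, rfl⟩ := h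
      by_cases hv : v ∈ H
      · refine ⟨d.s l * star (d.s m), tendsto_const_nhds.congr' ?_⟩
        filter_upwards [Filter.eventually_ge_atTop {v}] with F hF
        rw [← mul_assoc, vertexSum_mul_s F l (hF (by simp)) hv]
      · refine ⟨0, tendsto_const_nhds.congr fun F => ?_⟩
        rw [← mul_assoc, vertexSum_mul_s_of_notMem F l hv, zero_mul]
    | zero => exact ⟨0, by simp⟩
    | add x y _ _ hx hy =>
      obtain ⟨b, hb⟩ := hx
      obtain ⟨c, hc⟩ := hy
      exact ⟨b + c, (hb.add hc).congr fun F => (mul_add _ _ _).symm⟩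
    | smul c x _ hx =>
      obtain ⟨b, hb⟩ := hx
      exact ⟨c • b, (hb.const_smul c).congr fun F => (mul_smul_comm _ _ _).symm⟩
  refine cauchySeq_tendsto_of_complete (Metric.cauchySeq_iff'.2 fun ε hε => ?_)
  obtain ⟨x, hx, hax⟩ := Metric.mem_closure_iff.1 (hr.dense_spanning a) (ε / 3) (by positivity)
  obtain ⟨b, hb⟩ := hspan x hx
  obtain ⟨N, hN⟩ := Metric.cauchySeq_iff'.1 hb.cauchySeq (ε / 3) (by positivity)
  have hdist : ∀ F, dist (d.vertexSum H F * a) (d.vertexSum H F * x) < ε / 3 := fun F => by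
    rw [dist_eq_norm, ← mul_sub]
    rw [dist_eq_norm] at hax
    refine ((norm_mul_le _ _).trans
      (mul_le_mul_of_nonneg_right (norm_vertexSum_le F) (norm_nonneg _))).trans_lt ?_
    rwa [one_mul]
  refine ⟨N, fun F hF => ?_⟩
  calc dist (d.vertexSum H F * a) (d.vertexSum H N * a)
      ≤ dist (d.vertexSum H F * a) (d.vertexSum H F * x) +
          dist (d.vertexSum H F * x) (d.vertexSum H N * x) +
          dist (d.vertexSum H N * x) (d.vertexSum H N * a) := dist_triangle4 _ _ _ _
    _ < ε / 3 + ε / 3 + ε / 3 := by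
        have h3 := hdist N
        rw [dist_comm] at h3
        exact add_lt_add (add_lt_add (hdist F) (hN F hF)) h3
    _ = ε := by ring

variable {m : DoubleCentralizer ℂ d.CStar}
  (hfst : ∀ b, Filter.Tendsto (fun F => d.vertexSum H F * b) Filter.atTop (nhds (m.fst b)))
  (hsnd : ∀ b, Filter.Tendsto (fun F => b * d.vertexSum H F) Filter.atTop (nhds (m.snd b)))

include hfst in
theorem fst_s {w v : Λ} (l : w ⟶ v) (hv : v ∈ H) : m.fst (d.s l) = d.s l := by
  classical
  refine tendsto_nhds_unique (hfst _) (tendsto_const_nhds.congr' ?_)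
  filter_upwards [Filter.eventually_ge_atTop {v}] with F hF
  rw [vertexSum_mul_s F l (hF (by simp)) hv]

include hfst in
theorem fst_s_of_notMem {w v : Λ} (l : w ⟶ v) (hv : v ∉ H) : m.fst (d.s l) = 0 :=
  tendsto_nhds_unique (hfst _) (tendsto_const_nhds.congr fun F =>
    (vertexSum_mul_s_of_notMem F l hv).symm)

include hfst hsnd in
theorem snd_star (b : d.CStar) : m.snd (star b) = star (m.fst b) :=
  tendsto_nhds_unique (hsnd _) ((hfst b).star.congr fun F => by rw [star_mul, star_vertexSum])

include hfst hsnd in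
-- The compression of `s_l s_m*` is itself if both ranges are in `H`, and zero otherwise; density
-- and continuity do the rest.
theorem snd_fst_mem_rangeSubalgebra (hr : d.RowFinite) (a : d.CStar) :
    m.snd (m.fst a) ∈ d.rangeSubalgebra H := by
  have hcl : IsClosed (d.rangeSubalgebra H : Set d.CStar) :=
    NonUnitalStarSubalgebra.isClosed_topologicalClosure _
  refine closure_minimal (s := (d.spanning : Set d.CStar)) (fun x hx => ?_)
    (hcl.preimage (m.snd.continuous.comp m.fst.continuous)) (hr.dense_spanning a)
  change m.snd (m.fst x) ∈ d.rangeSubalgebra H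
  induction hx using Submodule.span_induction with
  | mem x h =>
    obtain ⟨w, v, v', l, l', rfl⟩ := h
    rw [strictLimit_fst_mul hfst]
    by_cases hv : v ∈ H
    · rw [fst_s hfst l hv, strictLimit_snd_mul hsnd, snd_star hfst hsnd]
      by_cases hv' : v' ∈ H
      · rw [fst_s hfst l' hv']
        exact mul_mem (s_mem_rangeSubalgebra l hv) (star_mem (s_mem_rangeSubalgebra l' hv'))
      · rw [fst_s_of_notMem hfst l' hv', star_zero, mul_zero]
        exact zero_mem _
    · rw [fst_s_of_notMem hfst l hv, zero_mul, map_zero]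
      exact zero_mem _
  | zero => rw [map_zero, map_zero]; exact zero_mem _
  | add x y _ _ hx hy => rw [map_add, map_add]; exact add_mem hx hy
  | smul c x _ hx => rw [map_smul, map_smul]; exact SMulMemClass.smul_mem c hx

include hfst hsnd in
theorem fst_eq_self (hH : Hereditary H) {b : d.CStar} (hb : b ∈ d.rangeSubalgebra H) :
    m.fst b = b ∧ m.snd b = b := by
  have hss : ∀ b, m.snd b = star (m.fst (star b)) := fun b => by
    rw [← snd_star hfst hsnd, star_star]
  -- The condition on the adjoint makes `K` star-closed. For the generators it needs heredity: `s_l*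
  -- = s_{s(l)} s_l*` with `s(l) ∈ H`.
  let K : NonUnitalStarSubalgebra ℂ d.CStar :=
    { carrier := {b | m.fst b = b ∧ m.fst (star b) = star b}
      add_mem' := fun {a b} ha hb => by
        refine ⟨?_, ?_⟩
        · rw [map_add, ha.1, hb.1]
        · rw [star_add, map_add, ha.2, hb.2]
      zero_mem' := by simp
      mul_mem' := fun {a b} ha hb => by
        refine ⟨?_, ?_⟩
        · rw [strictLimit_fst_mul hfst, ha.1]
        · rw [star_mul, strictLimit_fst_mul hfst, hb.2]
      smul_mem' := fun c {a} ha => by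
        refine ⟨?_, ?_⟩
        · rw [map_smul, ha.1]
        · rw [star_smul, map_smul, ha.2]
      star_mem' := fun {a} ha => ⟨ha.2, by rw [star_star, ha.1]⟩ }
  have hK : IsClosed (K : Set d.CStar) :=
    (isClosed_eq m.fst.continuous continuous_id).inter
      (isClosed_eq (m.fst.continuous.comp continuous_star) continuous_star)
  have hle : d.rangeSubalgebra H ≤ K := by
    refine rangeSubalgebra_le hK fun w v l hv => ⟨fst_s hfst l hv, ?_⟩
    rw [← d.id_mul_star_s l, strictLimit_fst_mul hfst, fst_s hfst _ (hH l hv)]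
  have h := hle hb
  exact ⟨h.1, by rw [hss, h.2, star_star]⟩

/-- The subalgebra generated by the paths with range in `H` is a full corner of `I_H`. -/
theorem isFullCorner_rangeSubalgebra (hr : d.RowFinite) (hH : Hereditary H) :
    IsFullCorner ((d.rangeSubalgebra H).comap
      (NonUnitalStarSubalgebraClass.subtype (d.vertexIdeal H))) := by
  classical
  obtain ⟨m, hfst, hsnd⟩ := exists_strictLimit (f := Filter.atTop) (p := d.vertexSum H)
    star_vertexSum norm_vertexSum_le hr.exists_tendsto_vertexSum_mul
  have hmem : ∀ F, d.vertexSum H F ∈ d.vertexIdeal H := fun F =>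
    sum_mem fun v hv => s_id_mem_vertexIdeal (Finset.mem_filter.1 hv).2
  let p : Finset Λ → d.vertexIdeal H := fun F => ⟨d.vertexSum H F, hmem F⟩
  have hlim : ∀ b : d.vertexIdeal H,
      ∃ c, Filter.Tendsto (fun F => p F * b) Filter.atTop (nhds c) := fun b =>
    ⟨⟨m.fst b, (d.vertexIdeal H).isClosed.mem_of_tendsto (hfst b)
      (Filter.Eventually.of_forall fun F => (d.vertexIdeal H).mul_mem_left _ b.2)⟩,
      tendsto_subtype_rng.2 (hfst b)⟩
  -- The corner projection `n` must be a multiplier of `I_H`, while the computations on generators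
  -- use the multiplier `m` of all of `C*(Λ)`; `n` is the restriction of `m`.
  obtain ⟨n, hnfst, hnsnd⟩ := exists_strictLimit (f := Filter.atTop) (p := p)
    (fun F => Subtype.ext (star_vertexSum F)) norm_vertexSum_le hlim
  have hn1 : ∀ b, ((n.fst b : d.vertexIdeal H) : d.CStar) = m.fst b := fun b =>
    tendsto_nhds_unique (tendsto_subtype_rng.1 (hnfst b)) (hfst b)
  have hn2 : ∀ b, ((n.snd b : d.vertexIdeal H) : d.CStar) = m.snd b := fun b =>
    tendsto_nhds_unique (tendsto_subtype_rng.1 (hnsnd b)) (hsnd b)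
  refine ⟨⟨n, isStarProjection_strictLimit hnfst hnsnd
    (fun F => Subtype.ext (star_vertexSum F)) (fun F => ?_), fun b => ?_⟩, fun J hJ => ?_⟩
  · filter_upwards [Filter.eventually_ge_atTop F] with F' hF'
    exact Subtype.ext (vertexSum_mul_vertexSum hF')
  · simp only [coe_eq_compression_iff hnfst hnsnd]
    change (b : d.CStar) ∈ d.rangeSubalgebra H ↔ _
    constructor
    · intro hb
      obtain ⟨h1, h2⟩ := fst_eq_self hfst hsnd hH hb
      exact ⟨b, Subtype.ext (by rw [hn2, hn1, h1, h2])⟩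
    · rintro ⟨a, rfl⟩
      rw [hn2, hn1]
      exact snd_fst_mem_rangeSubalgebra hfst hsnd hr a
  -- For fullness, `J` is also an ideal of `C*(Λ)`, and it contains the generators `s_v` of `I_H`.
  · have hle : d.vertexIdeal H ≤ (d.vertexIdeal H).ofIdeal J := vertexIdeal_le fun v hv => by
      have h := s_id_mem_vertexIdeal (d := d) hv
      exact (ClosedIdeal.mem_ofIdeal (d.vertexIdeal H) (x := ⟨_, h⟩)).2
        (hJ (s_mem_rangeSubalgebra (𝟙 v) hv))
    refine top_le_iff.1 fun x _ => ?_
    exact (ClosedIdeal.mem_ofIdeal _).1 (hle x.2)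

end Corner

end DegreeMap
end HigherRank
end

theorem theorem5p2 {k : ℕ} {Λ : Type u} [Category.{v} Λ] (d : HigherRank.DegreeMap k Λ)
    (hd : d.IsKGraph) (hr : d.RowFinite) (hc : d.LocallyConvex) :
    (∃ Φ : d.SatHered ≃o d.GaugeIdeal, ∀ H : d.SatHered, (Φ H).1 = d.vertexIdeal H.1) ∧
    (∀ H : Set Λ, HigherRank.Hereditary H → d.Saturated H →
      (d.restrict Hᶜ).IsKGraph ∧ (d.restrict Hᶜ).RowFinite ∧ (d.restrict Hᶜ).LocallyConvex ∧
      ∃ φ : (d.vertexIdeal H).Quotient ≃⋆ₐ[ℂ] (d.restrict Hᶜ).CStar,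
        ∀ (w v : ObjectProperty.FullSubcategory (fun v : Λ => v ∈ Hᶜ)) (l : w ⟶ v),
          φ (HigherRank.ClosedIdeal.Quotient.mk (d.vertexIdeal H) (d.s l.hom)) =
            (d.restrict Hᶜ).s l) ∧
    (∀ H : Set Λ, HigherRank.Hereditary H →
      (d.restrict H).IsKGraph ∧ (d.restrict H).RowFinite ∧ (d.restrict H).LocallyConvex ∧
      (∃ φ : (d.restrict H).CStar ≃⋆ₐ[ℂ] d.rangeSubalgebra H,
        ∀ (w v : ObjectProperty.FullSubcategory (fun v : Λ => v ∈ H)) (l : w ⟶ v),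
          (φ ((d.restrict H).s l) : d.CStar) = d.s l.hom) ∧
      (d.rangeSubalgebra H : Set d.CStar) ⊆ d.vertexIdeal H ∧
      HigherRank.IsFullCorner ((d.rangeSubalgebra H).comap
        (NonUnitalStarSubalgebraClass.subtype (d.vertexIdeal H)))) := by
  refine ⟨⟨HigherRank.DegreeMap.idealOrderIso hd hr hc, fun _ => rfl⟩, fun H hH hs => ?_,
    fun H hH => ?_⟩
  · exact ⟨hd.restrict hH.convex_compl, hr.restrict Hᶜ, hc.restrict (hs.followsEdges hd),
      HigherRank.DegreeMap.exists_quotient_equiv hd hr hH hs⟩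
  · exact ⟨hd.restrict hH.convex, hr.restrict H, hc.restrict hH.followsEdges,
      HigherRank.DegreeMap.exists_subgraph_equiv hd hr hc hH,
      HigherRank.DegreeMap.rangeSubalgebra_subset_vertexIdeal,
      HigherRank.DegreeMap.isFullCorner_rangeSubalgebra hr hH⟩
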